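/- Let $B$ be a smooth connected complex algebraic curve and let $\mathfrak E=(E,\phi)$ be a Higgs bundle on $B$: a vector bundle $E$ with an $\mathcal O_B$-linear morphism $\phi\colon E\to E\otimes\Omega^1_B$. For a vector bundle $F$ on an open set $U\subset B$ with a Higgs field $\psi\colon F\to F\otimes\Omega^1_U$, let $\mathrm{Hgrass}_1(F,\psi)$ denote the Grassmannian of rank 1 Higgs subbundles: the closed subscheme of the projective bundle $\mathbb P F=\operatorname{Proj}_U\operatorname{Sym}(F^\vee)$ of lines in $F$ which parametrizes the $\psi$-invariant lines; if $z_1,\dots,z_r$ are the homogeneous coordinates given by a local frame of $F$ and $(\psi_{ij})$ is the matrix of $\psi$ in this frame, with respect to a local generator of $\Omega^1_U$, it is given by the equations $\sum_k z_k(\psi_{jk}z_i-\psi_{ik}z_j)=0$. Let $U\subset B$ be a nonempty open subset on which the Jordan type of $\phi$ is constant, given by $$\bigl((\lambda_v,i_{vj})^{m_{vj}}\ \big|\ 1\le v\le s,\ 1\le j\le j_v\bigr),$$ with $j_v,i_{vj},m_{vj}\ge 1$ and, for each $v$, the $i_{vj}$ distinct. That is, $\lambda_1,\dots,\lambda_s\in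 H^0(U,\Omega^1_U)$ (functions on $U$, once $\Omega^1_U$ is trivialized) have distinct values at every closed point $x\in U$, and at every such point the Jordan form of $\phi_x\colon E_x\to E_x\otimes\Omega^1_{B,x}\cong E_x$ (for any isomorphism $\Omega^1_{B,x}\cong\mathbb C$) consists of exactly $m_{vj}$ Jordan blocks of size $i_{vj}$ with eigenvalue $\lambda_v(x)$, for $1\le v\le s$ and $1\le j\le j_v$. Then, for every $v$, the generalized eigensheaf $E_v\subset E_{|U}$ of $\phi$ relative to $\lambda_v$ is a $\phi$-invariant subbundle (with locally free quotient), so that $\mathfrak E_v=(E_v,\phi_{|E_v})$ is a Higgs bundle on $U$; each scheme $\mathrm{Hgrass}_1(\mathfrak E_v)$ is nonempty and connected; and the canonical morphism of $U$-schemes $$\coprod_{v=1}^s \mathrm{Hgrass}_1(\mathfrak E_v)\longrightarrow \mathrm{Hgrass}_1(\mathfrak E_{|U}),$$ induced by the inclusions $\mathfrak E_v\hookrightarrow\mathfrak E_{|U}$, is an isomorphism. Thus this is the decomposition of $\mathrm{Hgrass}_1(\mathfrak E_{|U})$ into its connected components. -/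

import Mathlib

open CategoryTheory Limits TopologicalSpace AlgebraicGeometry TensorProduct
open HomogeneousIdeal (irrelevant)

noncomputable section

namespace Higgs

universe u


section LineRing

variable (R : Type u) [CommRing R] (M : Type u) [AddCommGroup M] [Module R M]
  (Φ : Set (Module.End R M))

/-- The ideal of the symmetric algebra of the dual of `M` generated by the quadrics
`α · (β ∘ φ) - β · (α ∘ φ)` for `φ` in `Φ`. If `M` is free and `z_i` are the coordinates of a basis,
these are the equations `∑ k, z_k (φ_jk z_i - φ_ik z_j)`, saying that a line is `φ`-invariant. -/
def lineIdeal : Ideal (SymmetricAlgebra R (Module.Dual R M)) :=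
  Ideal.span {x | ∃ φ ∈ Φ, ∃ α β : Module.Dual R M,
    x = SymmetricAlgebra.ι R _ α * SymmetricAlgebra.ι R _ (β ∘ₗ φ)
      - SymmetricAlgebra.ι R _ β * SymmetricAlgebra.ι R _ (α ∘ₗ φ)}

/-- The homogeneous coordinate ring of the scheme of lines in `M` preserved by all `φ` in `Φ`, as a
closed subscheme of the projective bundle of lines in `M`. -/
def LineRing : Type u := SymmetricAlgebra R (Module.Dual R M) ⧸ lineIdeal R M Φ

instance : CommRing (LineRing R M Φ) :=
  inferInstanceAs (CommRing (SymmetricAlgebra R (Module.Dual R M) ⧸ lineIdeal R M Φ))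

instance : Algebra R (LineRing R M Φ) :=
  inferInstanceAs (Algebra R (SymmetricAlgebra R (Module.Dual R M) ⧸ lineIdeal R M Φ))

namespace LineRing

/-- The linear coordinates, given by the functionals on `M`. -/
def coord : Module.Dual R M →ₗ[R] LineRing R M Φ :=
  (Ideal.Quotient.mkₐ R (lineIdeal R M Φ)).toLinearMap ∘ₗ SymmetricAlgebra.ι R _

variable {R M Φ}

lemma coord_rel {φ : Module.End R M} (h : φ ∈ Φ) (α β : Module.Dual R M) :
    coord R M Φ α * coord R M Φ (β ∘ₗ φ) = coord R M Φ β * coord R M Φ (α ∘ₗ φ) := by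
  rw [← sub_eq_zero]
  exact Ideal.Quotient.eq_zero_iff_mem.mpr (Ideal.subset_span ⟨φ, h, α, β, rfl⟩)

variable {C : Type*} [CommRing C] [Algebra R C]

/-- The universal property of the line ring. -/
def lift (ℓ : Module.Dual R M →ₗ[R] C)
    (h : ∀ φ ∈ Φ, ∀ α β : Module.Dual R M, ℓ α * ℓ (β ∘ₗ φ) = ℓ β * ℓ (α ∘ₗ φ)) :
    LineRing R M Φ →ₐ[R] C :=
  Ideal.Quotient.liftₐ (lineIdeal R M Φ) (SymmetricAlgebra.lift ℓ) fun a ha ↦ by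
    have : lineIdeal R M Φ ≤ RingHom.ker (SymmetricAlgebra.lift ℓ) := by
      rw [lineIdeal, Ideal.span_le]
      rintro _ ⟨φ, hφ, α, β, rfl⟩
      simp [RingHom.mem_ker, h φ hφ α β]
    exact this ha

@[simp] lemma lift_coord (ℓ : Module.Dual R M →ₗ[R] C) (h) (α : Module.Dual R M) :
    lift (Φ := Φ) ℓ h (coord R M Φ α) = ℓ α := by
  simp only [lift, coord]
  erw [Ideal.Quotient.liftₐ_apply, Ideal.Quotient.lift_mk]
  exact SymmetricAlgebra.lift_ι_apply _ _

lemma algHom_ext {F G : LineRing R M Φ →ₐ[R] C}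
    (h : ∀ α, F (coord R M Φ α) = G (coord R M Φ α)) : F = G :=
  Ideal.Quotient.algHom_ext _ (SymmetricAlgebra.algHom_ext (LinearMap.ext h))

lemma ringHom_ext {C : Type*} [CommRing C] {F G : LineRing R M Φ →+* C}
    (h₀ : ∀ r, F (algebraMap R _ r) = G (algebraMap R _ r))
    (h : ∀ α, F (coord R M Φ α) = G (coord R M Φ α)) : F = G := by
  let := (F.comp (algebraMap R (LineRing R M Φ))).toAlgebra
  let F' : LineRing R M Φ →ₐ[R] C := { F with commutes' := fun _ ↦ rfl }
  let G' : LineRing R M Φ →ₐ[R] C := { G with commutes' := fun r ↦ (h₀ r).symm }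
  have : F' = G' := algHom_ext h
  exact RingHom.ext fun x ↦ DFunLike.congr_fun this x

variable (R M Φ) in
/-- The grading of the line ring by degree. -/
def deg (n : ℕ) : Submodule R (LineRing R M Φ) := LinearMap.range (coord R M Φ) ^ n

lemma coord_mem (α : Module.Dual R M) : coord R M Φ α ∈ deg R M Φ 1 := by
  simpa only [deg, pow_one] using LinearMap.mem_range_self _ α

instance : SetLike.GradedMonoid (deg R M Φ) :=
  inferInstanceAs (SetLike.GradedMonoid ((LinearMap.range (coord R M Φ) ^ ·) : ℕ → Submodule R _))

open DirectSum in
/-- The linear coordinates, as elements of degree one. -/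
def gradedCoord : Module.Dual R M →ₗ[R] ⨁ i, deg R M Φ i :=
  DirectSum.lof R ℕ (fun i => deg R M Φ i) 1 ∘ₗ
    (coord R M Φ).codRestrict _ fun m => coord_mem m

theorem gradedCoord_apply (m : Module.Dual R M) :
    gradedCoord m = DirectSum.of (fun i : ℕ => deg R M Φ i) 1 ⟨coord R M Φ m, coord_mem m⟩ :=
  rfl

open DirectSum in
/-- The decomposition of the line ring into its graded pieces. -/
def toGraded : LineRing R M Φ →ₐ[R] ⨁ i, deg R M Φ i :=
  lift (Φ := Φ) (C := DirectSum ℕ fun i ↦ deg R M Φ i) gradedCoord <| by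
    intro φ hφ α β
    rw [gradedCoord_apply, gradedCoord_apply, gradedCoord_apply, gradedCoord_apply,
      DirectSum.of_mul_of, DirectSum.of_mul_of]
    exact DirectSum.of_eq_of_gradedMonoid_eq (Sigma.subtype_ext rfl (coord_rel hφ α β))

instance gradedAlgebra : GradedAlgebra (deg R M Φ) :=
  GradedAlgebra.ofAlgHom _ toGraded
    (by
      refine algHom_ext (Φ := Φ) fun α ↦ ?_
      rw [AlgHom.comp_apply, toGraded, lift_coord, AlgHom.id_apply,
        gradedCoord_apply, DirectSum.coeAlgHom_of])
    fun i x => by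
    obtain ⟨x, hx⟩ := x
    dsimp only [Subtype.coe_mk, DirectSum.lof_eq_of]
    unfold deg at hx
    induction hx using Submodule.pow_induction_on_left' with
    | algebraMap r =>
      rw [AlgHom.commutes, DirectSum.algebraMap_apply]; rfl
    | add x y i hx hy ihx ihy =>
      rw [map_add, ihx, ihy, ← map_add]
      rfl
    | mem_mul m hm i x hx ih =>
      obtain ⟨_, rfl⟩ := hm
      rw [map_mul, ih, toGraded, lift_coord, gradedCoord_apply, DirectSum.of_mul_of]
      exact DirectSum.of_eq_of_gradedMonoid_eq (Sigma.subtype_ext (add_comm _ _) rfl)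

lemma irrelevant_le : (HomogeneousIdeal.irrelevant (deg R M Φ)).toIdeal ≤
    Ideal.span (Set.range (coord R M Φ)) := by
  rw [HomogeneousIdeal.toIdeal_irrelevant_le]
  rintro (_ | i) hi x hx
  · simp at hi
  · have hx' : x ∈ LinearMap.range (coord R M Φ) * deg R M Φ i := by
      rw [deg, ← pow_succ']; exact hx
    refine Submodule.mul_induction_on hx' ?_ ?_
    · rintro _ ⟨α, rfl⟩ n _
      exact Ideal.mul_mem_right _ _ (Ideal.subset_span ⟨α, rfl⟩)
    · exact fun x y hx hy ↦ Ideal.add_mem _ hx hy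


section Map

variable {S : Type u} [CommRing S] {N : Type u} [AddCommGroup N] [Module S N]
  {Ψ : Set (Module.End S N)}
  {T : Type u} [CommRing T] {P : Type u} [AddCommGroup P] [Module T P]
  {Θ : Set (Module.End T P)}

/-- The map `d` of dual modules carries the transpose of every `φ` in `Φ` to the transpose of some
`ψ` in `Ψ`. -/
def Compat (Φ : Set (Module.End R M)) (Ψ : Set (Module.End S N)) {g : R →+* S}
    (d : Module.Dual R M →ₛₗ[g] Module.Dual S N) : Prop :=
  ∀ φ ∈ Φ, ∃ ψ ∈ Ψ, ∀ α : Module.Dual R M, d (α ∘ₗ φ) = d α ∘ₗ ψ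

/-- The homomorphism of line rings induced by a map of dual modules. -/
def mapRingHom (g : R →+* S) (d : Module.Dual R M →ₛₗ[g] Module.Dual S N) (h : Compat Φ Ψ d) :
    LineRing R M Φ →+* LineRing S N Ψ :=
  letI := ((algebraMap S (LineRing S N Ψ)).comp g).toAlgebra
  (lift (Φ := Φ) (C := LineRing S N Ψ)
    { toFun := fun α ↦ coord S N Ψ (d α)
      map_add' := fun α β ↦ by rw [map_add, map_add]
      map_smul' := fun r α ↦ by
        rw [LinearMap.map_smulₛₗ, map_smul, Algebra.smul_def, Algebra.smul_def]; rfl }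
    (by
      intro φ hφ α β
      obtain ⟨ψ, hψ, H⟩ := h φ hφ
      simp only [LinearMap.coe_mk, AddHom.coe_mk, H]
      exact coord_rel hψ _ _)).toRingHom

variable (g : R →+* S) (d : Module.Dual R M →ₛₗ[g] Module.Dual S N) (h : Compat Φ Ψ d)

@[simp] lemma mapRingHom_algebraMap (r : R) :
    mapRingHom g d h (algebraMap R _ r) = algebraMap S _ (g r) := by
  let := ((algebraMap S (LineRing S N Ψ)).comp g).toAlgebra
  exact AlgHom.commutes _ r

@[simp] lemma mapRingHom_coord (α : Module.Dual R M) :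
    mapRingHom g d h (coord R M Φ α) = coord S N Ψ (d α) := by
  let := ((algebraMap S (LineRing S N Ψ)).comp g).toAlgebra
  exact lift_coord _ _ α

lemma mapRingHom_mem {n : ℕ} {x : LineRing R M Φ} (hx : x ∈ deg R M Φ n) :
    mapRingHom g d h x ∈ deg S N Ψ n := by
  unfold deg at hx
  induction hx using Submodule.pow_induction_on_left' with
  | algebraMap r =>
    rw [mapRingHom_algebraMap, deg, pow_zero]
    exact Submodule.algebraMap_mem _
  | add x y i hx hy ihx ihy =>
    rw [map_add]; exact add_mem ihx ihy
  | mem_mul m hm i x hx ih =>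
    obtain ⟨α, rfl⟩ := hm
    rw [map_mul, mapRingHom_coord, deg, pow_succ']
    exact Submodule.mul_mem_mul ⟨_, rfl⟩ ih

/-- The homomorphism of line rings, as a graded homomorphism. -/
def map : deg R M Φ →+*ᵍ deg S N Ψ where
  __ := mapRingHom g d h
  map_mem := mapRingHom_mem g d h

@[simp] lemma map_algebraMap (r : R) : map g d h (algebraMap R _ r) = algebraMap S _ (g r) :=
  mapRingHom_algebraMap g d h r

@[simp] lemma map_coord (α : Module.Dual R M) :
    map g d h (coord R M Φ α) = coord S N Ψ (d α) :=
  mapRingHom_coord g d h α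

lemma irrelevant_le_map (hd : Submodule.span S (Set.range d) = ⊤) :
    irrelevant (deg S N Ψ) ≤ (irrelevant (deg R M Φ)).map (map g d h) := by
  change (irrelevant (deg S N Ψ)).toIdeal ≤ ((irrelevant (deg R M Φ)).map (map g d h)).toIdeal
  refine irrelevant_le.trans (Ideal.span_le.mpr ?_)
  rintro _ ⟨β, rfl⟩
  have : β ∈ Submodule.span S (Set.range d) := hd ▸ Submodule.mem_top
  refine Submodule.span_induction (p := fun β _ ↦ coord S N Ψ β ∈
    ((irrelevant (deg R M Φ)).map (map g d h)).toIdeal) ?_ (by simp) ?_ ?_ this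
  · rintro _ ⟨α, rfl⟩
    rw [← map_coord g d h]
    exact Ideal.mem_map_of_mem _ (HomogeneousIdeal.mem_irrelevant_of_mem _ one_pos (coord_mem α))
  · intro x y _ _ hx hy
    rw [map_add]; exact Ideal.add_mem _ hx hy
  · intro s x _ hx
    rw [map_smul, Algebra.smul_def]; exact Ideal.mul_mem_left _ _ hx

end Map


section IsLoc

variable {S : Type u} [CommRing S] {N : Type u} [AddCommGroup N] [Module S N]
  (Φ : Set (Module.End R M)) (Ψ : Set (Module.End S N))

/-- A semilinear map of dual modules, compatible with the given endomorphisms, which is a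
localization away from `r`. -/
structure IsLoc {g : R →+* S} (r : R) (d : Module.Dual R M →ₛₗ[g] Module.Dual S N) : Prop where
  surj : ∀ β : Module.Dual S N, ∃ (k : ℕ) (α : Module.Dual R M), d α = g r ^ k • β
  inj : ∀ α : Module.Dual R M, d α = 0 → ∃ k : ℕ, r ^ k • α = 0
  compat : ∀ ψ ∈ Ψ, ∃ (k : ℕ), ∃ φ ∈ Φ, ∀ α : Module.Dual R M,
    d (α ∘ₗ φ) = g r ^ k • (d α ∘ₗ ψ)

end IsLoc

section Localization

variable {S : Type u} [CommRing S] [Algebra R S] {N : Type u} [AddCommGroup N] [Module S N]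
  {Ψ : Set (Module.End S N)} (r : R) [IsLocalization.Away r S]
  (d : Module.Dual R M →ₛₗ[algebraMap R S] Module.Dual S N) (h : Compat Φ Ψ d)

variable {r d}

lemma IsLoc.span_eq_top (H : IsLoc Φ Ψ r d) :
    Submodule.span S (Set.range d) = ⊤ := by
  refine eq_top_iff.mpr fun β _ ↦ ?_
  obtain ⟨k, α, hα⟩ := H.surj β
  have hu : IsUnit (algebraMap R S r ^ k) := (IsLocalization.Away.algebraMap_isUnit r).pow k
  have : β = hu.unit⁻¹.1 • d α := by
    rw [hα, smul_smul, hu.val_inv_mul, one_smul]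
  rw [this]
  exact Submodule.smul_mem _ _ (Submodule.subset_span ⟨α, rfl⟩)

lemma IsLoc.exists_map_eq (H : IsLoc Φ Ψ r d) {n : ℕ} {y : LineRing S N Ψ}
    (hy : y ∈ deg S N Ψ n) : ∃ (k : ℕ), ∃ x ∈ deg R M Φ n,
      map _ d h x = algebraMap S _ (algebraMap R S r) ^ k * y := by
  unfold deg at hy
  induction hy using Submodule.pow_induction_on_left' with
  | algebraMap s =>
    obtain ⟨k, a, ha⟩ := IsLocalization.Away.surj r s
    refine ⟨k, algebraMap R _ a, ?_, ?_⟩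
    · rw [deg, pow_zero]; exact Submodule.algebraMap_mem _
    · rw [map_algebraMap, ← ha, map_mul, map_pow, mul_comm]
  | add x y i hx hy ihx ihy =>
    obtain ⟨k, a, ha, ha'⟩ := ihx
    obtain ⟨l, b, hb, hb'⟩ := ihy
    refine ⟨k + l, r ^ l • a + r ^ k • b,
      add_mem (Submodule.smul_mem _ _ ha) (Submodule.smul_mem _ _ hb), ?_⟩
    rw [map_add, Algebra.smul_def, Algebra.smul_def, map_mul, map_mul, ha', hb', map_algebraMap,
      map_algebraMap]
    simp only [map_pow]
    ring
  | mem_mul m hm i x hx ih =>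
    obtain ⟨β, rfl⟩ := hm
    obtain ⟨k, α, hα⟩ := H.surj β
    obtain ⟨l, b, hb, hb'⟩ := ih
    refine ⟨k + l, coord R M Φ α * b, ?_, ?_⟩
    · rw [deg, pow_succ']; exact Submodule.mul_mem_mul ⟨_, rfl⟩ hb
    · rw [map_mul, map_coord, hα, hb', map_smul, Algebra.smul_def]
      simp only [map_pow]
      ring

lemma IsLoc.exists_of_map_eq_zero (H : IsLoc Φ Ψ r d) {x : LineRing R M Φ}
    (hx : map _ d h x = 0) : ∃ k : ℕ, algebraMap R _ r ^ k * x = 0 := by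
  let L := Localization.Away (algebraMap R (LineRing R M Φ) r)
  have hr : IsUnit (algebraMap R L r) := by
    rw [IsScalarTower.algebraMap_apply R (LineRing R M Φ) L]
    exact IsLocalization.Away.algebraMap_isUnit _
  let := (IsLocalization.Away.lift r hr : S →+* L).toAlgebra
  have : IsScalarTower R S L := .of_algebraMap_eq fun a ↦ (IsLocalization.Away.lift_eq r hr a).symm
  let d' : Module.Dual R M →ₗ[R] Module.Dual S N :=
    { toFun := d
      map_add' := map_add d
      map_smul' := fun a α ↦ by
        rw [LinearMap.map_smulₛₗ, algebraMap_smul]; rfl }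
  have hunit (x : Submonoid.powers r) : ∃ k : ℕ, x.1 = r ^ k := by
    obtain ⟨_, k, rfl⟩ := x; exact ⟨k, rfl⟩
  have hd' : IsLocalizedModule (Submonoid.powers r) d' := by
    constructor
    · rintro ⟨_, k, rfl⟩
      have hu : IsUnit (algebraMap R S (r ^ k)) := by
        rw [_root_.map_pow]; exact (IsLocalization.Away.algebraMap_isUnit r).pow k
      rw [Module.End.isUnit_iff]
      refine ⟨fun β γ e ↦ ?_, fun β ↦ ⟨hu.unit⁻¹.1 • β, ?_⟩⟩
      · simp only [Module.algebraMap_end_apply] at e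
        rw [← algebraMap_smul S (r ^ k) β, ← algebraMap_smul S (r ^ k) γ] at e
        exact hu.smul_left_cancel.mp e
      · simp only [Module.algebraMap_end_apply]
        rw [← algebraMap_smul S, smul_smul, hu.mul_val_inv, one_smul]
    · intro β
      obtain ⟨k, α, hα⟩ := H.surj β
      refine ⟨⟨α, ⟨r ^ k, k, rfl⟩⟩, ?_⟩
      change (r ^ k) • β = d α
      rw [hα, ← algebraMap_smul S, map_pow]
    · intro α β e
      obtain ⟨k, hk⟩ := H.inj (α - β) (by rw [map_sub, sub_eq_zero]; exact e)
      refine ⟨⟨r ^ k, k, rfl⟩, ?_⟩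
      change r ^ k • α = r ^ k • β
      rwa [smul_sub, sub_eq_zero] at hk
  let c : Module.Dual R M →ₗ[R] L :=
    (IsScalarTower.toAlgHom R (LineRing R M Φ) L).toLinearMap ∘ₗ coord R M Φ
  have hcu (x : Submonoid.powers r) : IsUnit (algebraMap R (Module.End R L) x) := by
    obtain ⟨_, k, rfl⟩ := x
    rw [map_pow]
    refine IsUnit.pow k ?_
    rw [Module.End.isUnit_iff]
    refine ⟨fun β γ e ↦ ?_, fun β ↦ ⟨hr.unit⁻¹.1 * β, ?_⟩⟩
    · simp only [Module.algebraMap_end_apply, Algebra.smul_def] at e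
      exact hr.mul_left_cancel e
    · simp only [Module.algebraMap_end_apply, Algebra.smul_def]
      rw [← mul_assoc, hr.mul_val_inv, one_mul]
  let ℓ₀ : Module.Dual S N →ₗ[R] L := IsLocalizedModule.lift (.powers r) d' c hcu
  let ℓ : Module.Dual S N →ₗ[S] L := ℓ₀.extendScalarsOfIsLocalization (.powers r) S
  have hℓ (α : Module.Dual R M) : ℓ (d α) = algebraMap _ L (coord R M Φ α) :=
    IsLocalizedModule.lift_apply (.powers r) d' c hcu α
  have hu (k : ℕ) : IsUnit (algebraMap S L (algebraMap R S r) ^ k) := by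
    rw [← IsScalarTower.algebraMap_apply]; exact hr.pow k
  let F : LineRing S N Ψ →ₐ[S] L := lift ℓ (by
    intro ψ hψ β γ
    obtain ⟨k, φ, hφ, H'⟩ := H.compat ψ hψ
    have key (α : Module.Dual R M) : algebraMap S L (algebraMap R S r) ^ k * ℓ (d α ∘ₗ ψ) =
        algebraMap _ L (coord R M Φ (α ∘ₗ φ)) := by
      rw [← hℓ, H', map_smul, Algebra.smul_def, map_pow]
    obtain ⟨k₁, a, ha⟩ := H.surj β
    obtain ⟨k₂, b, hb⟩ := H.surj γ
    refine ((hu k).mul (hu (k₁ + k₂))).mul_left_cancel ?_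
    have e₁ := hℓ a
    have e₂ := hℓ b
    have e₃ := key a
    have e₄ := key b
    have e₅ := congr(algebraMap _ L $(coord_rel hφ a b))
    rw [ha, map_smul, Algebra.smul_def, map_pow] at e₁
    rw [hb, map_smul, Algebra.smul_def, map_pow] at e₂
    rw [ha, LinearMap.smul_comp, map_smul, Algebra.smul_def, map_pow] at e₃
    rw [hb, LinearMap.smul_comp, map_smul, Algebra.smul_def, map_pow] at e₄
    rw [map_mul, map_mul, ← e₁, ← e₂, ← e₃, ← e₄] at e₅
    linear_combination e₅)
  have hF : (F.toRingHom.comp (mapRingHom _ d h)) = algebraMap (LineRing R M Φ) L := by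
    refine ringHom_ext (fun a ↦ ?_) fun α ↦ ?_
    · change F (mapRingHom _ d h _) = _
      rw [mapRingHom_algebraMap, AlgHom.commutes, ← IsScalarTower.algebraMap_apply,
        ← IsScalarTower.algebraMap_apply]
    · change F (mapRingHom _ d h _) = _
      rw [mapRingHom_coord, lift_coord, hℓ]
  have : algebraMap (LineRing R M Φ) L x = 0 := by
    rw [← hF]
    change F (map _ d h x) = 0
    rw [hx, map_zero]
  rw [IsLocalization.map_eq_zero_iff (.powers (algebraMap R (LineRing R M Φ) r))] at this
  obtain ⟨⟨_, k, rfl⟩, hk⟩ := this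
  exact ⟨k, hk⟩


open HomogeneousLocalization in
lemma IsLoc.isPushout_away (H : IsLoc Φ Ψ r d) (α : Module.Dual R M) :
    IsPushout (CommRingCat.ofHom (algebraMap R S))
      (CommRingCat.ofHom ((fromZeroRingHom (deg R M Φ) (.powers (coord R M Φ α))).comp
        (algebraMap R (deg R M Φ 0))))
      (CommRingCat.ofHom ((fromZeroRingHom (deg S N Ψ) (.powers (map _ d h (coord R M Φ α)))).comp
        (algebraMap S (deg S N Ψ 0))))
      (CommRingCat.ofHom (Away.map (map _ d h) (coord R M Φ α))) := by
  set a := coord R M Φ α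
  set g := map (algebraMap R S) d h
  have ha : a ∈ deg R M Φ 1 := coord_mem α
  let A₁ := Away (deg R M Φ) a
  let A₂ := Away (deg S N Ψ) (g a)
  let f₁ : R →+* A₁ := (fromZeroRingHom (deg R M Φ) (.powers a)).comp (algebraMap R (deg R M Φ 0))
  let f₂ : S →+* A₂ :=
    (fromZeroRingHom (deg S N Ψ) (.powers (g a))).comp (algebraMap S (deg S N Ψ 0))
  let e : A₁ →+* A₂ := Away.map g a
  have val₁ (x : R) : (f₁ x).val = algebraMap _ _ (algebraMap R (LineRing R M Φ) x) := rfl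
  have val₂ (x : S) : (f₂ x).val = algebraMap _ _ (algebraMap S (LineRing S N Ψ) x) := rfl
  have comm : e.comp f₁ = f₂.comp (algebraMap R S) := by
    refine RingHom.ext fun x ↦ ?_
    have : f₁ x = Away.mk _ ha 0 (algebraMap R _ x) (by
        rw [zero_smul, deg, pow_zero]; exact Submodule.algebraMap_mem _) := by
      ext
      rw [val₁, Away.val_mk]
      simp only [pow_zero]
      rfl
    apply HomogeneousLocalization.val_injective
    change (e (f₁ x)).val = (f₂ (algebraMap R S x)).val
    rw [val₂, this]
    change (Away.map g a _).val = _
    rw [Away.map_mk, Away.val_mk]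
    simp only [pow_zero, g, map_algebraMap]
    rfl
  let : Algebra A₁ A₂ := e.toAlgebra
  have hu : IsUnit (f₂ (algebraMap R S r)) := (IsLocalization.Away.algebraMap_isUnit r).map f₂
  have hloc : IsLocalization ((Submonoid.powers r).map f₁) A₂ := by
    have hsub (k : ℕ) : f₁ r ^ k ∈ (Submonoid.powers r).map f₁ :=
      ⟨r ^ k, ⟨k, rfl⟩, _root_.map_pow f₁ r k⟩
    have he (x : R) : e (f₁ x) = f₂ (algebraMap R S x) := congr($comm x)
    refine ⟨?_, ?_, ?_⟩
    · rintro ⟨_, _, ⟨k, rfl⟩, rfl⟩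
      change IsUnit (e (f₁ (r ^ k)))
      rw [he, _root_.map_pow, _root_.map_pow]
      exact hu.pow k
    · intro z
      obtain ⟨n, y, hy, rfl⟩ := Away.mk_surjective (𝒜 := deg S N Ψ) (f := g a) (g.2 ha) z
      obtain ⟨k, x, hx, e'⟩ := H.exists_map_eq h hy
      refine ⟨⟨Away.mk _ ha n x hx, ⟨f₁ r ^ k, hsub k⟩⟩, ?_⟩
      change _ * e (f₁ r ^ k) = e _
      rw [_root_.map_pow, he]
      change _ = Away.map g a _
      rw [Away.map_mk]
      ext
      rw [val_mul, val_pow, val₂, Away.val_mk, Away.val_mk, e', ← Localization.mk_one_eq_algebraMap,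
        Localization.mk_pow, Localization.mk_mul]
      congr 1
      · ring
      · simp
    · intro x y exy
      obtain ⟨n, x, hx, rfl⟩ := Away.mk_surjective (𝒜 := deg R M Φ) (f := a) ha x
      obtain ⟨m, y, hy, rfl⟩ := Away.mk_surjective (𝒜 := deg R M Φ) (f := a) ha y
      change Away.map g a _ = Away.map g a _ at exy
      rw [Away.map_mk, Away.map_mk, HomogeneousLocalization.ext_iff_val, Away.val_mk, Away.val_mk,
        Localization.mk_eq_mk_iff, Localization.r_iff_exists] at exy
      obtain ⟨⟨_, l, rfl⟩, hl⟩ := exy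
      simp only at hl
      have : g (a ^ l * (a ^ m * x) - a ^ l * (a ^ n * y)) = 0 := by
        rw [map_sub, map_mul, map_mul, map_mul, map_mul, map_pow, map_pow, map_pow, hl, sub_self]
      obtain ⟨k, hk⟩ := H.exists_of_map_eq_zero h this
      refine ⟨⟨f₁ r ^ k, hsub k⟩, ?_⟩
      ext
      rw [val_mul, val_mul, val_pow, val₁, Away.val_mk, Away.val_mk, ← Localization.mk_one_eq_algebraMap,
        Localization.mk_pow, Localization.mk_mul, Localization.mk_mul, Localization.mk_eq_mk_iff,
        Localization.r_iff_exists]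
      refine ⟨⟨_, l, rfl⟩, ?_⟩
      simp only [one_pow, one_mul]
      linear_combination hk
  exact (CommRingCat.isPushout_of_isLocalization f₁ f₂ comm.symm (.powers r)).flip

end Localization

end LineRing
end LineRing

section

namespace LineRing

variable {R : Type u} [CommRing R] {M : Type u} [AddCommGroup M] [Module R M]
  {Φ : Set (Module.End R M)}
variable {S : Type u} [CommRing S] {N : Type u} [AddCommGroup N] [Module S N]
  {Ψ : Set (Module.End S N)}
variable {T : Type u} [CommRing T] {P : Type u} [AddCommGroup P] [Module T P]
  {Θ : Set (Module.End T P)}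

variable (R M Φ) in
/-- The structure morphism of `Proj` of the line ring. -/
def base : Proj (deg R M Φ) ⟶ Spec (.of R) :=
  Proj.toSpecZero (deg R M Φ) ≫ Spec.map (CommRingCat.ofHom (algebraMap R (deg R M Φ 0)))

/-- The morphism of `Proj`s induced by a compatible map of dual modules. -/
def projMap (g : R →+* S) (d : Module.Dual R M →ₛₗ[g] Module.Dual S N) (h : Compat Φ Ψ d)
    (hd : Submodule.span S (Set.range d) = ⊤) : Proj (deg S N Ψ) ⟶ Proj (deg R M Φ) :=
  Proj.map (map g d h) (irrelevant_le_map g d h hd)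

variable (R M Φ) in
/-- The standard affine charts. -/
def chart (α : Module.Dual R M) :
    Spec (.of <| HomogeneousLocalization.Away (deg R M Φ) (coord R M Φ α)) ⟶ Proj (deg R M Φ) :=
  Proj.awayι (deg R M Φ) (coord R M Φ α) (coord_mem α) one_pos

variable (R M Φ) in
/-- The cover by the standard affine charts. -/
def chartCover : (Proj (deg R M Φ)).AffineOpenCover :=
  Proj.affineOpenCoverOfIrrelevantLESpan _ (coord R M Φ) (fun α ↦ coord_mem α)
    (fun _ ↦ one_pos) irrelevant_le

lemma awayι_base {n : ℕ} (a : LineRing R M Φ) (ha : a ∈ deg R M Φ n) (hn : 0 < n) :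
    Proj.awayι (deg R M Φ) a ha hn ≫ base R M Φ = Spec.map (CommRingCat.ofHom
      ((HomogeneousLocalization.fromZeroRingHom (deg R M Φ) (.powers a)).comp
        (algebraMap R (deg R M Φ 0)))) := by
  unfold base
  rw [Proj.awayι_toSpecZero_assoc, ← Spec.map_comp]
  rfl

lemma awayMap_fromZero (g : R →+* S) (d : Module.Dual R M →ₛₗ[g] Module.Dual S N)
    (h : Compat Φ Ψ d) {n : ℕ} (a : LineRing R M Φ) (ha : a ∈ deg R M Φ n) :
    (HomogeneousLocalization.Away.map (map g d h) a).comp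
      ((HomogeneousLocalization.fromZeroRingHom (deg R M Φ) (.powers a)).comp
        (algebraMap R (deg R M Φ 0))) =
    ((HomogeneousLocalization.fromZeroRingHom (deg S N Ψ) (.powers (map g d h a))).comp
        (algebraMap S (deg S N Ψ 0))).comp g := by
  ext x
  change (HomogeneousLocalization.Away.map (map g d h) _
    (HomogeneousLocalization.fromZeroRingHom _ _ (algebraMap R (deg R M Φ 0) x))).val = _
  have : HomogeneousLocalization.fromZeroRingHom _ (.powers a) (algebraMap R (deg R M Φ 0) x) =
      HomogeneousLocalization.Away.mk _ ha 0 (algebraMap R _ x) (by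
        rw [zero_smul, deg, pow_zero]; exact Submodule.algebraMap_mem _) := by
    ext
    rw [HomogeneousLocalization.Away.val_mk]
    simp only [pow_zero]
    rfl
  rw [this, HomogeneousLocalization.Away.map_mk, HomogeneousLocalization.Away.val_mk]
  simp only [pow_zero, map_algebraMap]
  rfl

lemma projMap_base (g : R →+* S) (d : Module.Dual R M →ₛₗ[g] Module.Dual S N) (h : Compat Φ Ψ d)
    (hd : Submodule.span S (Set.range d) = ⊤) :
    projMap g d h hd ≫ base R M Φ = base S N Ψ ≫ Spec.map (CommRingCat.ofHom g) := by
  refine (Proj.mapAffineOpenCover _ (irrelevant_le_map g d h hd)).openCover.hom_ext _ _ ?_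
  suffices ∀ (i : ℕ) (hi : 0 < i) (a : LineRing R M Φ) (ha : a ∈ deg R M Φ i),
      Proj.awayι (deg S N Ψ) (map g d h a) ((map g d h).2 ha) hi ≫ projMap g d h hd ≫ base R M Φ =
      Proj.awayι (deg S N Ψ) (map g d h a) ((map g d h).2 ha) hi ≫
        base S N Ψ ≫ Spec.map (CommRingCat.ofHom g) from
    fun s ↦ this s.1 s.1.2 s.2.1 s.2.2
  intro i hi a ha
  refine (Proj.awayι_comp_map_assoc (map g d h) (irrelevant_le_map g d h hd) hi a ha
    (base R M Φ)).trans ?_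
  rw [awayι_base, ← Category.assoc, awayι_base, ← Spec.map_comp, ← Spec.map_comp,
    ← CommRingCat.ofHom_comp, ← CommRingCat.ofHom_comp, awayMap_fromZero g d h a ha]

lemma proj_map_congr (f f' : deg R M Φ →+*ᵍ deg S N Ψ)
    (hf : irrelevant (deg S N Ψ) ≤ (irrelevant (deg R M Φ)).map f)
    (hf' : irrelevant (deg S N Ψ) ≤ (irrelevant (deg R M Φ)).map f') (e : ∀ x, f x = f' x) :
    Proj.map f hf = Proj.map f' hf' := by
  have : f = f' := DFunLike.ext _ _ e
  subst this
  rfl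

lemma projMap_congr (g : R →+* S) (d d' : Module.Dual R M →ₛₗ[g] Module.Dual S N)
    (h : Compat Φ Ψ d) (h' : Compat Φ Ψ d')
    (hd : Submodule.span S (Set.range d) = ⊤) (hd' : Submodule.span S (Set.range d') = ⊤)
    (e : ∀ α, d α = d' α) : projMap g d h hd = projMap g d' h' hd' := by
  obtain rfl : d = d' := LinearMap.ext e
  rfl

lemma projMap_id (g : R →+* R) (d : Module.Dual R M →ₛₗ[g] Module.Dual R M) (h : Compat Φ Φ d)
    (hd : Submodule.span R (Set.range d) = ⊤) (hg : ∀ r, g r = r) (hd' : ∀ α, d α = α) :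
    projMap g d h hd = 𝟙 _ := by
  rw [← Proj.map_id]
  refine proj_map_congr _ _ _ _ fun x ↦ ?_
  change mapRingHom g d h x = RingHom.id _ x
  congr 1
  refine ringHom_ext (fun r ↦ ?_) fun α ↦ ?_
  · simp [hg]
  · simp [hd']

lemma projMap_comp (g : R →+* S) (d : Module.Dual R M →ₛₗ[g] Module.Dual S N) (h : Compat Φ Ψ d)
    (hd : Submodule.span S (Set.range d) = ⊤)
    (g' : S →+* T) (d' : Module.Dual S N →ₛₗ[g'] Module.Dual T P) (h' : Compat Ψ Θ d')
    (hd' : Submodule.span T (Set.range d') = ⊤)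
    (g'' : R →+* T) (d'' : Module.Dual R M →ₛₗ[g''] Module.Dual T P) (h'' : Compat Φ Θ d'')
    (hd'' : Submodule.span T (Set.range d'') = ⊤)
    (e : ∀ r, g'' r = g' (g r)) (e' : ∀ α, d'' α = d' (d α)) :
    projMap g'' d'' h'' hd'' = projMap g' d' h' hd' ≫ projMap g d h hd := by
  unfold projMap
  rw [← Proj.map_comp]
  refine proj_map_congr _ _ _ _ fun x ↦ ?_
  change mapRingHom g'' d'' h'' x = ((mapRingHom g' d' h').comp (mapRingHom g d h)) x
  congr 1
  refine ringHom_ext (fun r ↦ ?_) fun α ↦ ?_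
  · simp [e]
  · simp [e']

lemma projMap_square {S' : Type u} [CommRing S'] {N' : Type u} [AddCommGroup N'] [Module S' N']
    {Ψ' : Set (Module.End S' N')}
    (g : R →+* S) (d : Module.Dual R M →ₛₗ[g] Module.Dual S N) (h : Compat Φ Ψ d)
    (hd : Submodule.span S (Set.range d) = ⊤)
    (g' : S →+* T) (d' : Module.Dual S N →ₛₗ[g'] Module.Dual T P) (h' : Compat Ψ Θ d')
    (hd' : Submodule.span T (Set.range d') = ⊤)
    (j : R →+* S') (c : Module.Dual R M →ₛₗ[j] Module.Dual S' N') (i : Compat Φ Ψ' c)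
    (hc : Submodule.span S' (Set.range c) = ⊤)
    (j' : S' →+* T) (c' : Module.Dual S' N' →ₛₗ[j'] Module.Dual T P) (i' : Compat Ψ' Θ c')
    (hc' : Submodule.span T (Set.range c') = ⊤)
    (e : ∀ r, g' (g r) = j' (j r)) (e' : ∀ α, d' (d α) = c' (c α)) :
    projMap g' d' h' hd' ≫ projMap g d h hd = projMap j' c' i' hc' ≫ projMap j c i hc := by
  unfold projMap
  rw [← Proj.map_comp, ← Proj.map_comp]
  refine proj_map_congr _ _ _ _ fun x ↦ ?_
  change ((mapRingHom g' d' h').comp (mapRingHom g d h)) x =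
    ((mapRingHom j' c' i').comp (mapRingHom j c i)) x
  congr 1
  refine ringHom_ext (fun r ↦ ?_) fun α ↦ ?_
  · simp [e]
  · simp [e']

lemma isPullback (r : R) [Algebra R S] [IsLocalization.Away r S]
    (d : Module.Dual R M →ₛₗ[algebraMap R S] Module.Dual S N) (h : Compat Φ Ψ d)
    (H : IsLoc Φ Ψ r d) :
    IsPullback (projMap _ d h H.span_eq_top) (base S N Ψ) (base R M Φ)
      (Spec.map (CommRingCat.ofHom (algebraMap R S))) := by
  refine Scheme.isPullback_of_openCover _ _ _ _ (chartCover R M Φ).openCover ?_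
  suffices ∀ α : Module.Dual R M, IsPullback
      (pullback.snd (projMap _ d h H.span_eq_top) (chart R M Φ α))
      (pullback.fst _ (chart R M Φ α) ≫ base S N Ψ) (chart R M Φ α ≫ base R M Φ)
      (Spec.map (CommRingCat.ofHom (algebraMap R S))) from this
  intro α
  have h₁ : IsPullback _ _ (projMap _ d h H.span_eq_top) (chart R M Φ α) :=
    (IsOpenImmersion.isPullback _ _ _ _
    (Proj.awayι_comp_map (map _ d h) (irrelevant_le_map _ d h H.span_eq_top) one_pos
      (coord R M Φ α) (coord_mem α))
    (by rw [Proj.opensRange_awayι, Proj.opensRange_awayι, Proj.map_preimage_basicOpen])).flip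
  have h₂ := isPullback_SpecMap_of_isPushout _ _ _ _ (H.isPushout_away h α)
  refine h₂.flip.of_iso h₁.isoPullback (.refl _) (.refl _) (.refl _) ?_ ?_ ?_ ?_
  · simp only [Iso.refl_hom]
    erw [Category.comp_id]
    exact h₁.isoPullback_hom_snd.symm
  · simp only [Iso.refl_hom]
    erw [Category.comp_id]
    rw [← Category.assoc, h₁.isoPullback_hom_fst]
    exact (awayι_base _ _ _).symm
  · simp only [Iso.refl_hom]
    erw [Category.comp_id, Category.id_comp]
    exact (awayι_base _ _ _).symm
  · simp

end LineRing

end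

section

section LocalizationMaps

variable {R S : Type u} [CommRing R] [CommRing S] {g : R →+* S}
  {M N : Type u} [AddCommGroup M] [Module R M] [AddCommGroup N] [Module S N]

/-- The ring homomorphism `g` is a localization away from `r`. -/
def IsLocRing (g : R →+* S) (r : R) : Prop :=
  let := g.toAlgebra
  IsLocalization.Away r S

/-- The semilinear map `f` is a localization of modules away from `r`. -/
structure IsLocMod (r : R) (f : M →ₛₗ[g] N) : Prop where
  surj : ∀ y : N, ∃ (k : ℕ) (x : M), f x = g r ^ k • y
  inj : ∀ x : M, f x = 0 → ∃ k : ℕ, r ^ k • x = 0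

variable {r : R} {f : M →ₛₗ[g] N}

lemma IsLocRing.isUnit (hg : IsLocRing g r) : IsUnit (g r) :=
  let := g.toAlgebra
  have : IsLocalization.Away r S := hg
  IsLocalization.Away.algebraMap_isUnit r

lemma IsLocRing.surj (hg : IsLocRing g r) (a : S) : ∃ (k : ℕ) (b : R), g b = g r ^ k * a := by
  let := g.toAlgebra
  have : IsLocalization.Away r S := hg
  obtain ⟨k, b, h⟩ := IsLocalization.Away.surj r a
  exact ⟨k, b, h.symm.trans (mul_comm _ _)⟩

lemma IsLocMod.hom_ext (hg : IsLocRing g r) (hf : IsLocMod r f) {P : Type u} [AddCommGroup P]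
    [Module S P] {a b : N →ₗ[S] P} (h : ∀ x, a (f x) = b (f x)) : a = b := by
  ext y
  obtain ⟨k, x, hx⟩ := hf.surj y
  have := h x
  rw [hx, map_smul, map_smul] at this
  exact (hg.isUnit.pow k).smul_left_cancel.mp this

lemma exists_dualExt (hg : IsLocRing g r) (hf : IsLocMod r f) [Module.FinitePresentation R M] :
    ∃ d : Module.Dual R M →ₛₗ[g] Module.Dual S N, (∀ α x, d α (f x) = g (α x)) ∧ IsLocMod r d := by
  let : Algebra R S := g.toAlgebra
  let : Module R N := Module.compHom N g
  have : IsScalarTower R S N := .of_algebraMap_smul fun _ _ ↦ rfl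
  have : IsLocalization (.powers r) S := hg
  let f' : M →ₗ[R] N := { toFun := f, map_add' := map_add f, map_smul' := f.map_smulₛₗ }
  have hr (k : ℕ) : IsUnit (g (r ^ k)) := by rw [map_pow]; exact hg.isUnit.pow k
  have : IsLocalizedModule (.powers r) f' := by
    refine ⟨?_, ?_, ?_⟩
    · rintro ⟨_, k, rfl⟩
      rw [Module.End.isUnit_iff]
      refine ⟨fun β γ e ↦ (hr k).smul_left_cancel.mp e, fun β ↦ ⟨(hr k).unit⁻¹.1 • β, ?_⟩⟩
      change g (r ^ k) • ((hr k).unit⁻¹.1 • β) = β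
      rw [smul_smul, (hr k).mul_val_inv, one_smul]
    · intro β
      obtain ⟨k, α, hα⟩ := hf.surj β
      refine ⟨⟨α, ⟨r ^ k, k, rfl⟩⟩, ?_⟩
      change g (r ^ k) • β = f α
      rw [hα, map_pow]
    · intro α β e
      obtain ⟨k, hk⟩ := hf.inj (α - β) (by rw [map_sub, sub_eq_zero]; exact e)
      refine ⟨⟨r ^ k, k, rfl⟩, ?_⟩
      change r ^ k • α = r ^ k • β
      rwa [smul_sub, sub_eq_zero] at hk
  let d' := IsLocalizedModule.mapExtendScalars (.powers r) f' (Algebra.linearMap R S) S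
  have hd' : IsLocalizedModule (.powers r) d' := inferInstance
  refine ⟨{ toFun := d', map_add' := map_add d', map_smul' := fun a α ↦ ?_ }, ?_, ?_, ?_⟩
  · rw [map_smul]
    ext y
    rfl
  · intro α x
    change d' α (f' x) = _
    simp only [d', IsLocalizedModule.mapExtendScalars_apply_apply, IsLocalizedModule.map_apply]
    rfl
  · intro β
    obtain ⟨⟨α, ⟨_, k, rfl⟩⟩, h⟩ := IsLocalizedModule.surj (.powers r) d' β
    refine ⟨k, α, h.symm.trans ?_⟩
    ext y
    change g (r ^ k) • β y = g r ^ k • β y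
    rw [map_pow]
  · intro α h
    obtain ⟨⟨_, k, rfl⟩, h⟩ := (IsLocalizedModule.eq_zero_iff (.powers r) d').mp h
    exact ⟨k, h⟩

/-- The functional on `N` extending a functional on `M`, for a localization `M → N`. -/
def dualExt (hg : IsLocRing g r) (hf : IsLocMod r f) [Module.FinitePresentation R M] :
    Module.Dual R M →ₛₗ[g] Module.Dual S N :=
  (exists_dualExt hg hf).choose

lemma dualExt_apply (hg : IsLocRing g r) (hf : IsLocMod r f) [Module.FinitePresentation R M]
    (α : Module.Dual R M) (x : M) : dualExt hg hf α (f x) = g (α x) :=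
  (exists_dualExt hg hf).choose_spec.1 α x

lemma isLocMod_dualExt (hg : IsLocRing g r) (hf : IsLocMod r f) [Module.FinitePresentation R M] :
    IsLocMod r (dualExt hg hf) :=
  (exists_dualExt hg hf).choose_spec.2

end LocalizationMaps

section Forms

variable {k R S : Type u} [CommRing k] [CommRing R] [Algebra k R] [CommRing S] [Algebra k S]
  {M N : Type u} [AddCommGroup M] [Module R M] [AddCommGroup N] [Module S N]

/-- The pullback of differential forms along `g`. -/
def omegaRes (g : R →ₐ[k] S) : Ω[R⁄k] →ₛₗ[g.toRingHom] Ω[S⁄k] :=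
  letI := g.toRingHom.toAlgebra
  have : IsScalarTower k R S := .of_algebraMap_eq fun x ↦ (g.commutes x).symm
  { toFun := KaehlerDifferential.map k k R S
    map_add' := map_add _
    map_smul' := fun a x ↦ by rw [map_smul]; rfl }

lemma omegaRes_D (g : R →ₐ[k] S) (a : R) :
    omegaRes g (KaehlerDifferential.D k R a) = KaehlerDifferential.D k S (g a) :=
  let := g.toRingHom.toAlgebra
  have : IsScalarTower k R S := .of_algebraMap_eq fun x ↦ (g.commutes x).symm
  KaehlerDifferential.map_D k k R S a

lemma isLocMod_omegaRes {g : R →ₐ[k] S} {r : R} (hg : IsLocRing g.toRingHom r) :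
    IsLocMod r (omegaRes g) := by
  let := g.toRingHom.toAlgebra
  have : IsScalarTower k R S := .of_algebraMap_eq fun x ↦ (g.commutes x).symm
  have : IsLocalization (.powers r) S := hg
  have := KaehlerDifferential.isLocalizedModule_map k R S (.powers r)
  refine ⟨fun y ↦ ?_, fun x h ↦ ?_⟩
  · obtain ⟨⟨α, ⟨_, k, rfl⟩⟩, h⟩ := IsLocalizedModule.surj (.powers r)
      (KaehlerDifferential.map k k R S) y
    refine ⟨k, α, h.symm.trans ?_⟩
    change (r ^ k) • y = _
    rw [← algebraMap_smul S, map_pow]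
    rfl
  · obtain ⟨⟨_, k, rfl⟩, h⟩ := (IsLocalizedModule.eq_zero_iff (.powers r)
      (KaehlerDifferential.map k k R S)).mp h
    exact ⟨k, h⟩

/-- The restriction map `M ⊗ Ω_R → N ⊗ Ω_S` induced by a semilinear map `M → N`. -/
def tensorRes (g : R →ₐ[k] S) (f : M →ₛₗ[g.toRingHom] N) :
    M ⊗[R] Ω[R⁄k] →+ N ⊗[S] Ω[S⁄k] :=
  TensorProduct.liftAddHom
    { toFun := fun m ↦ ((TensorProduct.mk S N Ω[S⁄k] (f m)).toAddMonoidHom).comp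
        (omegaRes g).toAddMonoidHom
      map_zero' := AddMonoidHom.ext fun ω ↦ by
        change f 0 ⊗ₜ[S] omegaRes g ω = 0
        rw [map_zero, TensorProduct.zero_tmul]
      map_add' := fun x y ↦ AddMonoidHom.ext fun ω ↦ by
        change f (x + y) ⊗ₜ[S] omegaRes g ω = f x ⊗ₜ[S] omegaRes g ω + f y ⊗ₜ[S] omegaRes g ω
        rw [map_add, TensorProduct.add_tmul] }
    (fun r m ω ↦ by
      change f (r • m) ⊗ₜ[S] omegaRes g ω = f m ⊗ₜ[S] omegaRes g (r • ω)
      rw [f.map_smulₛₗ, (omegaRes g).map_smulₛₗ, TensorProduct.smul_tmul])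

@[simp] lemma tensorRes_tmul (g : R →ₐ[k] S) (f : M →ₛₗ[g.toRingHom] N) (m : M) (ω : Ω[R⁄k]) :
    tensorRes g f (m ⊗ₜ ω) = f m ⊗ₜ omegaRes g ω := rfl

/-- The contraction of an `Ω`-valued endomorphism with a vector field. -/
def contract (φ : M →ₗ[R] M ⊗[R] Ω[R⁄k]) (v : Module.Dual R Ω[R⁄k]) : Module.End R M :=
  (TensorProduct.rid R M).toLinearMap ∘ₗ LinearMap.lTensor M v ∘ₗ φ

lemma contract_res (g : R →ₐ[k] S) (f : M →ₛₗ[g.toRingHom] N) (φ : M →ₗ[R] M ⊗[R] Ω[R⁄k])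
    (ψ : N →ₗ[S] N ⊗[S] Ω[S⁄k]) (h : ∀ m, tensorRes g f (φ m) = ψ (f m))
    (v : Module.Dual R Ω[R⁄k]) (w : Module.Dual S Ω[S⁄k])
    (hvw : ∀ ω, w (omegaRes g ω) = g (v ω)) (m : M) :
    f (contract φ v m) = contract ψ w (f m) := by
  simp only [contract, LinearMap.comp_apply, ← h]
  induction φ m using TensorProduct.induction_on with
  | zero => rw [map_zero, map_zero, map_zero, map_zero, map_zero, map_zero]
  | tmul x y =>
    simp only [LinearEquiv.coe_coe, LinearMap.lTensor_tmul, rid_tmul, tensorRes_tmul, hvw]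
    exact f.map_smulₛₗ _ _
  | add x y hx hy => simp only [map_add, hx, hy]

lemma contract_smul (φ : M →ₗ[R] M ⊗[R] Ω[R⁄k]) (a : R) (v : Module.Dual R Ω[R⁄k]) :
    contract φ (a • v) = a • contract φ v := by
  ext m
  simp only [contract, LinearMap.comp_apply, LinearMap.smul_apply, LinearMap.lTensor_smul,
    map_smul]

end Forms

end

section

/-- `B` is a smooth, connected (equivalently, irreducible) complex algebraic curve. -/
class IsSmoothCurve (B : Scheme.{0}) [B.Over (Spec (.of ℂ))] : Prop where
  isIntegral : IsIntegral B
  smooth : SmoothOfRelativeDimension 1 (B ↘ Spec (.of ℂ))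
  isSeparated : IsSeparated (B ↘ Spec (.of ℂ))
  quasiCompact : QuasiCompact (B ↘ Spec (.of ℂ))

variable {B : Scheme.{0}} [B.Over (Spec (.of ℂ))]

/-- The algebra structure given by the structure morphism of `B`. -/
instance (W : B.Opens) : Algebra ℂ Γ(B, W) :=
  ((Scheme.ΓSpecIso (.of ℂ)).inv ≫ (B ↘ Spec (.of ℂ)).appLE ⊤ W le_top).hom.toAlgebra

/-- Restriction of functions. -/
def resAlg {V W : B.Opens} (h : V ≤ W) : Γ(B, W) →ₐ[ℂ] Γ(B, V) where
  __ := (B.presheaf.map (homOfLE h).op).hom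
  commutes' x := by
    change B.presheaf.map (homOfLE h).op
      (((B ↘ Spec (.of ℂ)).appLE ⊤ W le_top) ((Scheme.ΓSpecIso (.of ℂ)).inv x)) =
      ((B ↘ Spec (.of ℂ)).appLE ⊤ V le_top) ((Scheme.ΓSpecIso (.of ℂ)).inv x)
    rw [← Scheme.Hom.appLE_map (B ↘ Spec (.of ℂ)) le_top (homOfLE h).op]
    rfl

/-- Restriction of sections. -/
def resMod (E : B.Modules) {V W : B.Opens} (h : V ≤ W) :
    Γ(E, W) →ₛₗ[(resAlg h).toRingHom] Γ(E, V) where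
  __ := (E.presheaf.map (homOfLE h).op).hom
  map_smul' r x := Scheme.Modules.map_smul E (homOfLE h) r x

lemma resAlg_resAlg {V W X : B.Opens} (h : V ≤ W) (h' : W ≤ X) (x : Γ(B, X)) :
    resAlg h (resAlg h' x) = resAlg (h.trans h') x :=
  congr($(B.presheaf.map_comp (homOfLE h').op (homOfLE h).op) x).symm

lemma resMod_resMod (E : B.Modules) {V W X : B.Opens} (h : V ≤ W) (h' : W ≤ X) (x : Γ(E, X)) :
    resMod E h (resMod E h' x) = resMod E (h.trans h') x :=
  congr($(E.presheaf.map_comp (homOfLE h').op (homOfLE h).op) x).symm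

lemma resAlg_self {W : B.Opens} (h : W ≤ W) (x : Γ(B, W)) : resAlg h x = x :=
  congr($(B.presheaf.map_id _) x)

lemma resMod_self (E : B.Modules) {W : B.Opens} (h : W ≤ W) (x : Γ(E, W)) : resMod E h x = x :=
  congr($(E.presheaf.map_id _) x)

lemma isLocRing_resAlg {V W : B.AffineZariskiSite} (h : V ≤ W) (r : Γ(B, W.toOpens))
    (hr : B.basicOpen r = V.toOpens) :
    IsLocRing (resAlg (Scheme.AffineZariskiSite.toOpens_mono h)).toRingHom r := by
  obtain ⟨V, hV⟩ := V
  subst hr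
  exact W.2.isLocalization_basicOpen r

lemma fromSpec_appIso_inv {W : B.Opens} (hW : IsAffineOpen W) (D : (Spec Γ(B, W)).Opens)
    (h : hW.fromSpec ''ᵁ D ≤ W) (r : Γ(B, W)) :
    (hW.fromSpec.appIso D).inv
      ((Spec Γ(B, W)).presheaf.map D.leTop.op ((Scheme.ΓSpecIso _).inv r)) =
      resAlg h r := by
  have e : D ≤ hW.fromSpec ⁻¹ᵁ W := by
    rw [hW.fromSpec_preimage_self]; exact le_top
  have e₁ := hW.fromSpec.appLE_appIso_inv e
  have e₂ : hW.fromSpec.appLE W D e =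
      (Scheme.ΓSpecIso _).inv ≫ (Spec Γ(B, W)).presheaf.map D.leTop.op := by
    rw [Scheme.Hom.appLE, hW.fromSpec_app_self, Category.assoc, ← Functor.map_comp]
    rfl
  rw [e₂] at e₁
  exact congr($e₁ r)

lemma smul_restrict_fromSpec (E : B.Modules) {W : B.Opens} (hW : IsAffineOpen W)
    (D : (Spec Γ(B, W)).Opens) (h : hW.fromSpec ''ᵁ D ≤ W) (r : Γ(B, W))
    (y : Γ(E.restrict hW.fromSpec, D)) :
    (E.restrictAppIso hW.fromSpec D).hom (r • y) =
      resAlg h r • (E.restrictAppIso hW.fromSpec D).hom y := by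
  rw [← fromSpec_appIso_inv]
  rfl

lemma resMod_injective_of_ge (E : B.Modules) {V W : B.Opens} (h : V ≤ W) (h' : W ≤ V) :
    Function.Injective (resMod E h) := by
  intro x y e
  have := congr(resMod E h' $e)
  rwa [resMod_resMod, resMod_resMod, resMod_self, resMod_self] at this

lemma isLocMod_resMod_aux (E : B.Modules) [E.IsQuasicoherent] {W : B.Opens}
    (hW : IsAffineOpen W) (r : Γ(B, W)) (hT : hW.fromSpec ''ᵁ ⊤ ≤ W)
    (hD : hW.fromSpec ''ᵁ PrimeSpectrum.basicOpen r ≤ W) :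
    (∀ y : Γ(E, hW.fromSpec ''ᵁ PrimeSpectrum.basicOpen r), ∃ (k : ℕ)
      (x : Γ(E, hW.fromSpec ''ᵁ ⊤)), resMod E (hW.fromSpec.image_mono le_top) x =
        resAlg hD r ^ k • y) ∧
    (∀ x : Γ(E, hW.fromSpec ''ᵁ ⊤),
      resMod E (hW.fromSpec.image_mono (U := PrimeSpectrum.basicOpen r) le_top) x = 0 →
      ∃ k : ℕ, resAlg hT r ^ k • x = 0) := by
  let f := ((modulesSpecToSheaf.obj (E.restrict hW.fromSpec)).obj.map
    (PrimeSpectrum.basicOpen r).leTop.op).hom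
  have h₁ : IsLocalizedModule (.powers r) f :=
    (isIso_fromTildeΓ_iff_isLocalizing (E.restrict hW.fromSpec)).mp inferInstance r
  constructor
  · intro y
    obtain ⟨⟨x, ⟨_, k, rfl⟩⟩, hx⟩ := IsLocalizedModule.surj (.powers r) f
      ((E.restrictAppIso hW.fromSpec (PrimeSpectrum.basicOpen r)).inv y)
    refine ⟨k, (E.restrictAppIso hW.fromSpec ⊤).hom x, hx.symm.trans ?_⟩
    refine (smul_restrict_fromSpec E hW _ hD (r ^ k) _).trans ?_
    rw [map_pow]
    rfl
  · intro x hx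
    obtain ⟨⟨_, k, rfl⟩, hk⟩ := (IsLocalizedModule.eq_zero_iff (.powers r) f
      (m := ((E.restrictAppIso hW.fromSpec ⊤).inv x))).mp hx
    refine ⟨k, ?_⟩
    rw [← map_pow]
    exact (smul_restrict_fromSpec E hW _ _ (r ^ k) _).symm.trans hk

lemma isLocMod_resMod (E : B.Modules) [E.IsQuasicoherent] {V W : B.AffineZariskiSite} (h : V ≤ W)
    (r : Γ(B, W.toOpens)) (hr : B.basicOpen r = V.toOpens) :
    IsLocMod r (resMod E (Scheme.AffineZariskiSite.toOpens_mono h)) := by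
  obtain ⟨V, hV⟩ := V
  obtain ⟨W, hW⟩ := W
  change B.basicOpen r = V at hr
  have hVW : V ≤ W := Scheme.AffineZariskiSite.toOpens_mono h
  have eT : hW.fromSpec ''ᵁ ⊤ = W := by
    rw [Scheme.Hom.image_top_eq_opensRange, hW.opensRange_fromSpec]
  have eD : hW.fromSpec ''ᵁ PrimeSpectrum.basicOpen r = V := by
    rw [hW.fromSpec_image_basicOpen, hr]
  obtain ⟨h₁, h₂⟩ := isLocMod_resMod_aux E hW r eT.le (eD.le.trans hVW)
  constructor
  · intro (y : Γ(E, V))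
    obtain ⟨k, x, hx⟩ := h₁ (resMod E eD.le y)
    refine ⟨k, resMod E eT.ge x, resMod_injective_of_ge E eD.le eD.ge ?_⟩
    rw [resMod_resMod, resMod_resMod]
    refine hx.trans ?_
    rw [LinearMap.map_smulₛₗ, map_pow]
    congr 2
    exact (resAlg_resAlg _ _ _).symm
  · intro (x : Γ(E, W)) hx
    obtain ⟨k, hk⟩ := h₂ (resMod E eT.le x) (by
      have := congr(resMod E eD.le $hx)
      rw [resMod_resMod, map_zero] at this
      rwa [resMod_resMod])
    refine ⟨k, resMod_injective_of_ge E eT.le eT.ge ?_⟩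
    rw [LinearMap.map_smulₛₗ, map_zero]
    rwa [← map_pow] at hk

variable (B) in
/-- A Higgs bundle on the curve `B`: a vector bundle `E`, that is, a quasi-coherent sheaf whose
modules of sections on affine open subsets are finite and projective, with a morphism
`φ : E → E ⊗ Ω` of sheaves of modules, given by its components on affine open subsets. Since `B` is a
curve, the condition `φ ∧ φ = 0` is automatic. -/
structure HiggsBundle where
  /-- the underlying sheaf of modules -/
  E : B.Modules
  isQuasicoherent : E.IsQuasicoherent
  finite (W : B.AffineZariskiSite) : Module.Finite Γ(B, W.toOpens) Γ(E, W.toOpens)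
  projective (W : B.AffineZariskiSite) : Module.Projective Γ(B, W.toOpens) Γ(E, W.toOpens)
  /-- the Higgs field -/
  φ (W : B.AffineZariskiSite) : Γ(E, W.toOpens) →ₗ[Γ(B, W.toOpens)]
    Γ(E, W.toOpens) ⊗[Γ(B, W.toOpens)] Ω[Γ(B, W.toOpens)⁄ℂ]
  φ_res {V W : B.AffineZariskiSite} (h : V.toOpens ≤ W.toOpens) (e : Γ(E, W.toOpens)) :
    tensorRes (resAlg h) (resMod E h) (φ W e) = φ V (resMod E h e)

end

section

variable {B : Scheme.{0}}

/-- The affine open subsets of `U`, with the inclusions of basic open subsets as morphisms. -/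
abbrev AffineIn (U : B.Opens) : Type := {W : B.AffineZariskiSite // W.toOpens ≤ U}

namespace AffineIn

variable {U : B.Opens}

/-- The underlying open subset. -/
abbrev opens (W : AffineIn U) : B.Opens := W.1.toOpens

lemma opens_mono {V W : AffineIn U} (h : V ≤ W) : V.opens ≤ W.opens :=
  Scheme.AffineZariskiSite.toOpens_mono h

lemma exists_basicOpen {V W : AffineIn U} (h : V ≤ W) :
    ∃ r : Γ(B, W.opens), B.basicOpen r = V.opens := h

end AffineIn

variable [B.Over (Spec (.of ℂ))]

instance [h : IsSmoothCurve B] : LocallyOfFinitePresentation (B ↘ Spec (.of ℂ)) :=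
  have := h.smooth
  have := SmoothOfRelativeDimension.smooth 1 (B ↘ Spec (.of ℂ))
  inferInstance

lemma finitePresentation_omega [IsSmoothCurve B] (W : B.AffineZariskiSite) :
    Module.FinitePresentation Γ(B, W.toOpens) Ω[Γ(B, W.toOpens)⁄ℂ] := by
  have h := (B ↘ Spec (.of ℂ)).finitePresentation_appLE (isAffineOpen_top _) W.2 le_top
  have h' : (algebraMap ℂ Γ(B, W.toOpens)).FinitePresentation := by
    refine RingHom.FinitePresentation.comp (g := ((B ↘ Spec (.of ℂ)).appLE ⊤ W.1 le_top).hom) h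
      (.of_bijective ?_)
    exact ConcreteCategory.bijective_of_isIso (Scheme.ΓSpecIso (.of ℂ)).inv
  have : Algebra.FinitePresentation ℂ Γ(B, W.toOpens) := h'
  infer_instance

/-- The restriction of functions to a basic open subset. -/
abbrev res {U : B.Opens} {V W : AffineIn U} (h : V ≤ W) : Γ(B, W.opens) →ₐ[ℂ] Γ(B, V.opens) :=
  resAlg (AffineIn.opens_mono h)

namespace HiggsBundle

variable (𝔈 : HiggsBundle B)

/-- The endomorphism of the module of sections of `E` over `W` obtained by contracting the Higgs
field with the vector field `v`. -/
def endo (W : B.AffineZariskiSite) (v : Module.Dual Γ(B, W.toOpens) Ω[Γ(B, W.toOpens)⁄ℂ]) :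
    Module.End Γ(B, W.toOpens) Γ(𝔈.E, W.toOpens) :=
  contract (𝔈.φ W) v

end HiggsBundle

/-- A Higgs subbundle of the restriction of `𝔈` to `U`: a quasi-coherent subsheaf, given by its
sections on the affine open subsets of `U`, with locally free quotient, preserved by the Higgs
field. With the restriction of the Higgs field, it is a Higgs bundle on `U`. -/
structure HiggsSubbundle (𝔈 : HiggsBundle B) (U : B.Opens) where
  /-- the sections on an affine open subset -/
  sec (W : AffineIn U) : Submodule Γ(B, W.opens) Γ(𝔈.E, W.opens)
  span_res {V W : AffineIn U} (h : V ≤ W) :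
    Submodule.span Γ(B, V.opens) (resMod 𝔈.E (AffineIn.opens_mono h) '' sec W) = sec V
  projective (W : AffineIn U) : Module.Projective Γ(B, W.opens) (Γ(𝔈.E, W.opens) ⧸ sec W)
  invariant (W : AffineIn U) (e : Γ(𝔈.E, W.opens)) (he : e ∈ sec W) :
    𝔈.φ W.1 e ∈ LinearMap.range (LinearMap.rTensor Ω[Γ(B, W.opens)⁄ℂ] (sec W).subtype)

lemma contract_mem {R k M : Type} [CommRing k] [CommRing R] [Algebra k R] [AddCommGroup M]
    [Module R M] (φ : M →ₗ[R] M ⊗[R] Ω[R⁄k]) (F : Submodule R M)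
    (hF : ∀ e ∈ F, φ e ∈ LinearMap.range (LinearMap.rTensor Ω[R⁄k] F.subtype))
    (v : Module.Dual R Ω[R⁄k]) (e : M) (he : e ∈ F) : contract φ v e ∈ F := by
  obtain ⟨t, ht⟩ := hF e he
  simp only [contract, LinearMap.comp_apply, ← ht]
  clear ht
  induction t using TensorProduct.induction_on with
  | zero => simp
  | tmul x y =>
    simp only [LinearMap.rTensor_tmul, LinearMap.lTensor_tmul]
    exact F.smul_mem _ x.2
  | add x y hx hy => simp only [map_add]; exact F.add_mem hx hy

lemma exists_retraction {R M : Type} [CommRing R] [AddCommGroup M]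
    [Module R M] (F : Submodule R M) [Module.Projective R (M ⧸ F)] :
    ∃ p : M →ₗ[R] F, ∀ x : F, p x = x := by
  obtain ⟨s, hs⟩ := Module.projective_lifting_property F.mkQ LinearMap.id F.mkQ_surjective
  have h (x : M) : (LinearMap.id - s ∘ₗ F.mkQ : M →ₗ[R] M) x ∈ F := by
    rw [← Submodule.Quotient.mk_eq_zero, ← Submodule.mkQ_apply]
    have := congr($hs (F.mkQ x))
    simp only [LinearMap.comp_apply, LinearMap.id_apply] at this
    simp only [LinearMap.sub_apply, LinearMap.comp_apply, LinearMap.id_apply, map_sub, this,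
      sub_self]
  refine ⟨(LinearMap.id - s ∘ₗ F.mkQ).codRestrict F h, fun x ↦ Subtype.ext ?_⟩
  have : F.mkQ x = 0 := (Submodule.Quotient.mk_eq_zero F).mpr x.2
  simp only [LinearMap.codRestrict_apply, LinearMap.sub_apply, LinearMap.comp_apply, this, map_zero,
    LinearMap.id_apply, sub_zero]

namespace HiggsSubbundle

section
variable {𝔈 : HiggsBundle B} {U : B.Opens} (F : HiggsSubbundle 𝔈 U)

/-- The endomorphism of the module of sections of `F` over `W` obtained by contracting the
restricted Higgs field with the vector field `v`. -/
def endo (W : AffineIn U) (v : Module.Dual Γ(B, W.opens) Ω[Γ(B, W.opens)⁄ℂ]) :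
    Module.End Γ(B, W.opens) (F.sec W) :=
  (𝔈.endo W.1 v).restrict fun e he ↦ contract_mem (𝔈.φ W.1) (F.sec W) (F.invariant W) v e he

/-- The endomorphisms given by all vector fields. On a curve, a submodule is invariant under the
Higgs field if and only if it is invariant under these. -/
def endos (W : AffineIn U) : Set (Module.End Γ(B, W.opens) (F.sec W)) := Set.range (F.endo W)

instance finitePresentation_sec (W : AffineIn U) :
    Module.FinitePresentation Γ(B, W.opens) (F.sec W) := by
  have := F.projective W
  have := 𝔈.finite W.1
  have := 𝔈.projective W.1
  obtain ⟨p, hp⟩ := exists_retraction (F.sec W)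
  have : Module.Finite Γ(B, W.opens) (F.sec W) :=
    .of_surjective p fun x ↦ ⟨x, hp x⟩
  have : Module.Projective Γ(B, W.opens) (F.sec W) :=
    .of_split (F.sec W).subtype p (LinearMap.ext hp)
  exact Module.finitePresentation_of_projective _ _

/-- Restriction of sections of `F`. -/
def res {V W : AffineIn U} (h : V ≤ W) : F.sec W →ₛₗ[(Higgs.res h).toRingHom] F.sec V where
  toFun x := ⟨resMod 𝔈.E (AffineIn.opens_mono h) x, by
    rw [← F.span_res h]; exact Submodule.subset_span ⟨x, x.2, rfl⟩⟩
  map_add' x y := Subtype.ext (map_add _ _ _)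
  map_smul' r x := Subtype.ext (LinearMap.map_smulₛₗ _ _ _)

lemma isLocMod_res {V W : AffineIn U} (h : V ≤ W) (r : Γ(B, W.opens))
    (hr : B.basicOpen r = V.opens) : IsLocMod r (F.res h) := by
  have := 𝔈.isQuasicoherent
  have hE := isLocMod_resMod 𝔈.E (V := V.1) (W := W.1) h r hr
  have hg := isLocRing_resAlg (V := V.1) (W := W.1) h r hr
  constructor
  · rintro ⟨y, hy⟩
    suffices ∃ (k : ℕ), ∃ x ∈ F.sec W, resMod 𝔈.E (AffineIn.opens_mono h) x = Higgs.res h r ^ k • y by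
      obtain ⟨k, x, hx, e⟩ := this
      exact ⟨k, ⟨x, hx⟩, Subtype.ext e⟩
    rw [← F.span_res h] at hy
    induction hy using Submodule.span_induction with
    | mem y hy =>
      obtain ⟨x, hx, rfl⟩ := hy
      exact ⟨0, x, hx, by rw [pow_zero, one_smul]⟩
    | zero => exact ⟨0, 0, zero_mem _, by rw [map_zero, smul_zero]⟩
    | add y z _ _ hy hz =>
      obtain ⟨k, x, hx, e⟩ := hy
      obtain ⟨l, x', hx', e'⟩ := hz
      refine ⟨k + l, r ^ l • x + r ^ k • x', add_mem (Submodule.smul_mem _ _ hx)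
        (Submodule.smul_mem _ _ hx'), ?_⟩
      rw [map_add, LinearMap.map_smulₛₗ, LinearMap.map_smulₛₗ, e, e', map_pow, map_pow, smul_add,
        smul_smul, pow_add, smul_smul]
      change (Higgs.res h r ^ l * _) • _ + (Higgs.res h r ^ k * _) • _ = _
      rw [mul_comm (Higgs.res h r ^ l)]
    | smul a y _ hy =>
      obtain ⟨k, x, hx, e⟩ := hy
      obtain ⟨l, b, hb⟩ := hg.surj a
      refine ⟨k + l, b • x, Submodule.smul_mem _ _ hx, ?_⟩
      rw [LinearMap.map_smulₛₗ, hb, e, smul_smul, smul_smul, pow_add]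
      congr 1
      change Higgs.res h r ^ l * a * _ = _
      ring
  · rintro ⟨x, hx⟩ h0
    obtain ⟨k, hk⟩ := hE.inj x congr(($h0).1)
    exact ⟨k, Subtype.ext hk⟩

/-- Restriction of sections of the dual of `F`. -/
def dualRes {V W : AffineIn U} (h : V ≤ W) :
    Module.Dual Γ(B, W.opens) (F.sec W) →ₛₗ[(Higgs.res h).toRingHom]
      Module.Dual Γ(B, V.opens) (F.sec V) :=
  dualExt (isLocRing_resAlg h _ (AffineIn.exists_basicOpen h).choose_spec)
    (F.isLocMod_res h _ (AffineIn.exists_basicOpen h).choose_spec)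

lemma dualRes_apply {V W : AffineIn U} (h : V ≤ W) (α : Module.Dual Γ(B, W.opens) (F.sec W))
    (x : F.sec W) : F.dualRes h α (F.res h x) = Higgs.res h (α x) :=
  dualExt_apply _ _ _ _

lemma dual_ext {V W : AffineIn U} (h : V ≤ W) {α β : Module.Dual Γ(B, V.opens) (F.sec V)}
    (e : ∀ x, α (F.res h x) = β (F.res h x)) : α = β := by
  obtain ⟨r, hr⟩ := id h
  exact (F.isLocMod_res h r hr).hom_ext (isLocRing_resAlg h r hr) e

end
end HiggsSubbundle

end

section

variable {B : Scheme.{0}} [B.Over (Spec (.of ℂ))]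

namespace HiggsSubbundle

variable {𝔈 : HiggsBundle B} {U : B.Opens} (F : HiggsSubbundle 𝔈 U)

lemma endo_res {V W : AffineIn U} (h : V ≤ W)
    (v : Module.Dual Γ(B, W.opens) Ω[Γ(B, W.opens)⁄ℂ])
    (w : Module.Dual Γ(B, V.opens) Ω[Γ(B, V.opens)⁄ℂ])
    (hvw : ∀ ω, w (omegaRes (Higgs.res h) ω) = Higgs.res h (v ω)) (x : F.sec W) :
    F.res h (F.endo W v x) = F.endo V w (F.res h x) :=
  Subtype.ext (contract_res (Higgs.res h) (resMod 𝔈.E (AffineIn.opens_mono h)) (𝔈.φ W.1) (𝔈.φ V.1)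
    (𝔈.φ_res _) v w hvw x)

lemma dualRes_comp_endo {V W : AffineIn U} (h : V ≤ W)
    (v : Module.Dual Γ(B, W.opens) Ω[Γ(B, W.opens)⁄ℂ])
    (w : Module.Dual Γ(B, V.opens) Ω[Γ(B, V.opens)⁄ℂ])
    (hvw : ∀ ω, w (omegaRes (Higgs.res h) ω) = Higgs.res h (v ω))
    (α : Module.Dual Γ(B, W.opens) (F.sec W)) :
    F.dualRes h (α ∘ₗ F.endo W v) = F.dualRes h α ∘ₗ F.endo V w := by
  refine F.dual_ext h fun x ↦ ?_
  rw [LinearMap.comp_apply, dualRes_apply, ← F.endo_res h v w hvw, dualRes_apply,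
    LinearMap.comp_apply]

lemma endo_smul (W : AffineIn U) (a : Γ(B, W.opens))
    (v : Module.Dual Γ(B, W.opens) Ω[Γ(B, W.opens)⁄ℂ]) :
    F.endo W (a • v) = a • F.endo W v :=
  LinearMap.ext fun x ↦ Subtype.ext congr($(contract_smul (𝔈.φ W.1) a v) x)

variable [IsSmoothCurve B]

lemma compat {V W : AffineIn U} (h : V ≤ W) :
    LineRing.Compat (F.endos W) (F.endos V) (F.dualRes h) := by
  rintro _ ⟨v, rfl⟩
  obtain ⟨r, hr⟩ := id h
  have hg := isLocRing_resAlg (V := V.1) (W := W.1) h r hr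
  have := finitePresentation_omega W.1
  exact ⟨_, ⟨dualExt hg (isLocMod_omegaRes hg) v, rfl⟩,
    F.dualRes_comp_endo h _ _ fun ω ↦ dualExt_apply _ _ _ _⟩

lemma isLoc {V W : AffineIn U} (h : V ≤ W) (r : Γ(B, W.opens)) (hr : B.basicOpen r = V.opens) :
    LineRing.IsLoc (F.endos W) (F.endos V) r (F.dualRes h) := by
  have hg := isLocRing_resAlg (V := V.1) (W := W.1) h r hr
  have hd : IsLocMod r (F.dualRes h) := by
    obtain ⟨d, hd, hd'⟩ := exists_dualExt hg (F.isLocMod_res h r hr)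
    convert! hd'
    refine LinearMap.ext fun α ↦ F.dual_ext h fun x ↦ ?_
    rw [dualRes_apply, hd]
    rfl
  refine ⟨hd.surj, hd.inj, ?_⟩
  rintro _ ⟨w, rfl⟩
  have := finitePresentation_omega W.1
  obtain ⟨k, v, hv⟩ := (isLocMod_dualExt hg (isLocMod_omegaRes hg)).surj w
  refine ⟨k, _, ⟨v, rfl⟩, fun α ↦ ?_⟩
  rw [F.dualRes_comp_endo h v (Higgs.res h r ^ k • w) fun ω ↦ by
    erw [← hv]; exact dualExt_apply _ _ _ _, endo_smul, LinearMap.comp_smul]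
  rfl

lemma span_dualRes {V W : AffineIn U} (h : V ≤ W) :
    Submodule.span Γ(B, V.opens) (Set.range (F.dualRes h)) = ⊤ := by
  obtain ⟨r, hr⟩ := id h
  let := (Higgs.res h).toRingHom.toAlgebra
  have : IsLocalization.Away r Γ(B, V.opens) := isLocRing_resAlg (V := V.1) (W := W.1) h r hr
  exact (F.isLoc h r hr).span_eq_top

/-- The part over the affine open subset `W` of the Grassmannian of rank one Higgs subbundles of
`F`. -/
def hgrassOver (W : AffineIn U) : Scheme.{0} :=
  Proj (LineRing.deg Γ(B, W.opens) (F.sec W) (F.endos W))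

/-- The structure morphism of `hgrassOver`. -/
def hgrassOverToSpec (W : AffineIn U) : F.hgrassOver W ⟶ Spec Γ(B, W.opens) :=
  LineRing.base Γ(B, W.opens) (F.sec W) (F.endos W)

/-- The inclusion of the part over `V` in the part over `W`. -/
def hgrassOverRes {V W : AffineIn U} (h : V ≤ W) : F.hgrassOver V ⟶ F.hgrassOver W :=
  LineRing.projMap (Higgs.res h).toRingHom (F.dualRes h) (F.compat h) (F.span_dualRes h)

lemma hgrassOverRes_self (W : AffineIn U) (h : W ≤ W) :
    F.hgrassOverRes h = 𝟙 _ := by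
  refine LineRing.projMap_id _ _ _ _ (fun r ↦ resAlg_self _ r) fun α ↦ F.dual_ext h fun x ↦ ?_
  have hx : F.res h x = x := Subtype.ext (resMod_self _ _ _)
  rw [dualRes_apply, hx]
  exact resAlg_self _ _

lemma hgrassOverRes_comp {V W X : AffineIn U} (h : V ≤ W) (h' : W ≤ X) :
    F.hgrassOverRes (h.trans h') = F.hgrassOverRes h ≫ F.hgrassOverRes h' := by
  refine LineRing.projMap_comp _ _ _ _ _ _ _ _ _ _ _ _
    (fun r ↦ (resAlg_resAlg _ _ r).symm) fun α ↦ F.dual_ext (h.trans h') fun x ↦ ?_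
  have hx : F.res (h.trans h') x = F.res h (F.res h' x) := Subtype.ext (resMod_resMod _ _ _ _).symm
  rw [dualRes_apply, hx, dualRes_apply, dualRes_apply]
  exact (resAlg_resAlg _ _ _).symm

lemma isPullback_hgrassOverRes {V W : AffineIn U} (h : V ≤ W) :
    IsPullback (F.hgrassOverRes h) (F.hgrassOverToSpec V) (F.hgrassOverToSpec W)
      (Spec.map (CommRingCat.ofHom (Higgs.res h).toRingHom)) := by
  obtain ⟨r, hr⟩ := id h
  let := (Higgs.res h).toRingHom.toAlgebra
  have : IsLocalization.Away r Γ(B, V.opens) := isLocRing_resAlg (V := V.1) (W := W.1) h r hr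
  exact LineRing.isPullback r (F.dualRes h) (F.compat h) (F.isLoc h r hr)

end HiggsSubbundle

/-- The cover of `U` by its affine open subsets. -/
abbrev affineCover (U : B.Opens) : U.toScheme.OpenCover where
  I₀ := AffineIn U
  X W := W.opens
  f W := B.homOfLE W.2
  mem₀ := by
    rw [Scheme.presieve₀_mem_precoverage_iff]
    refine ⟨fun x ↦ ?_, fun W ↦ inferInstance⟩
    obtain ⟨_, ⟨V, hV, rfl⟩, hxV, (hVU : V ≤ U)⟩ :=
      B.isBasis_affineOpens.exists_subset_of_mem_open x.2 U.2
    refine ⟨⟨⟨V, hV⟩, hVU⟩, ⟨x.1, hxV⟩, U.ι.isOpenEmbedding.injective ?_⟩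
    change (B.homOfLE hVU ≫ U.ι) _ = _
    rw [Scheme.homOfLE_ι]
    rfl

instance (U : B.Opens) : (affineCover U).LocallyDirected where
  trans f := B.homOfLE (AffineIn.opens_mono f.le)
  w f := by simp
  directed {V W} x := by
    let a := (pullback.fst _ _ ≫ V.opens.ι) x
    have haV : a ∈ V.opens := (pullback.fst (B.homOfLE V.2) (B.homOfLE W.2) x).2
    have haW : a ∈ W.opens := by
      have : a = (pullback.snd (B.homOfLE V.2) (B.homOfLE W.2) ≫ W.opens.ι) x := by
        unfold a
        rw [← B.homOfLE_ι V.2, ← B.homOfLE_ι W.2, pullback.condition_assoc]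
      rw [this]
      exact (pullback.snd (B.homOfLE V.2) (B.homOfLE W.2) x).2
    obtain ⟨f, g, e, hxf⟩ := exists_basicOpen_le_affine_inter V.1.2 W.1.2 _ ⟨haV, haW⟩
    let X : AffineIn U := ⟨V.1.basicOpen f, (B.basicOpen_le f).trans V.2⟩
    have hV : X ≤ V := ⟨f, rfl⟩
    have hW : X ≤ W := ⟨g, e.symm⟩
    refine ⟨X, homOfLE hV, homOfLE hW, ⟨a, hxf⟩, ?_⟩
    apply (pullback.fst _ _ ≫ V.opens.ι).isOpenEmbedding.injective
    change (pullback.lift _ _ _ ≫ pullback.fst _ _ ≫ V.opens.ι) _ = _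
    simp only [pullback.lift_fst_assoc, Scheme.homOfLE_ι, Scheme.Opens.ι_apply]
    rfl

end

section

variable {B : Scheme.{0}} [B.Over (Spec (.of ℂ))]

lemma isoSpec_inv_homOfLE {U : B.Opens} {V W : AffineIn U} (h : V ≤ W) :
    Spec.map (CommRingCat.ofHom (Higgs.res h).toRingHom) ≫ W.1.2.isoSpec.inv =
      V.1.2.isoSpec.inv ≫ B.homOfLE (AffineIn.opens_mono h) := by
  rw [← cancel_mono W.opens.ι, Category.assoc, Category.assoc, Scheme.homOfLE_ι]
  exact W.1.2.map_fromSpec V.1.2 (homOfLE (AffineIn.opens_mono h)).op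

lemma isPullback_isoSpec_inv {U : B.Opens} {V W : AffineIn U} (h : V ≤ W) :
    IsPullback (Spec.map (CommRingCat.ofHom (Higgs.res h).toRingHom)) V.1.2.isoSpec.inv
      W.1.2.isoSpec.inv (B.homOfLE (AffineIn.opens_mono h)) :=
  IsPullback.of_vert_isIso ⟨isoSpec_inv_homOfLE h⟩

/-- A morphism of relative gluing data induces a morphism of the glued schemes. -/
def gluedMap {S : Scheme.{0}} {𝒰 : S.OpenCover} [Category 𝒰.I₀] [𝒰.LocallyDirected]
    [Small.{0} 𝒰.I₀] [Quiver.IsThin 𝒰.I₀] (d d' : 𝒰.RelativeGluingData)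
    (η : d.functor ⟶ d'.functor) : d.glued ⟶ d'.glued :=
  colimMap η

namespace HiggsSubbundle

variable {𝔈 : HiggsBundle B} {U : B.Opens} (F : HiggsSubbundle 𝔈 U) [IsSmoothCurve B]

/-- The diagram of the parts of the Higgs Grassmannian over the affine open subsets of `U`. -/
def hgrassFunctor : AffineIn U ⥤ Scheme.{0} where
  obj W := F.hgrassOver W
  map f := F.hgrassOverRes f.le
  map_id W := F.hgrassOverRes_self W _
  map_comp f g := F.hgrassOverRes_comp f.le g.le

/-- The gluing data of the Higgs Grassmannian. -/
def gluingData : (affineCover U).RelativeGluingData where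
  functor := F.hgrassFunctor
  natTrans :=
    { app W := F.hgrassOverToSpec W ≫ W.1.2.isoSpec.inv
      naturality V W f := by
        change F.hgrassOverRes f.le ≫ _ ≫ _ = (_ ≫ _) ≫ B.homOfLE (AffineIn.opens_mono f.le)
        rw [← Category.assoc, (F.isPullback_hgrassOverRes f.le).w, Category.assoc,
          isoSpec_inv_homOfLE, Category.assoc] }
  equifibered V W f := by
    exact (F.isPullback_hgrassOverRes f.le).paste_vert (isPullback_isoSpec_inv f.le)

/-- The Grassmannian of rank one Higgs subbundles (that is, of invariant lines) of `F`, as a scheme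
over `U`. It is the closed subscheme of the projective bundle of lines in `F` cut out by the
quadrics of `lineIdeal`. -/
def hgrass : Scheme.{0} := F.gluingData.glued

/-- The structure morphism of the Higgs Grassmannian. -/
def hgrassToBase : F.hgrass ⟶ U := F.gluingData.toBase

end HiggsSubbundle

/-- The restriction of the Higgs bundle `𝔈` to `U`. -/
def HiggsBundle.restrict (𝔈 : HiggsBundle B) (U : B.Opens) : HiggsSubbundle 𝔈 U where
  sec _ := ⊤
  span_res {V W} h := by
    have := 𝔈.isQuasicoherent
    obtain ⟨r, hr⟩ := id h
    have hE := isLocMod_resMod 𝔈.E (V := V.1) (W := W.1) h r hr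
    have hg := isLocRing_resAlg (V := V.1) (W := W.1) h r hr
    refine eq_top_iff.mpr fun y _ ↦ ?_
    obtain ⟨k, x, hx⟩ := hE.surj y
    have hu := hg.isUnit.pow k
    have : y = hu.unit⁻¹.1 • resMod 𝔈.E (AffineIn.opens_mono h) x := by
      rw [hx, smul_smul, hu.val_inv_mul, one_smul]
    rw [this]
    exact Submodule.smul_mem _ _ (Submodule.subset_span ⟨x, trivial, rfl⟩)
  projective W := inferInstance
  invariant W e _ := by
    exact LinearMap.rTensor_surjective _ (g := Submodule.subtype ⊤)
      (fun x ↦ ⟨⟨x, trivial⟩, rfl⟩) _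

namespace HiggsSubbundle

variable {𝔈 : HiggsBundle B} {U : B.Opens} (F : HiggsSubbundle 𝔈 U)

/-- The restriction to `F` of functionals on the Higgs bundle. -/
def resDual (W : AffineIn U) : 
    Module.Dual Γ(B, W.opens) ((𝔈.restrict U).sec W) →ₛₗ[RingHom.id Γ(B, W.opens)]
      Module.Dual Γ(B, W.opens) (F.sec W) :=
  LinearMap.lcomp _ _ (Submodule.inclusion (le_top : F.sec W ≤ (𝔈.restrict U).sec W))

lemma resDual_compat (W : AffineIn U) :
    LineRing.Compat ((𝔈.restrict U).endos W) (F.endos W) (F.resDual W) := by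
  rintro _ ⟨v, rfl⟩
  exact ⟨_, ⟨v, rfl⟩, fun α ↦ rfl⟩

lemma span_resDual (W : AffineIn U) :
    Submodule.span Γ(B, W.opens) (Set.range (F.resDual W)) = ⊤ := by
  refine eq_top_iff.mpr fun β _ ↦ Submodule.subset_span ?_
  have := F.projective W
  obtain ⟨p, hp⟩ := exists_retraction (F.sec W)
  refine ⟨β ∘ₗ p ∘ₗ Submodule.subtype _, LinearMap.ext fun x ↦ ?_⟩
  exact congrArg β (hp x)

variable [IsSmoothCurve B]

/-- The morphism induced by the inclusion of `F`, over an affine open subset. -/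
def hgrassOverIncl (W : AffineIn U) : F.hgrassOver W ⟶ (𝔈.restrict U).hgrassOver W :=
  LineRing.projMap _ (F.resDual W) (F.resDual_compat W) (F.span_resDual W)

lemma hgrassOverRes_incl {V W : AffineIn U} (h : V ≤ W) :
    F.hgrassOverRes h ≫ F.hgrassOverIncl W =
      F.hgrassOverIncl V ≫ (𝔈.restrict U).hgrassOverRes h := by
  have h₁ (α) : F.resDual V ((𝔈.restrict U).dualRes h α) = F.dualRes h (F.resDual W α) := by
    refine F.dual_ext h fun x ↦ ?_
    rw [dualRes_apply]
    exact (𝔈.restrict U).dualRes_apply h α ⟨x, trivial⟩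
  exact LineRing.projMap_square _ _ _ _ _ _ _ _ _ _ _ _ _ _ _ _ (fun _ ↦ rfl) fun α ↦ (h₁ α).symm

/-- The morphisms induced by the inclusion of `F`, over all affine open subsets. -/
def hgrassInclNatTrans : F.gluingData.functor ⟶ (𝔈.restrict U).gluingData.functor where
  app W := F.hgrassOverIncl W
  naturality _ _ f := F.hgrassOverRes_incl f.le

/-- The canonical morphism from the Higgs Grassmannian of `F` to that of the restriction of `𝔈` to
`U`, induced by the inclusion of `F`. -/
def hgrassIncl : F.hgrass ⟶ (𝔈.restrict U).hgrass :=
  gluedMap _ _ F.hgrassInclNatTrans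

end HiggsSubbundle

end

section

/-- The endomorphism `T` of the vector space `V` has Jordan type
`((μ v, size v j) ^ (mult v j) | v, j)`: there is a basis, made of `mult v j` chains of length
`size v j` for every `v` and `j`, such that `T - μ v` maps the first vector of each of these chains
to zero, and every other vector of the chain to the preceding one. -/
def HasJordanType {κ V : Type*} [Field κ] [AddCommGroup V] [Module κ V] (T : Module.End κ V)
    {s : ℕ} (μ : Fin s → κ) (J : Fin s → ℕ) (size mult : ∀ v, Fin (J v) → ℕ) : Prop :=
  ∃ b : Module.Basis (Σ v : Fin s, Σ j : Fin (J v), Fin (mult v j) × Fin (size v j)) κ V,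
    ∀ (v : Fin s) (j : Fin (J v)) (a : Fin (mult v j)),
      (∀ h : 0 < size v j, T (b ⟨v, j, a, ⟨0, h⟩⟩) = μ v • b ⟨v, j, a, ⟨0, h⟩⟩) ∧
      ∀ (k : ℕ) (h : k + 1 < size v j), T (b ⟨v, j, a, ⟨k + 1, h⟩⟩) =
        μ v • b ⟨v, j, a, ⟨k + 1, h⟩⟩ + b ⟨v, j, a, ⟨k, k.lt_succ_self.trans h⟩⟩

variable {B : Scheme.{0}} [B.Over (Spec (.of ℂ))]

/-- A section over `U` of the sheaf of differential forms of `B`. -/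
structure OneForm (U : B.Opens) where
  /-- the form on an affine open subset -/
  val (W : AffineIn U) : Ω[Γ(B, W.opens)⁄ℂ]
  val_res {V W : AffineIn U} (h : V ≤ W) : omegaRes (res h) (val W) = val V

namespace HiggsBundle

variable (𝔈 : HiggsBundle B) {U : B.Opens}

/-- The Higgs field has constant Jordan type `((lam v, size v j) ^ (mult v j) | v, j)` on `U`, with
distinct eigenvalues `lam v`: at every closed point `p` of `U`, the values at `p` of the forms
`lam v` are distinct, and the fibre of the Higgs field at `p` has this Jordan type. Here the fibre of
the cotangent bundle at `p` is identified with the residue field of `p` by any vector field `D` which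
does not vanish at `p`. -/
structure HasConstantJordanType {s : ℕ} (lam : Fin s → OneForm U) (J : Fin s → ℕ)
    (size mult : ∀ v, Fin (J v) → ℕ) : Prop where
  pos_J (v : Fin s) : 0 < J v
  pos_size (v : Fin s) (j : Fin (J v)) : 0 < size v j
  pos_mult (v : Fin s) (j : Fin (J v)) : 0 < mult v j
  injective_size (v : Fin s) : Function.Injective (size v)
  injective (W : AffineIn U) (p : Ideal Γ(B, W.opens)) [p.IsMaximal]
    (D : Module.Dual Γ(B, W.opens) Ω[Γ(B, W.opens)⁄ℂ]) (hD : ∃ ω, D ω ∉ p) :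
    Function.Injective fun v ↦ algebraMap Γ(B, W.opens) p.ResidueField (D ((lam v).val W))
  hasJordanType (W : AffineIn U) (p : Ideal Γ(B, W.opens)) [p.IsMaximal]
    (D : Module.Dual Γ(B, W.opens) Ω[Γ(B, W.opens)⁄ℂ]) (hD : ∃ ω, D ω ∉ p) :
    HasJordanType ((𝔈.endo W.1 D).baseChange p.ResidueField)
      (fun v ↦ algebraMap Γ(B, W.opens) p.ResidueField (D ((lam v).val W))) J size mult

/-- The sections over `W` of the generalized eigensheaf of the Higgs field for the eigenvalue `lam`:
those which are annihilated by some power of `φ_D - lam_D`, for every vector field `D`. -/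
def genEigenspace (lam : OneForm U) (W : AffineIn U) :
    Submodule Γ(B, W.opens) Γ(𝔈.E, W.opens) :=
  ⨅ D : Module.Dual Γ(B, W.opens) Ω[Γ(B, W.opens)⁄ℂ],
    (𝔈.endo W.1 D).maxGenEigenspace (D (lam.val W))

end HiggsBundle

end

end Higgs

end

/-!
The theorem is proved over an arbitrary affine open subset `W` of `U`, with ring of functions `R`
and module of sections `M`, without choosing a generator of the differentials. A vector field `D`
turns the Higgs field into an endomorphism `T D` of `M`. Since the differentials have rank one,
the vector fields satisfy `D ω • D' = D' ω • D`, so that the endomorphisms `T D` are proportional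
to each other up to functions `D ω`, and these functions have no common zero. The constancy of the
Jordan type is a condition at the closed points, but `R` is a Jacobson domain: it follows that
`∏ v, (T D - D (lam v)) ^ N = 0` if `D` is not zero, and that the differences of the `D (lam v)` are
invertible wherever `D` does not vanish (`HiggsBundle.HasConstantJordanType.isSpectral`).

Consequently, the cofactors of the polynomials `(X - D (lam v)) ^ N` generate the unit ideal where
`D` does not vanish, and `M` is the direct sum of the common generalized eigenspaces
(`IsSpectral.exists_isDecomposition`). The projection `π v` onto an eigenspace is locally a
polynomial in `T D`. An endomorphism which is a polynomial in `T D` preserves every line preserved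
by `T D`, even universally: in the homogeneous coordinate ring of the scheme of invariant lines,
`α · (β ∘ π v) = β · (α ∘ π v)` for all linear coordinates `α` and `β` (`IsSpectral.mem_quad`).
Taking `β` to vanish on the eigenspace shows that the coordinates along the eigenspace annihilate
those along its complement. So where a coordinate along the eigenspace is invertible, the
invariant lines are those of the eigenspace, and the scheme of invariant lines in the eigenspace
is an open subscheme (`LineRing.isOpenImmersion_projMap`). These open subschemes are pairwise
disjoint and cover, so they form a coproduct. The statements glue over `U` because the squares
formed by the morphism of Grassmannians and their parts over `W` are cartesian
(`HiggsSubbundle.isPullback_hgrassOverIncl`).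

For the connectedness of a summand over `W` (`LineRing.connectedSpace_proj`), the structure
morphism to `Spec R` is closed, its target is irreducible, and it suffices that the fibres at
closed points are nonempty and irreducible. On the eigenspace, `T D` is the sum of a scalar and a
nilpotent endomorphism `f`, and the coordinates `α ∘ f` are nilpotent in the line ring
(`isNilpotent_coord_comp`). So the fibre is, up to nilpotents, the projective space of lines in
the common kernel of these endomorphisms. It is nonempty, since the endomorphisms `f` are
proportional to a single one near a given closed point (`LineRing.conormal_ne_top`), and the
eigenspace is not zero in the fibre (`IsSpectral.exists_dual_notMem`). Finally, the parts over
nonempty affine open subsets meet pairwise, since the curve is irreducible.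
-/

noncomputable section
namespace Higgs
universe u

/-! ### Endomorphisms of a given Jordan type, and Bézout identities -/

section Jordan

open Polynomial

variable {κ V : Type*} [Field κ] [AddCommGroup V] [Module κ V] {T : Module.End κ V}
    {s : ℕ} {μ : Fin s → κ} {J : Fin s → ℕ} {size mult : ∀ v, Fin (J v) → ℕ}

lemma HasJordanType.aeval_prod_eq_zero (h : HasJordanType T μ J size mult) {N : ℕ}
    (hN : ∀ v j, size v j ≤ N) : aeval T (∏ v, (X - C (μ v)) ^ N) = 0 := by
  obtain ⟨b, hb⟩ := h
  have key (v j a) (k : ℕ) (hk : k < size v j) :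
      (T - algebraMap κ _ (μ v)) ^ (k + 1) • b ⟨v, j, a, ⟨k, hk⟩⟩ = 0 := by
    induction k with
    | zero => simp [(hb v j a).1 hk]
    | succ k ih =>
      rw [pow_succ, mul_smul]
      have : (T - algebraMap κ _ (μ v)) • b ⟨v, j, a, ⟨k + 1, hk⟩⟩ =
          b ⟨v, j, a, ⟨k, k.lt_succ_self.trans hk⟩⟩ := by
        simp [(hb v j a).2 k hk]
      rw [this, ih]
  refine b.ext fun ⟨v, j, a, k⟩ ↦ ?_
  have hle : k.1 + 1 ≤ N := k.2.trans_le (hN v j)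
  rw [← Finset.prod_erase_mul _ _ (Finset.mem_univ v), ← Nat.sub_add_cancel hle, pow_add,
    ← mul_assoc, map_mul, Module.End.mul_apply]
  have := key v j a k.1 k.2
  simp only [map_pow, map_sub, aeval_X, aeval_C]
  rw [Module.End.smul_def] at this
  rw [this, map_zero, LinearMap.zero_apply]

lemma HasJordanType.exists_eigenvector (h : HasJordanType T μ J size mult) (v : Fin s)
    (hJ : 0 < J v) (hs : ∀ j, 0 < size v j) (hm : ∀ j, 0 < mult v j) :
    ∃ b ≠ 0, T b = μ v • b := by
  obtain ⟨b, hb⟩ := h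
  exact ⟨b ⟨v, ⟨0, hJ⟩, ⟨0, hm _⟩, ⟨0, hs _⟩⟩, b.ne_zero _, (hb v _ _).1 _⟩

end Jordan

section Bezout

open Polynomial

variable {R : Type*} [CommRing R] {ι : Type*} [Fintype ι] [DecidableEq ι]

/-- The product of the `(X - l w) ^ N` over `w ≠ v`. -/
def cofactor (l : ι → R) (N : ℕ) (v : ι) : R[X] := ∏ w ∈ Finset.univ.erase v, (X - C (l w)) ^ N

lemma cofactor_mul (l : ι → R) (N : ℕ) (v : ι) :
    (X - C (l v)) ^ N * cofactor l N v = ∏ w, (X - C (l w)) ^ N :=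
  Finset.mul_prod_erase _ _ (Finset.mem_univ v)

/-- If the differences of the `l v` become invertible after inverting `r`, then the cofactors of the
`(X - l v) ^ N` generate the unit ideal after inverting `r`: a prime ideal containing all the
cofactors contains two distinct `X - l v`, hence their difference, hence `r`. -/
lemma exists_sum_mul_cofactor [Nonempty ι] (l : ι → R) (N : ℕ) (r : R)
    (hr : ∀ v w, v ≠ w → r ∈ (Ideal.span {l v - l w}).radical) :
    ∃ (K : ℕ) (a : ι → R[X]), ∑ v, a v * cofactor l N v = C (r ^ K) := by
  have hmem : C r ∈ (Ideal.span (Set.range (cofactor l N))).radical := by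
    rw [Ideal.radical_eq_sInf, Ideal.mem_sInf]
    rintro P ⟨hP, hPp⟩
    have h₁ (v : ι) : ∃ w ≠ v, X - C (l w) ∈ P := by
      have : cofactor l N v ∈ P := hP (Ideal.subset_span ⟨v, rfl⟩)
      obtain ⟨w, hw, hw'⟩ := (hPp.prod_mem_iff).mp this
      exact ⟨w, (Finset.mem_erase.mp hw).1, hPp.mem_of_pow_mem _ hw'⟩
    obtain ⟨v, -, hv⟩ := h₁ (Classical.arbitrary ι)
    obtain ⟨w, hne, hw⟩ := h₁ v
    obtain ⟨k, hk⟩ := hr v w hne.symm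
    obtain ⟨c, hc⟩ := Ideal.mem_span_singleton.mp hk
    have : C r ^ k ∈ P := by
      have e : C r ^ k = ((X - C (l w)) - (X - C (l v))) * C c := by
        rw [← map_pow, hc, map_mul, map_sub]; ring
      rw [e]
      exact P.mul_mem_right _ (P.sub_mem hw hv)
    exact hPp.mem_of_pow_mem _ this
  obtain ⟨K, hK⟩ := hmem
  obtain ⟨a, ha⟩ := Ideal.mem_span_range_iff_exists_fun.mp hK
  exact ⟨K, a, by rw [ha, map_pow]⟩

end Bezout

/-! ### Endomorphisms preserving the universal line -/

section Quad

variable {R : Type u} [CommRing R] {M : Type u} [AddCommGroup M] [Module R M]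

open LineRing in
/-- The endomorphisms `f` of `M` which preserve the universal line in the scheme of lines preserved
by `Φ`: those for which the quadrics `α · (β ∘ f) - β · (α ∘ f)` vanish in the line ring. -/
def quad (Φ : Set (Module.End R M)) : Submodule R (Module.End R M) where
  carrier := {f | ∀ α β : Module.Dual R M,
    coord R M Φ α * coord R M Φ (β ∘ₗ f) = coord R M Φ β * coord R M Φ (α ∘ₗ f)}
  zero_mem' α β := by simp
  add_mem' {f g} hf hg α β := by
    rw [LinearMap.comp_add, LinearMap.comp_add, map_add, map_add, mul_add, mul_add, hf, hg]
  smul_mem' c f hf α β := by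
    rw [LinearMap.comp_smul, LinearMap.comp_smul, map_smul, map_smul, mul_smul_comm, mul_smul_comm,
      hf]

variable {Φ : Set (Module.End R M)}

open LineRing in
lemma coord_mul_coord_comp {f : Module.End R M} (hf : f ∈ quad Φ) (α β : Module.Dual R M) :
    coord R M Φ α * coord R M Φ (β ∘ₗ f) = coord R M Φ β * coord R M Φ (α ∘ₗ f) := hf α β

lemma subset_quad : Φ ⊆ quad Φ := fun _ h α β ↦ LineRing.coord_rel h α β

lemma one_mem_quad : (1 : Module.End R M) ∈ quad Φ := fun _ _ ↦ mul_comm _ _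

lemma mul_mem_quad {f g : Module.End R M} (hf : f ∈ quad Φ) (hg : g ∈ quad Φ)
    (h : Commute f g) : f * g ∈ quad Φ := by
  intro α β
  have e₁ := hg α (β ∘ₗ f)
  have e₂ := hf (α ∘ₗ g) β
  have e₃ : (α ∘ₗ g) ∘ₗ f = α ∘ₗ (f * g) := by rw [h.eq]; rfl
  rw [e₃, mul_comm] at e₂
  exact e₁.trans e₂

lemma aeval_mem_quad {f : Module.End R M} (hf : f ∈ quad Φ) (P : Polynomial R) :
    Polynomial.aeval f P ∈ quad Φ := by
  have hpow (n : ℕ) : f ^ n ∈ quad Φ := by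
    induction n with
    | zero => exact one_mem_quad
    | succ n ih => exact pow_succ f n ▸ mul_mem_quad ih hf ((Commute.refl f).pow_left n)
  induction P using Polynomial.induction_on' with
  | add p q hp hq => rw [map_add]; exact add_mem hp hq
  | monomial n a =>
    rw [Polynomial.aeval_monomial, ← Algebra.smul_def]
    exact Submodule.smul_mem _ _ (hpow n)

end Quad

/-! ### Direct sum decompositions and dual bases -/

section Decomposition

/-- The endomorphisms `π v` are the projections onto the summands of a direct sum decomposition of
the module `M` into the submodules `F v`. -/
structure IsDecomposition {R M ι : Type*} [CommRing R] [AddCommGroup M] [Module R M] [Fintype ι]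
    (F : ι → Submodule R M) (π : ι → Module.End R M) : Prop where
  mem (v : ι) (e : M) : π v e ∈ F v
  sum (e : M) : ∑ v, π v e = e
  zero {v w : ι} (h : v ≠ w) {e : M} (he : e ∈ F w) : π v e = 0

namespace IsDecomposition

variable {R M ι : Type*} [CommRing R] [AddCommGroup M] [Module R M] [Fintype ι]
    {F : ι → Submodule R M} {π : ι → Module.End R M}

lemma apply_eq (h : IsDecomposition F π) {v : ι} {e : M} (he : e ∈ F v) : π v e = e := by
  conv_rhs => rw [← h.sum e]
  rw [Finset.sum_eq_single v (fun w _ hw ↦ h.zero hw he) (by simp)]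

lemma commute (h : IsDecomposition F π) {f : Module.End R M} (hf : ∀ v, ∀ e ∈ F v, f e ∈ F v)
    (v : ι) : Commute f (π v) := by
  classical
  refine LinearMap.ext fun e ↦ ?_
  conv_rhs => rw [← h.sum e]
  simp only [Module.End.mul_apply, map_sum]
  rw [Finset.sum_eq_single v (fun w _ hw ↦ h.zero hw.symm (hf _ _ (h.mem w e))) (by simp),
    h.apply_eq (hf _ _ (h.mem v e))]

lemma projective [Module.Projective R M] (h : IsDecomposition F π) (v : ι) :
    Module.Projective R (M ⧸ F v) := by
  refine .of_split ((F v).liftQ (1 - π v) fun e he ↦ ?_) (F v).mkQ ?_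
  · simp [h.apply_eq he]
  · refine Submodule.linearMap_qext _ (LinearMap.ext fun e ↦ ?_)
    simp [h.mem v e]

lemma of_iSup_eq_top [DecidableEq ι] (hi : iSupIndep F) (hs : iSup F = ⊤) :
    ∃ π : ι → Module.End R M, IsDecomposition F π := by
  have hint := (DirectSum.isInternal_submodule_iff_iSupIndep_and_iSup_eq_top F).mpr ⟨hi, hs⟩
  let e : (DirectSum ι fun v ↦ F v) ≃ₗ[R] M := .ofBijective (DirectSum.coeLinearMap F) hint
  have he (w : ι) (z : F w) : e (DirectSum.lof R ι (fun v ↦ F v) w z) = z :=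
    DirectSum.coeLinearMap_lof F w z
  refine ⟨fun v ↦ (F v).subtype ∘ₗ DirectSum.component R ι _ v ∘ₗ e.symm.toLinearMap, ?_, ?_, ?_⟩
  · intro v x
    exact Subtype.property _
  · intro x
    obtain ⟨y, rfl⟩ := e.surjective x
    simp only [LinearMap.comp_apply, LinearEquiv.coe_coe, e.symm_apply_apply]
    conv_rhs => rw [← DirectSum.sum_univ_of y, map_sum]
    exact Finset.sum_congr rfl fun v _ ↦ (he v _).symm
  · intro v w hvw x hx
    have hx' : e.symm x = DirectSum.lof R ι (fun v ↦ F v) w ⟨x, hx⟩ :=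
      e.symm_apply_eq.mpr (he w ⟨x, hx⟩).symm
    simp only [LinearMap.comp_apply, LinearEquiv.coe_coe, hx', DirectSum.component.of]
    rw [dif_neg hvw.symm, map_zero]

end IsDecomposition

end Decomposition

lemma exists_dualBasis (R M : Type*) [CommRing R] [AddCommGroup M] [Module R M]
    [Module.Finite R M] [Module.Projective R M] :
    ∃ (n : ℕ) (m : Fin n → M) (γ : Fin n → Module.Dual R M), ∀ e, ∑ i, γ i e • m i = e := by
  obtain ⟨n, f, g, -, -, hfg⟩ := Module.Finite.exists_comp_eq_id_of_projective R M
  refine ⟨n, fun i ↦ f (Pi.single i 1), fun i ↦ LinearMap.proj i ∘ₗ g, fun e ↦ ?_⟩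
  conv_rhs => rw [← LinearMap.id_apply (R := R) e, ← hfg, LinearMap.comp_apply,
    ← Finset.univ_sum_single (g e), map_sum]
  refine Finset.sum_congr rfl fun i _ ↦ ?_
  rw [LinearMap.comp_apply, LinearMap.proj_apply, ← map_smul, ← Pi.single_smul, smul_eq_mul,
    mul_one]

/-! ### Common generalized eigenspaces of proportional endomorphisms -/

section Spectral

open Polynomial

variable {R : Type u} [CommRing R] {M : Type u} [AddCommGroup M] [Module R M]
  {Ω : Type*} [AddCommGroup Ω] [Module R Ω] {ι : Type*} [Fintype ι]

/-- A family of endomorphisms `T D`, depending on a functional `D` on a module `Ω` of rank one, with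
eigenvalues `D (lam v)`. Their differences become invertible after inverting any `D ω`, and the
polynomial `∏ v, (X - D (lam v)) ^ N` annihilates `T D` if `D` is not zero. The linear dependence on
`D` and the rank of `Ω` are encoded by the proportionalities `smul_comm` and `rank_one`; no
generator of `Ω` is required to exist. -/
structure IsSpectral (T : Module.Dual R Ω → Module.End R M) (lam : ι → Ω) (N : ℕ) : Prop where
  rank_one (D D' : Module.Dual R Ω) (ω ω' : Ω) : D ω * D' ω' = D' ω * D ω'
  smul_comm (D D' : Module.Dual R Ω) (ω : Ω) : D ω • T D' = D' ω • T D
  exists_notMem (p : Ideal R) (hp : p.IsMaximal) : ∃ D : Module.Dual R Ω, ∃ ω, D ω ∉ p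
  mem_radical (D : Module.Dual R Ω) (ω : Ω) {v w : ι} (h : v ≠ w) :
    D ω ∈ (Ideal.span {D (lam v) - D (lam w)}).radical
  aeval_eq_zero (D : Module.Dual R Ω) (ω : Ω) (h : D ω ≠ 0) :
    aeval (T D) (∏ v, (X - C (D (lam v))) ^ N) = 0

/-- The common generalized eigenspace of the endomorphisms `T D` for the eigenvalues `D lam`. -/
def commonGenEigenspace (T : Module.Dual R Ω → Module.End R M) (lam : Ω) : Submodule R M :=
  ⨅ D : Module.Dual R Ω, (T D).maxGenEigenspace (D lam)

namespace IsSpectral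

variable {T : Module.Dual R Ω → Module.End R M} {lam : ι → Ω} {N : ℕ}

lemma smul_sub_pow (h : IsSpectral T lam N) (D D' : Module.Dual R Ω) (ω : Ω) (v : ι) (k : ℕ) :
    D ω ^ k • (T D' - D' (lam v) • 1) ^ k = D' ω ^ k • (T D - D (lam v) • 1) ^ k := by
  rw [← _root_.smul_pow, ← _root_.smul_pow, smul_sub, smul_sub, h.smul_comm, smul_smul, smul_smul,
    h.rank_one]

/-- After multiplication by a power of `D ω`, the projections are polynomials in `T D`. -/
lemma exists_aeval [DecidableEq ι] (h : IsSpectral T lam N)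
    {D : Module.Dual R Ω} {ω : Ω} (hD : D ω ≠ 0) :
    ∃ (K : ℕ) (P : ι → R[X]), (∀ e, ∑ v, aeval (T D) (P v) e = D ω ^ K • e) ∧
      ∀ v, cofactor (fun v ↦ D (lam v)) N v ∣ P v := by
  cases isEmpty_or_nonempty ι
  · refine ⟨0, isEmptyElim, fun e ↦ ?_, isEmptyElim⟩
    have := congr($(h.aeval_eq_zero D ω hD) e)
    simp only [Finset.univ_eq_empty, Finset.prod_empty, map_one, Module.End.one_apply,
      LinearMap.zero_apply] at this
    simp [this]
  · obtain ⟨K, a, ha⟩ := exists_sum_mul_cofactor (fun v ↦ D (lam v)) N (D ω)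
      fun v w hvw ↦ h.mem_radical D ω hvw
    refine ⟨K, fun v ↦ a v * cofactor (fun v ↦ D (lam v)) N v, fun e ↦ ?_, fun v ↦ dvd_mul_left _ _⟩
    have := congr(aeval (T D) $ha e)
    rw [map_sum, LinearMap.sum_apply] at this
    rw [this, aeval_C, Module.algebraMap_end_apply]

variable [IsDomain R]

lemma exists_ne_zero (h : IsSpectral T lam N) : ∃ D : Module.Dual R Ω, ∃ ω, D ω ≠ 0 := by
  obtain ⟨p, hp⟩ := Ideal.exists_maximal R
  obtain ⟨D, ω, hD⟩ := h.exists_notMem p hp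
  exact ⟨D, ω, fun e ↦ hD (e ▸ p.zero_mem)⟩

variable [Module.IsTorsionFree R M]

/-- A single nonzero `D` determines the common generalized eigenspaces, since every
other one is proportional to it after multiplication by a nonzero scalar. -/
lemma commonGenEigenspace_eq (h : IsSpectral T lam N) {D : Module.Dual R Ω} {ω : Ω} (hD : D ω ≠ 0)
    (v : ι) : commonGenEigenspace T (lam v) = (T D).maxGenEigenspace (D (lam v)) := by
  refine le_antisymm (iInf_le _ D) (le_iInf fun D' e he ↦ ?_)
  rw [Module.End.mem_maxGenEigenspace] at he ⊢
  obtain ⟨k, hk⟩ := he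
  refine ⟨k, (smul_eq_zero_iff_right (pow_ne_zero k hD)).mp ?_⟩
  have := congr($(h.smul_sub_pow D D' ω v k) e)
  rwa [LinearMap.smul_apply, LinearMap.smul_apply, hk, smul_zero] at this

lemma commute (h : IsSpectral T lam N) (D D' : Module.Dual R Ω) : Commute (T D) (T D') := by
  obtain ⟨D₀, ω, h₀⟩ := h.exists_ne_zero
  have key (D₁ : Module.Dual R Ω) : Commute (T D₀) (T D₁) := by
    refine LinearMap.ext fun e ↦ smul_right_injective M h₀ ?_
    have e₁ := h.smul_comm D₀ D₁ ω
    have e₂ := congr($e₁ (T D₀ e))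
    have e₃ := congr(T D₀ ($e₁ e))
    simp only [LinearMap.smul_apply, map_smul] at e₂ e₃
    simp only [Module.End.mul_apply, e₂, e₃]
  refine LinearMap.ext fun e ↦ smul_right_injective M h₀ ?_
  have e₁ := h.smul_comm D₀ D ω
  have e₂ := congr($e₁ (T D' e))
  have e₃ := congr(T D' ($e₁ e))
  simp only [LinearMap.smul_apply, map_smul] at e₂ e₃
  have := LinearMap.congr_fun (key D').eq e
  simp only [Module.End.mul_apply] at this ⊢
  rw [e₂, e₃, this]

lemma map_mem (h : IsSpectral T lam N) (D : Module.Dual R Ω) {v : ι} {e : M}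
    (he : e ∈ commonGenEigenspace T (lam v)) : T D e ∈ commonGenEigenspace T (lam v) := by
  obtain ⟨D₀, ω, h₀⟩ := h.exists_ne_zero
  rw [h.commonGenEigenspace_eq h₀] at he ⊢
  exact Module.End.mapsTo_maxGenEigenspace_of_comm (h.commute D₀ D) _ he

lemma iSupIndep (h : IsSpectral T lam N) : iSupIndep fun v ↦ commonGenEigenspace T (lam v) := by
  obtain ⟨D, ω, hD⟩ := h.exists_ne_zero
  simp only [h.commonGenEigenspace_eq hD]
  refine (T D).independent_maxGenEigenspace.comp (f := fun v ↦ D (lam v)) fun v w e ↦ ?_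
  by_contra hvw
  have := h.mem_radical D ω hvw
  replace e : D (lam v) = D (lam w) := e
  rw [e, sub_self, Ideal.span_singleton_eq_bot.mpr rfl] at this
  exact hD (by simpa using this)

variable [DecidableEq ι]

lemma aeval_cofactor_mem (h : IsSpectral T lam N) {D : Module.Dual R Ω} {ω : Ω} (hD : D ω ≠ 0)
    (v : ι) (e : M) :
    aeval (T D) (cofactor (fun v ↦ D (lam v)) N v) e ∈ commonGenEigenspace T (lam v) := by
  rw [h.commonGenEigenspace_eq hD, Module.End.mem_maxGenEigenspace]
  refine ⟨N, ?_⟩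
  have := congr($(h.aeval_eq_zero D ω hD) e)
  rw [← cofactor_mul _ _ v, map_mul] at this
  simpa [Algebra.algebraMap_eq_smul_one] using this

lemma aeval_mem_of_dvd (h : IsSpectral T lam N) {D : Module.Dual R Ω} {ω : Ω} (hD : D ω ≠ 0)
    {v : ι} {P : R[X]} (hP : cofactor (fun v ↦ D (lam v)) N v ∣ P) (e : M) :
    aeval (T D) P e ∈ commonGenEigenspace T (lam v) := by
  obtain ⟨Q, rfl⟩ := hP
  rw [map_mul]
  exact h.aeval_cofactor_mem hD v _

/-- The module is the direct sum of the common generalized eigenspaces. Their sum contains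
`D ω ^ K • e` for every `e`, and the functions `D ω` have no common zero. -/
lemma exists_isDecomposition (h : IsSpectral T lam N) :
    ∃ π : ι → Module.End R M, IsDecomposition (fun v ↦ commonGenEigenspace T (lam v)) π := by
  refine IsDecomposition.of_iSup_eq_top h.iSupIndep ?_
  let S : Submodule R M := ⨆ v, commonGenEigenspace T (lam v)
  let I : Ideal R := Module.annihilator R (M ⧸ S)
  suffices I = ⊤ by
    refine eq_top_iff.mpr fun e _ ↦ ?_
    have h₁ : (1 : R) ∈ I := this ▸ Submodule.mem_top
    have := Module.mem_annihilator.mp h₁ (S.mkQ e)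
    rwa [one_smul, Submodule.mkQ_apply, Submodule.Quotient.mk_eq_zero] at this
  by_contra hI
  obtain ⟨p, hp, hIp⟩ := Ideal.exists_le_maximal I hI
  obtain ⟨D, ω, hD⟩ := h.exists_notMem p hp
  have h₀ : D ω ≠ 0 := fun e ↦ hD (e ▸ p.zero_mem)
  obtain ⟨K, P, hP, hP'⟩ := h.exists_aeval h₀
  refine hD (hp.isPrime.mem_of_pow_mem K (hIp ?_))
  rw [Module.mem_annihilator]
  intro e
  obtain ⟨e, rfl⟩ := S.mkQ_surjective e
  rw [← map_smul, ← hP e, Submodule.mkQ_apply, Submodule.Quotient.mk_eq_zero]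
  exact sum_mem fun v _ ↦ (le_iSup (fun v ↦ commonGenEigenspace T (lam v)) v)
    (h.aeval_mem_of_dvd h₀ (hP' v) e)

lemma aeval_eq_smul (h : IsSpectral T lam N) {π : ι → Module.End R M}
    (hπ : IsDecomposition (fun v ↦ commonGenEigenspace T (lam v)) π)
    {D : Module.Dual R Ω} {ω : Ω} (hD : D ω ≠ 0) {K : ℕ} {P : ι → R[X]}
    (hP : ∀ e, ∑ v, aeval (T D) (P v) e = D ω ^ K • e)
    (hP' : ∀ v, cofactor (fun v ↦ D (lam v)) N v ∣ P v) (v : ι) :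
    aeval (T D) (P v) = D ω ^ K • π v := by
  refine LinearMap.ext fun e ↦ ?_
  have := congr(π v $(hP e))
  rwa [map_sum, Finset.sum_eq_single v
    (fun w _ hw ↦ hπ.zero hw.symm (h.aeval_mem_of_dvd hD (hP' w) e)) (by simp),
    hπ.apply_eq (h.aeval_mem_of_dvd hD (hP' v) e), map_smul] at this

/-- The projections preserve the universal line: after multiplication by functions without a common
zero they become polynomials in the endomorphisms `T D`. -/
lemma mem_quad (h : IsSpectral T lam N) {π : ι → Module.End R M}
    (hπ : IsDecomposition (fun v ↦ commonGenEigenspace T (lam v)) π) (v : ι) :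
    π v ∈ quad (Set.range T) := by
  let I : Ideal R := (quad (Set.range T)).comap (LinearMap.toSpanSingleton R _ (π v))
  suffices I = ⊤ by
    have h₁ : (1 : R) ∈ I := this ▸ Submodule.mem_top
    simpa [I] using h₁
  by_contra hI
  obtain ⟨p, hp, hIp⟩ := Ideal.exists_le_maximal I hI
  obtain ⟨D, ω, hD⟩ := h.exists_notMem p hp
  have h₀ : D ω ≠ 0 := fun e ↦ hD (e ▸ p.zero_mem)
  obtain ⟨K, P, hP, hP'⟩ := h.exists_aeval h₀
  refine hD (hp.isPrime.mem_of_pow_mem K (hIp ?_))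
  change D ω ^ K • π v ∈ quad (Set.range T)
  rw [← h.aeval_eq_smul hπ h₀ hP hP']
  exact aeval_mem_quad (subset_quad (Set.mem_range_self D)) _

lemma sub_pow_apply_eq_zero (h : IsSpectral T lam N) (D : Module.Dual R Ω) {v : ι} {e : M}
    (he : e ∈ commonGenEigenspace T (lam v)) : ((T D - D (lam v) • 1) ^ N) e = 0 := by
  obtain ⟨D₀, ω, h₀⟩ := h.exists_ne_zero
  suffices H : ((T D₀ - D₀ (lam v) • 1) ^ N) e = 0 by
    refine (smul_eq_zero_iff_right (pow_ne_zero N h₀)).mp ?_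
    have := congr($(h.smul_sub_pow D₀ D ω v N) e)
    rwa [LinearMap.smul_apply, LinearMap.smul_apply, H, smul_zero] at this
  obtain ⟨π, hπ⟩ := h.exists_isDecomposition
  obtain ⟨K, P, hP, hP'⟩ := h.exists_aeval h₀
  refine (smul_eq_zero_iff_right (pow_ne_zero K h₀)).mp ?_
  rw [← map_smul]
  have e₁ := congr($(h.aeval_eq_smul hπ h₀ hP hP' v) e)
  rw [LinearMap.smul_apply, hπ.apply_eq he] at e₁
  obtain ⟨Q, hQ⟩ := hP' v
  have e₂ := congr($(h.aeval_eq_zero D₀ ω h₀) (aeval (T D₀) Q e))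
  rw [← cofactor_mul _ _ v, ← Module.End.mul_apply, ← map_mul, mul_assoc, ← hQ, map_mul,
    Module.End.mul_apply, e₁] at e₂
  simpa [Algebra.algebraMap_eq_smul_one] using e₂

/-- Every common generalized eigensheaf is nonzero in the fibre at `p`, if the fibre of `T D` has an
eigenvector: the cofactor of `(X - D (lam v)) ^ N` acts on this eigenvector by a nonzero scalar. -/
lemma exists_dual_notMem [Module.Finite R M] [Module.Projective R M] (h : IsSpectral T lam N)
    {D : Module.Dual R Ω} {ω : Ω} (hD : D ω ≠ 0) (p : Ideal R) [p.IsPrime] (v : ι)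
    (hne : ∀ w, w ≠ v → algebraMap R p.ResidueField (D (lam v)) ≠ algebraMap R _ (D (lam w)))
    {b : p.ResidueField ⊗[R] M} (hb : b ≠ 0)
    (hTb : (T D).baseChange p.ResidueField b = algebraMap R p.ResidueField (D (lam v)) • b) :
    ∃ (α : Module.Dual R (commonGenEigenspace T (lam v))) (e : commonGenEigenspace T (lam v)),
      α e ∉ p := by
  by_contra! H
  refine hb ?_
  set κ := p.ResidueField
  set P := cofactor (fun v ↦ D (lam v)) N v with hPdef
  have hP (e : M) := h.aeval_cofactor_mem hD v e
  let c : κ := (P.map (algebraMap R κ)).eval (algebraMap R κ (D (lam v)))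
  have hc : c ≠ 0 := by
    simp only [c, hPdef, cofactor, Polynomial.map_prod, Polynomial.eval_prod]
    refine Finset.prod_ne_zero_iff.mpr fun w hw ↦ ?_
    simpa [sub_eq_zero] using fun e ↦ absurd e (hne w (Finset.mem_erase.mp hw).1)
  have hPb : (aeval (T D) P).baseChange κ b = c • b := by
    have e₁ : (aeval (T D) P).baseChange κ =
        aeval ((T D).baseChange κ) (P.map (algebraMap R κ)) := by
      rw [aeval_map_algebraMap]
      exact (aeval_algHom_apply (Module.End.baseChangeHom R κ M) (T D) P).symm
    rw [e₁]
    exact Module.End.aeval_apply_of_hasEigenvector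
      ⟨Module.End.mem_eigenspace_iff.mpr hTb, hb⟩
  -- The cofactor maps into the eigenspace, on which all functionals vanish modulo `p`.
  have hzero (γ : Module.Dual R M) (x : κ ⊗[R] M) :
      γ.baseChange κ ((aeval (T D) P).baseChange κ x) = 0 := by
    induction x using TensorProduct.induction_on with
    | zero => simp
    | add x y hx hy => rw [map_add, map_add, hx, hy, add_zero]
    | tmul a e =>
      have := H (γ ∘ₗ Submodule.subtype _) ⟨_, hP e⟩
      rw [← Ideal.algebraMap_residueField_eq_zero] at this
      simp only [LinearMap.comp_apply, Submodule.subtype_apply] at this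
      simp only [P, LinearMap.baseChange_tmul, Module.Dual.baseChange_apply_tmul]
      rw [Algebra.smul_def, this, zero_mul]
  have hb' (γ : Module.Dual R M) : γ.baseChange κ b = 0 := by
    have := hzero γ b
    rw [hPb, map_smul] at this
    exact (smul_eq_zero_iff_right hc).mp this
  obtain ⟨n, m, γ, hm⟩ := exists_dualBasis R M
  have hx (x : κ ⊗[R] M) : ∑ i, (γ i).baseChange κ x • (1 : κ) ⊗ₜ[R] m i = x := by
    induction x using TensorProduct.induction_on with
    | zero => simp
    | add x y hx hy => simp only [map_add, add_smul, Finset.sum_add_distrib, hx, hy]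
    | tmul a e =>
      conv_rhs => rw [← hm e, TensorProduct.tmul_sum]
      refine Finset.sum_congr rfl fun i _ ↦ ?_
      simp [TensorProduct.smul_tmul', Algebra.smul_def, mul_comm]
  rw [← hx b]
  simp [hb']

end IsSpectral

end Spectral

/-! ### Lines in a direct summand -/

section Restriction

variable {R : Type u} [CommRing R] {M : Type u} [AddCommGroup M] [Module R M]
  {N : Type u} [AddCommGroup N] [Module R N]
  {Φ : Set (Module.End R M)} {Ψ : Set (Module.End R N)} {j : N →ₗ[R] M}

namespace LineRing

lemma induction {motive : LineRing R M Φ → Prop}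
    (algebraMap : ∀ r, motive (algebraMap R _ r)) (coord : ∀ α, motive (coord R M Φ α))
    (mul : ∀ x y, motive x → motive y → motive (x * y))
    (add : ∀ x y, motive x → motive y → motive (x + y)) (x : LineRing R M Φ) : motive x := by
  obtain ⟨x, rfl⟩ := Ideal.Quotient.mk_surjective x
  induction x using SymmetricAlgebra.induction with
  | algebraMap r => exact algebraMap r
  | ι α => exact coord α
  | mul x y hx hy => exact mul _ _ hx hy
  | add x y hx hy => exact add _ _ hx hy

variable (j) in
/-- The transpose of the linear map `j`, as a semilinear map. -/
def dualRestrict : Module.Dual R M →ₛₗ[RingHom.id R] Module.Dual R N := LinearMap.lcomp _ _ j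

@[simp] lemma dualRestrict_apply (α : Module.Dual R M) (x : N) :
    dualRestrict j α x = α (j x) := rfl

/-- If `π` is a projection onto `N` commuting with `Φ`, then composition with `π` induces a section
of the restriction homomorphism between the line rings of `M` and `N`. -/
def extend (π : M →ₗ[R] N) (hΨ : ∀ ψ ∈ Ψ, ∃ φ ∈ Φ, ∀ e, ψ (π e) = π (φ e)) :
    LineRing R N Ψ →ₐ[R] LineRing R M Φ :=
  lift (coord R M Φ ∘ₗ LinearMap.lcomp R R π) fun ψ hψ α β ↦ by
    obtain ⟨φ, hφ, H⟩ := hΨ ψ hψ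
    have e (γ : Module.Dual R N) : (γ ∘ₗ ψ) ∘ₗ π = (γ ∘ₗ π) ∘ₗ φ :=
      LinearMap.ext fun x ↦ congrArg γ (H x)
    simp only [LinearMap.comp_apply, LinearMap.lcomp_apply']
    rw [e, e]
    exact coord_rel hφ _ _

@[simp] lemma extend_coord (π : M →ₗ[R] N) (hΨ) (β : Module.Dual R N) :
    extend (Φ := Φ) (Ψ := Ψ) π hΨ (coord R N Ψ β) = coord R M Φ (β ∘ₗ π) :=
  lift_coord _ _ _

variable (π : M →ₗ[R] N) (hπ : ∀ x, π (j x) = x)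
  (hΨ : ∀ ψ ∈ Ψ, ∃ φ ∈ Φ, ∀ e, ψ (π e) = π (φ e))
  (hquad : j ∘ₗ π ∈ quad Φ) (h : Compat Φ Ψ (dualRestrict j))

lemma extend_mem {n : ℕ} {y : LineRing R N Ψ} (hy : y ∈ deg R N Ψ n) :
    extend π hΨ y ∈ deg R M Φ n := by
  unfold deg at hy
  induction hy using Submodule.pow_induction_on_left' with
  | algebraMap r =>
    rw [AlgHom.commutes, deg, pow_zero]
    exact Submodule.algebraMap_mem _
  | add x y i hx hy ihx ihy => rw [map_add]; exact add_mem ihx ihy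
  | mem_mul m hm i x hx ih =>
    obtain ⟨α, rfl⟩ := hm
    rw [map_mul, extend_coord, deg, pow_succ']
    exact Submodule.mul_mem_mul ⟨_, rfl⟩ ih

include hπ hquad in
/-- On the scheme of lines, the coordinates along two complementary summands have product zero. -/
lemma coord_comp_mul_coord (α : Module.Dual R N) (β : Module.Dual R M) (hβ : ∀ x, β (j x) = 0) :
    coord R M Φ (α ∘ₗ π) * coord R M Φ β = 0 := by
  have e₁ : (α ∘ₗ π) ∘ₗ j ∘ₗ π = α ∘ₗ π := LinearMap.ext fun x ↦ by simp [hπ]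
  have e₂ : β ∘ₗ j ∘ₗ π = 0 := LinearMap.ext fun x ↦ by simp [hβ]
  have := coord_mul_coord_comp hquad β (α ∘ₗ π)
  rw [e₁, e₂, map_zero, mul_zero] at this
  rw [mul_comm, this]

include hπ hquad in
lemma coord_mul_extend (α : Module.Dual R N) (x : LineRing R M Φ) :
    coord R M Φ (α ∘ₗ π) * extend π hΨ (mapRingHom _ (dualRestrict j) h x) =
      coord R M Φ (α ∘ₗ π) * x := by
  induction x using induction with
  | algebraMap r => rw [mapRingHom_algebraMap, AlgHom.commutes]; rfl
  | coord β =>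
    rw [mapRingHom_coord, extend_coord, ← sub_eq_zero, ← mul_sub, ← map_sub]
    exact coord_comp_mul_coord π hπ hquad α _ fun x ↦ by simp [hπ]
  | mul x y hx hy => rw [map_mul, map_mul, ← mul_assoc, hx, mul_right_comm, hy]; ring
  | add x y hx hy => rw [map_add, map_add, mul_add, mul_add, hx, hy]

include hπ hquad hΨ in
open HomogeneousLocalization in
/-- Where a coordinate along the summand `N` is invertible, the line ring of `M` is that of `N`. -/
lemma bijective_awayMap (α : Module.Dual R N) :
    Function.Bijective (Away.map (map _ (dualRestrict j) h) (coord R M Φ (α ∘ₗ π))) := by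
  set a := coord R M Φ (α ∘ₗ π) with ha'
  have ha : a ∈ deg R M Φ 1 := coord_mem _
  set f := map _ (dualRestrict j) h
  have hf (β : Module.Dual R N) : f (coord R M Φ (β ∘ₗ π)) = coord R N Ψ β := by
    rw [map_coord]
    exact congrArg _ (LinearMap.ext fun x ↦ by simp [hπ])
  constructor
  · rw [injective_iff_map_eq_zero]
    intro z hz
    obtain ⟨n, x, hx, rfl⟩ := Away.mk_surjective (𝒜 := deg R M Φ) (f := a) ha z
    rw [Away.map_mk, HomogeneousLocalization.ext_iff_val, Away.val_mk, val_zero,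
      Localization.mk_eq_mk', IsLocalization.mk'_eq_zero_iff] at hz
    obtain ⟨⟨_, k, rfl⟩, hk⟩ := hz
    rw [HomogeneousLocalization.ext_iff_val, Away.val_mk, val_zero, Localization.mk_eq_mk',
      IsLocalization.mk'_eq_zero_iff]
    refine ⟨⟨a ^ (k + 1), k + 1, rfl⟩, ?_⟩
    -- Multiplication by `a` cancels the difference between `x` and the extension of its image.
    have e : f (a ^ k * x) = 0 := by rw [map_mul, map_pow]; exact hk
    have := coord_mul_extend π hπ hΨ hquad h α (a ^ k * x)
    change _ * extend π hΨ (f (a ^ k * x)) = _ at this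
    rw [e, map_zero, mul_zero, ← ha', ← mul_assoc, ← pow_succ'] at this
    exact this.symm
  · intro z
    obtain ⟨n, y, hy, rfl⟩ := Away.mk_surjective (𝒜 := deg R N Ψ) (f := f a) (f.2 ha) z
    have hs (y : LineRing R N Ψ) : f (extend π hΨ y) = y := by
      induction y using induction with
      | algebraMap r => rw [AlgHom.commutes]; exact map_algebraMap _ _ _ _
      | coord β => rw [extend_coord, hf]
      | mul x y hx hy => rw [map_mul, map_mul, hx, hy]
      | add x y hx hy => rw [map_add, map_add, hx, hy]
    refine ⟨Away.mk _ ha n _ (extend_mem π hΨ hy), ?_⟩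
    rw [Away.map_mk]
    simp only [hs]

lemma isPullback_projMap_awayι (hd : Submodule.span R (Set.range (dualRestrict j)) = ⊤)
    (α : Module.Dual R M) :
    IsPullback (Proj.awayι (deg R N Ψ) (map _ (dualRestrict j) h (coord R M Φ α))
        ((map _ (dualRestrict j) h).2 (coord_mem α)) one_pos)
      (Spec.map (CommRingCat.ofHom (HomogeneousLocalization.Away.map
        (map _ (dualRestrict j) h) (coord R M Φ α))))
      (projMap _ (dualRestrict j) h hd)
      (Proj.awayι (deg R M Φ) (coord R M Φ α) (coord_mem α) one_pos) :=
  (IsOpenImmersion.isPullback _ _ _ _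
    (Proj.awayι_comp_map (map _ _ h) (irrelevant_le_map _ _ h hd) one_pos _ (coord_mem α))
    (by rw [Proj.opensRange_awayι, Proj.opensRange_awayι, Proj.map_preimage_basicOpen])).flip

include hπ hquad hΨ in
lemma isIso_SpecMap_awayMap (α : Module.Dual R N) :
    IsIso (Spec.map (CommRingCat.ofHom (HomogeneousLocalization.Away.map
      (map _ (dualRestrict j) h) (coord R M Φ (α ∘ₗ π))))) := by
  have : IsIso (CommRingCat.ofHom (HomogeneousLocalization.Away.map
      (map _ (dualRestrict j) h) (coord R M Φ (α ∘ₗ π)))) :=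
    (ConcreteCategory.isIso_iff_bijective _).mpr (bijective_awayMap π hπ hΨ hquad h α)
  infer_instance

include hπ hquad hΨ in
/-- The scheme of lines in a direct summand `N` is open in that of lines in `M`, if the projection
to `N` preserves the universal line. -/
lemma isOpenImmersion_projMap (hd : Submodule.span R (Set.range (dualRestrict j)) = ⊤) :
    IsOpenImmersion (projMap _ (dualRestrict j) h hd) := by
  let a : Module.Dual R N ⊕ {β : Module.Dual R M // ∀ x, β (j x) = 0} → Module.Dual R M :=
    Sum.elim (fun α ↦ α ∘ₗ π) Subtype.val
  have hspan : (irrelevant (deg R M Φ)).toIdeal ≤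
      Ideal.span (Set.range fun i ↦ coord R M Φ (a i)) := by
    refine irrelevant_le.trans (Ideal.span_le.mpr ?_)
    rintro _ ⟨α, rfl⟩
    have e : α = (α ∘ₗ j) ∘ₗ π + (α - (α ∘ₗ j) ∘ₗ π) := by abel
    rw [e, map_add]
    refine add_mem (Ideal.subset_span ⟨.inl _, rfl⟩) (Ideal.subset_span ⟨.inr ⟨_, fun x ↦ ?_⟩, rfl⟩)
    simp [hπ]
  let 𝒰 := Proj.affineOpenCoverOfIrrelevantLESpan _ _ (fun i ↦ coord_mem (Φ := Φ) (a i))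
    (fun _ ↦ one_pos) hspan
  refine IsZariskiLocalAtTarget.of_openCover 𝒰.openCover ?_
  suffices ∀ i, IsOpenImmersion (pullback.snd (projMap _ (dualRestrict j) h hd)
      (Proj.awayι (deg R M Φ) (coord R M Φ (a i)) (coord_mem (a i)) one_pos)) from this
  intro i
  have h₁ := isPullback_projMap_awayι h hd (a i)
  have h₂ : IsOpenImmersion (Spec.map (CommRingCat.ofHom (HomogeneousLocalization.Away.map
      (map _ (dualRestrict j) h) (coord R M Φ (a i))))) := by
    obtain α | ⟨β, hβ⟩ := i
    · exact @IsOpenImmersion.of_isIso _ _ _ (isIso_SpecMap_awayMap π hπ hΨ hquad h α)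
    · -- Here the source is empty, since `β` restricts to zero on `N`.
      have h₀ : map _ (dualRestrict j) h (coord R M Φ (a (.inr ⟨β, hβ⟩))) = 0 := by
        rw [map_coord, show dualRestrict j (a (.inr ⟨β, hβ⟩)) = 0 from LinearMap.ext hβ, map_zero]
      have := HomogeneousLocalization.subsingleton (deg R N Ψ)
        (x := .powers (map _ (dualRestrict j) h (coord R M Φ (a (.inr ⟨β, hβ⟩))))) ⟨1, by simp [h₀]⟩
      have : IsEmpty (Spec (.of (HomogeneousLocalization.Away (deg R N Ψ)
          (map _ (dualRestrict j) h (coord R M Φ (a (.inr ⟨β, hβ⟩))))))) :=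
        inferInstanceAs (IsEmpty (PrimeSpectrum _))
      infer_instance
  rw [← h₁.isoPullback_inv_snd]
  infer_instance

include hπ hquad hΨ in
lemma basicOpen_le_range_projMap (hd : Submodule.span R (Set.range (dualRestrict j)) = ⊤)
    (α : Module.Dual R N) {x : Proj (deg R M Φ)}
    (hx : x ∈ Proj.basicOpen (deg R M Φ) (coord R M Φ (α ∘ₗ π))) :
    x ∈ Set.range (projMap _ (dualRestrict j) h hd) := by
  have := isIso_SpecMap_awayMap π hπ hΨ hquad h α
  rw [← Proj.opensRange_awayι _ _ (coord_mem _) one_pos] at hx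
  obtain ⟨y, rfl⟩ := hx
  obtain ⟨z, rfl⟩ := (Scheme.homeoOfIso (asIso (Spec.map (CommRingCat.ofHom
    (HomogeneousLocalization.Away.map (map _ (dualRestrict j) h)
      (coord R M Φ (α ∘ₗ π))))))).surjective y
  refine ⟨_, congr($((isPullback_projMap_awayι h hd (α ∘ₗ π)).w) z)⟩

lemma exists_mem_basicOpen (x : Proj (deg R M Φ)) :
    ∃ α, x ∈ Proj.basicOpen (deg R M Φ) (coord R M Φ α) :=
  TopologicalSpace.Opens.mem_iSup.mp
    ((Proj.iSup_basicOpen_eq_top (deg R M Φ) _ irrelevant_le).ge (Set.mem_univ x))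

lemma exists_mem_basicOpen_comp {ι : Type*} [Fintype ι] {N : ι → Type u}
    [∀ i, AddCommGroup (N i)] [∀ i, Module R (N i)] {j : ∀ i, N i →ₗ[R] M} {π : ∀ i, M →ₗ[R] N i}
    (hsum : ∀ e, ∑ i, j i (π i e) = e) (x : Proj (deg R M Φ)) :
    ∃ (i : ι) (α : Module.Dual R (N i)),
      x ∈ Proj.basicOpen (deg R M Φ) (coord R M Φ (α ∘ₗ π i)) := by
  obtain ⟨α, hα⟩ := exists_mem_basicOpen x
  by_contra! H
  have e : α = ∑ i, (α ∘ₗ j i) ∘ₗ π i := LinearMap.ext fun e ↦ by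
    conv_lhs => rw [← hsum e, map_sum]
    simp
  rw [Proj.mem_basicOpen, e, map_sum] at hα
  exact hα (sum_mem fun i _ ↦ not_not.mp ((Proj.mem_basicOpen _ _ _).not.mp (H i _)))

lemma projMap_mem_basicOpen (hd : Submodule.span R (Set.range (dualRestrict j)) = ⊤)
    (α : Module.Dual R M) (y : Proj (deg R N Ψ)) :
    projMap _ (dualRestrict j) h hd y ∈ Proj.basicOpen (deg R M Φ) (coord R M Φ α) ↔
      y ∈ Proj.basicOpen (deg R N Ψ) (coord R N Ψ (dualRestrict j α)) := by
  rw [← map_coord _ _ h, ← Proj.map_preimage_basicOpen _ (irrelevant_le_map _ _ h hd)]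
  rfl

include hπ in
/-- The schemes of lines in two complementary summands do not meet. -/
lemma projMap_ne {N' : Type u} [AddCommGroup N'] [Module R N'] {j' : N' →ₗ[R] M}
    {Ψ' : Set (Module.End R N')}
    (h' : Compat Φ Ψ' (dualRestrict j')) (hj' : ∀ x, π (j' x) = 0)
    (hd : Submodule.span R (Set.range (dualRestrict j)) = ⊤)
    (hd' : Submodule.span R (Set.range (dualRestrict j')) = ⊤)
    (y : Proj (deg R N Ψ)) (z : Proj (deg R N' Ψ')) :
    projMap _ (dualRestrict j) h hd y ≠ projMap _ (dualRestrict j') h' hd' z := by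
  intro e
  obtain ⟨β, hβ⟩ := exists_mem_basicOpen y
  have h₁ : dualRestrict j (β ∘ₗ π) = β := LinearMap.ext fun x ↦ by simp [hπ]
  have h₂ : dualRestrict j' (β ∘ₗ π) = 0 := LinearMap.ext fun x ↦ by simp [hj']
  rw [← h₁, ← projMap_mem_basicOpen h hd, e, projMap_mem_basicOpen, h₂, map_zero,
    Proj.basicOpen_zero] at hβ
  exact hβ

end LineRing

end Restriction

/-! ### Connectedness of schemes of lines -/

section Connected

variable {R : Type u} [CommRing R] {M : Type u} [AddCommGroup M] [Module R M]
  {Φ : Set (Module.End R M)}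

/-- The coordinates in the image of the transpose of a nilpotent endomorphism preserving the
universal line are nilpotent, since `(α ∘ f) ^ 2 = α · (α ∘ f ^ 2)` in the line ring. -/
lemma isNilpotent_coord_comp {f : Module.End R M} (hf : f ∈ quad Φ) (hn : IsNilpotent f)
    (α : Module.Dual R M) : IsNilpotent (LineRing.coord R M Φ (α ∘ₗ f)) := by
  obtain ⟨n, hn⟩ := hn
  have hpow (k : ℕ) : f ^ k ∈ quad Φ := by
    simpa using aeval_mem_quad hf (Polynomial.X ^ k)
  have key (m : ℕ) : ∀ k, n ≤ k * 2 ^ m → IsNilpotent (LineRing.coord R M Φ (α ∘ₗ f ^ k)) := by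
    induction m with
    | zero =>
      intro k hk
      rw [pow_eq_zero_of_le (by simpa using hk) hn, LinearMap.comp_zero, map_zero]
      exact IsNilpotent.zero
    | succ m ih =>
      intro k hk
      have h₁ : IsNilpotent (LineRing.coord R M Φ (α ∘ₗ f ^ (k + k))) :=
        ih (k + k) (hk.trans_eq (by ring))
      have h₂ := coord_mul_coord_comp (hpow k) α (α ∘ₗ f ^ k)
      have h₃ : (α ∘ₗ f ^ k) ∘ₗ f ^ k = α ∘ₗ f ^ (k + k) := by rw [pow_add]; rfl
      rw [h₃, ← sq] at h₂
      obtain ⟨j, hj⟩ := h₁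
      exact ⟨2 * j, by rw [pow_mul, ← h₂, mul_pow, hj, mul_zero]⟩
  simpa using key n 1 (by simpa using Nat.lt_two_pow_self.le)

namespace LineRing

lemma algebraMap_mem_deg_zero (r : R) : algebraMap R (LineRing R M Φ) r ∈ deg R M Φ 0 := by
  rw [deg, pow_zero]
  exact Submodule.algebraMap_mem _

lemma base_mem_basicOpen (x : Proj (deg R M Φ)) (r : R) :
    base R M Φ x ∈ PrimeSpectrum.basicOpen r ↔
      x ∈ Proj.basicOpen (deg R M Φ) (algebraMap R _ r) := by
  obtain ⟨α, hα⟩ := exists_mem_basicOpen x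
  have hx := hα
  rw [← Proj.opensRange_awayι _ _ (coord_mem α) one_pos] at hx
  obtain ⟨z, rfl⟩ := hx
  have hg : coord R M Φ α * algebraMap R _ r ∈ deg R M Φ 1 :=
    SetLike.mul_mem_graded (A := deg R M Φ) (coord_mem α) (algebraMap_mem_deg_zero r)
  have h₁ : z ∈ Proj.awayι (deg R M Φ) _ (coord_mem α) one_pos ⁻¹ᵁ
      Proj.basicOpen _ (coord R M Φ α * algebraMap R _ r) ↔ z ∈ PrimeSpectrum.basicOpen
        (HomogeneousLocalization.Away.isLocalizationElem (coord_mem α) hg) := by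
    rw [Proj.awayι_preimage_basicOpen (deg R M Φ) (coord_mem α) one_pos hg one_pos]
    rfl
  rw [Proj.basicOpen_mul] at h₁
  have h₂ := h₁.symm.trans (and_iff_right hα)
  refine Iff.trans ?_ h₂
  rw [← Scheme.Hom.comp_apply, awayι_base]
  have h₃ : HomogeneousLocalization.Away.isLocalizationElem (coord_mem α) hg =
      HomogeneousLocalization.fromZeroRingHom (deg R M Φ) (.powers (coord R M Φ α))
        (algebraMap R (deg R M Φ 0) r) := by
    ext
    change (HomogeneousLocalization.Away.mk _ _ _ _ _).val = _
    rw [HomogeneousLocalization.Away.val_mk]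
    change _ = algebraMap _ _ (algebraMap R (LineRing R M Φ) r)
    rw [← Localization.mk_one_eq_algebraMap, Localization.mk_eq_mk_iff, Localization.r_iff_exists]
    refine ⟨1, ?_⟩
    simp
  rw [h₃]
  rfl

lemma specializes_of_le {x y : ProjectiveSpectrum (deg R M Φ)}
    (h : x.asHomogeneousIdeal ≤ y.asHomogeneousIdeal) : x ⤳ y :=
  specializes_iff_mem_closure.mpr ((ProjectiveSpectrum.le_iff_mem_closure _ _ _).mp h)

lemma adjoin_coord_eq_top {s : Set (Module.Dual R M)} (hs : Submodule.span R s = ⊤) :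
    Algebra.adjoin R (coord R M Φ '' s) = ⊤ := by
  refine eq_top_iff.mpr fun x h ↦ ?_
  clear h
  induction x using induction with
  | algebraMap r => exact Subalgebra.algebraMap_mem _ _
  | coord α =>
    have h : α ∈ Submodule.span R s := hs ▸ Submodule.mem_top
    induction h using Submodule.span_induction with
    | mem β hβ => exact Algebra.subset_adjoin ⟨β, hβ, rfl⟩
    | zero => rw [map_zero]; exact zero_mem _
    | add x y _ _ hx hy => rw [map_add]; exact add_mem hx hy
    | smul a x _ hx => rw [map_smul]; exact Subalgebra.smul_mem _ hx a
  | mul x y hx hy => exact mul_mem hx hy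
  | add x y hx hy => exact add_mem hx hy

instance [Module.Finite R (Module.Dual R M)] : Algebra.FiniteType R (LineRing R M Φ) := by
  obtain ⟨s, hs⟩ := Module.Finite.fg_top (R := R) (M := Module.Dual R M)
  classical
  exact ⟨⟨s.image (coord R M Φ), by rw [Finset.coe_image]; exact adjoin_coord_eq_top hs⟩⟩

instance [Module.Finite R (Module.Dual R M)] : UniversallyClosed (base R M Φ) := by
  have h₁ : ((algebraMap (deg R M Φ 0) (LineRing R M Φ)).comp
      (algebraMap R (deg R M Φ 0))).FiniteType :=
    (inferInstance : Algebra.FiniteType R (LineRing R M Φ))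
  have : Algebra.FiniteType (deg R M Φ 0) (LineRing R M Φ) :=
    RingHom.finiteType_algebraMap.mp h₁.of_comp_finiteType
  have : IsClosedImmersion (Spec.map (CommRingCat.ofHom (algebraMap R (deg R M Φ 0)))) := by
    refine IsClosedImmersion.spec_of_surjective _ ?_
    rintro ⟨x, hx⟩
    rw [deg, pow_zero] at hx
    obtain ⟨r, hr⟩ := Submodule.mem_one.mp hx
    exact ⟨r, Subtype.ext hr⟩
  unfold base
  infer_instance

variable (p : Ideal R) (𝒩 : Set (Module.End R M))

/-- The functionals vanishing, in the fibre at `p`, on the common kernel of the endomorphisms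
in `𝒩`. -/
def conormal : Submodule R (Module.Dual R M) :=
  p • ⊤ ⊔ Submodule.span R {γ | ∃ f ∈ 𝒩, ∃ β : Module.Dual R M, γ = β ∘ₗ f}

variable {p 𝒩}

lemma comp_mem_conormal {f : Module.End R M} (hf : f ∈ 𝒩) (β : Module.Dual R M) :
    β ∘ₗ f ∈ conormal p 𝒩 :=
  Submodule.mem_sup_right (Submodule.subset_span ⟨f, hf, β, rfl⟩)

/-- Up to nilpotents, the line ring of the fibre at `p` is the symmetric algebra of a vector space,
if the endomorphisms in `Φ` differ from scalars by nilpotent endomorphisms. -/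
lemma exists_hom_domain [p.IsMaximal] (h𝒩 : 𝒩 ⊆ quad Φ) (hn : ∀ f ∈ 𝒩, IsNilpotent f)
    (hΦ : ∀ φ ∈ Φ, ∃ l : R, φ - l • 1 ∈ 𝒩) (htop : conormal p 𝒩 ≠ ⊤) :
    ∃ (S : Type u) (_ : CommRing S) (_ : IsDomain S) (f : LineRing R M Φ →+* S),
      (∀ r, f (algebraMap R _ r) = 0 ↔ r ∈ p) ∧ (∃ α, f (coord R M Φ α) ≠ 0) ∧
      ∀ P : Ideal (LineRing R M Φ), P.IsPrime → (∀ r ∈ p, algebraMap R _ r ∈ P) →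
        RingHom.ker f ≤ P := by
  let Q := Module.Dual R M ⧸ conormal p 𝒩
  have hQ : Module.IsTorsionBySet R Q p := by
    intro q r
    obtain ⟨α, rfl⟩ := Submodule.mkQ_surjective _ q
    rw [← map_smul, Submodule.mkQ_apply, Submodule.Quotient.mk_eq_zero]
    exact Submodule.mem_sup_left (Submodule.smul_mem_smul r.2 trivial)
  let : Field (R ⧸ p) := Ideal.Quotient.field p
  let : Module (R ⧸ p) Q := hQ.module
  have hsmul (r : R) (q : Q) : Ideal.Quotient.mk p r • q = r • q := rfl
  let S := SymmetricAlgebra (R ⧸ p) Q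
  let g₀ : R →+* S := (algebraMap (R ⧸ p) S).comp (Ideal.Quotient.mk p)
  let ι : Q →ₗ[R ⧸ p] S := SymmetricAlgebra.ι (R ⧸ p) Q
  let q : Module.Dual R M →ₗ[R] Q := (conormal p 𝒩).mkQ
  have hq (φ) (hφ : φ ∈ Φ) : ∃ l : R, ∀ β, ι (q (β ∘ₗ φ)) = g₀ l * ι (q β) := by
    obtain ⟨l, hl⟩ := hΦ φ hφ
    refine ⟨l, fun β ↦ ?_⟩
    have : q (β ∘ₗ φ) = Ideal.Quotient.mk p l • q β := by
      rw [hsmul, ← map_smul, ← sub_eq_zero, ← map_sub, Submodule.mkQ_apply,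
        Submodule.Quotient.mk_eq_zero]
      convert comp_mem_conormal (p := p) hl β using 1
      ext x
      simp
    rw [this, map_smul, Algebra.smul_def]
    rfl
  let f : LineRing R M Φ →+* S :=
    letI := g₀.toAlgebra
    (lift (Φ := Φ) (C := S)
      { toFun := fun α ↦ ι (q α)
        map_add' := fun α β ↦ by rw [map_add, map_add]
        map_smul' := fun r α ↦ by
          rw [map_smul, ← hsmul, map_smul, Algebra.smul_def]; rfl }
      (by
        intro φ hφ α β
        obtain ⟨l, hl⟩ := hq φ hφ
        simp only [LinearMap.coe_mk, AddHom.coe_mk, hl]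
        ring)).toRingHom
  have hf₀ (r : R) : f (algebraMap R _ r) = g₀ r := by
    let := g₀.toAlgebra
    exact AlgHom.commutes _ r
  have hf₁ (α) : f (coord R M Φ α) = ι (q α) := by
    let := g₀.toAlgebra
    exact lift_coord _ _ α
  refine ⟨S, inferInstance, inferInstance, f, fun r ↦ ?_, ?_, fun P hP hpP ↦ ?_⟩
  · rw [hf₀]
    change algebraMap (R ⧸ p) S _ = 0 ↔ _
    rw [SymmetricAlgebra.algebraMap_eq_zero_iff, Ideal.Quotient.eq_zero_iff_mem]
  · by_contra! H
    refine htop (eq_top_iff.mpr fun α _ ↦ ?_)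
    rw [← Submodule.Quotient.mk_eq_zero]
    refine (Module.forall_dual_apply_eq_zero_iff (R ⧸ p) (q α)).mp fun γ ↦ ?_
    have := congr(SymmetricAlgebra.lift γ $((hf₁ α).symm.trans (H α)))
    rwa [SymmetricAlgebra.lift_ι_apply, map_zero] at this
  · let k₀ : R ⧸ p →+* LineRing R M Φ ⧸ P :=
      Ideal.Quotient.lift p ((Ideal.Quotient.mk P).comp (algebraMap R _)) fun r hr ↦
        Ideal.Quotient.eq_zero_iff_mem.mpr (hpP r hr)
    let k₁ : Q →ₗ[R] LineRing R M Φ ⧸ P := (conormal p 𝒩).liftQ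
      ((Ideal.Quotient.mkₐ R P).toLinearMap ∘ₗ coord R M Φ) (by
        refine sup_le (Submodule.smul_le.mpr ?_) (Submodule.span_le.mpr ?_)
        · intro r hr α _
          rw [LinearMap.mem_ker, map_smul, Algebra.smul_def]
          have : algebraMap R (LineRing R M Φ ⧸ P) r = 0 :=
            Ideal.Quotient.eq_zero_iff_mem.mpr (hpP r hr)
          rw [this, zero_mul]
        · rintro _ ⟨f, hf, β, rfl⟩
          obtain ⟨n, hn⟩ := isNilpotent_coord_comp (h𝒩 hf) (hn f hf) β
          exact Ideal.Quotient.eq_zero_iff_mem.mpr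
            (hP.mem_of_pow_mem n (hn ▸ P.zero_mem)))
    let : Algebra (R ⧸ p) (LineRing R M Φ ⧸ P) := k₀.toAlgebra
    let k : S →ₐ[R ⧸ p] LineRing R M Φ ⧸ P := SymmetricAlgebra.lift
      { toFun := k₁
        map_add' := map_add k₁
        map_smul' := fun r x ↦ by
          obtain ⟨r, rfl⟩ := Ideal.Quotient.mk_surjective r
          rw [hsmul, map_smul, Algebra.smul_def, Algebra.smul_def]
          rfl }
    have hk : k.toRingHom.comp f = Ideal.Quotient.mk P := by
      refine ringHom_ext (fun r ↦ ?_) fun α ↦ ?_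
      · change k (f _) = _
        rw [hf₀]
        exact k.commutes _
      · change k (f _) = _
        rw [hf₁]
        exact SymmetricAlgebra.lift_ι_apply _ _
    intro x hx
    rw [← Ideal.Quotient.eq_zero_iff_mem, ← hk]
    change k (f x) = 0
    rw [RingHom.mem_ker.mp hx, map_zero]

/-- The fibre at a maximal ideal is irreducible. -/
lemma exists_specializes [hp : p.IsMaximal] (h𝒩 : 𝒩 ⊆ quad Φ) (hn : ∀ f ∈ 𝒩, IsNilpotent f)
    (hΦ : ∀ φ ∈ Φ, ∃ l : R, φ - l • 1 ∈ 𝒩) (htop : conormal p 𝒩 ≠ ⊤) :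
    ∃ x₀ : Proj (deg R M Φ), base R M Φ x₀ = ⟨p, hp.isPrime⟩ ∧
      ∀ x, base R M Φ x = ⟨p, hp.isPrime⟩ → x₀ ⤳ x := by
  obtain ⟨S, _, _, f, hf₀, ⟨α, hα⟩, hf⟩ := exists_hom_domain h𝒩 hn hΦ htop
  have hcore : (Ideal.homogeneousCore (deg R M Φ) (RingHom.ker f)).toIdeal ≤ RingHom.ker f :=
    Ideal.toIdeal_homogeneousCore_le _ _
  have hmem (x : Proj (deg R M Φ)) (r : R) : r ∈ (base R M Φ x).asIdeal ↔
      algebraMap R _ r ∈ (x : ProjectiveSpectrum (deg R M Φ)).asHomogeneousIdeal := by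
    have := (base_mem_basicOpen x r).not
    rw [Proj.mem_basicOpen, not_not] at this
    exact (not_not.symm.trans this)
  -- The kernel of `f` is the smallest prime ideal over `p`; its homogeneous core is the generic
  -- point of the fibre.
  let x₀ : ProjectiveSpectrum (deg R M Φ) :=
    { asHomogeneousIdeal := Ideal.homogeneousCore (deg R M Φ) (RingHom.ker f)
      isPrime := (RingHom.ker_isPrime f).homogeneousCore
      not_irrelevant_le := fun h ↦ hα (hcore (h
        (HomogeneousIdeal.mem_irrelevant_of_mem _ one_pos (coord_mem α)))) }
  refine ⟨x₀, ?_, fun x hx ↦ specializes_of_le ?_⟩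
  · refine PrimeSpectrum.ext (Ideal.ext fun r ↦ ?_)
    refine (hmem x₀ r).trans ⟨fun h ↦ (hf₀ r).mp (hcore h), fun h ↦ ?_⟩
    exact Ideal.mem_homogeneousCore_of_homogeneous_of_mem ⟨0, algebraMap_mem_deg_zero r⟩
      ((hf₀ r).mpr h)
  · refine hcore.trans (hf _ (ProjectiveSpectrum.isPrime _) fun r hr ↦ (hmem x r).mp ?_)
    rw [hx]
    exact hr

/-- The scheme of lines is connected: its structure morphism is closed, the base is irreducible, and
the fibres at the closed points, which are projective spaces up to nilpotents, are nonempty and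
irreducible. -/
lemma connectedSpace_proj [IsDomain R] [IsJacobsonRing R] [Module.Finite R (Module.Dual R M)]
    (h𝒩 : 𝒩 ⊆ quad Φ) (hn : ∀ f ∈ 𝒩, IsNilpotent f) (hΦ : ∀ φ ∈ Φ, ∃ l : R, φ - l • 1 ∈ 𝒩)
    (htop : ∀ p : Ideal R, p.IsMaximal → conormal p 𝒩 ≠ ⊤) :
    ConnectedSpace (Proj (deg R M Φ)) := by
  have hpt (p : Ideal R) (hp : p.IsMaximal) := exists_specializes h𝒩 hn hΦ (htop p hp)
  have hclosed : IsClosedMap (base R M Φ) := (base R M Φ).isClosedMap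
  have hpre : PreconnectedSpace (Proj (deg R M Φ)) := by
    refine preconnectedSpace_iff_clopen.mpr fun Z hZ ↦ ?_
    have h₁ : IsClosed (base R M Φ '' Z) := hclosed _ hZ.1
    have h₂ : IsClosed (base R M Φ '' Zᶜ) := hclosed _ hZ.compl.1
    have hdisj : Disjoint (base R M Φ '' Z) (base R M Φ '' Zᶜ) := by
      rw [Set.disjoint_left]
      intro y hy hy'
      -- Otherwise both images contain a closed point, whose fibre is irreducible.
      obtain ⟨m, hm, hle⟩ := Ideal.exists_le_maximal (y : PrimeSpectrum R).asIdeal y.2.ne_top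
      have hs : y ⤳ (⟨m, hm.isPrime⟩ : PrimeSpectrum R) :=
        (PrimeSpectrum.le_iff_specializes _ _).mp hle
      obtain ⟨x, hx, hxm⟩ := hs.mem_closed h₁ hy
      obtain ⟨x', hx', hxm'⟩ := hs.mem_closed h₂ hy'
      obtain ⟨x₀, -, h⟩ := hpt m hm
      exact (h x' hxm').mem_open hZ.compl.2 hx' ((h x hxm).mem_open hZ.2 hx)
    have hunion : base R M Φ '' Z ∪ base R M Φ '' Zᶜ = Set.univ := by
      -- The closed points are dense, and the fibres over them are not empty.
      have : JacobsonSpace (PrimeSpectrum R) :=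
        PrimeSpectrum.isJacobsonRing_iff_jacobsonSpace.mp ‹_›
      refine Set.eq_univ_of_univ_subset (closure_closedPoints.symm.subset.trans
        ((h₁.union h₂).closure_subset_iff.mpr fun y hy ↦ ?_))
      have hm := (PrimeSpectrum.isClosed_singleton_iff_isMaximal y).mp hy
      obtain ⟨x₀, h₀, -⟩ := hpt _ hm
      rw [← Set.image_union, Set.union_compl_self]
      exact ⟨x₀, trivial, h₀⟩
    have hclopen : IsClopen (base R M Φ '' Z) := by
      refine ⟨h₁, ?_⟩
      rw [← isClosed_compl_iff]
      convert h₂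
      exact (IsCompl.of_eq hdisj.inter_eq hunion).compl_eq
    obtain h | h := isClopen_iff.mp hclopen
    · exact .inl (Set.image_eq_empty.mp h)
    · right
      rw [h, Set.univ_disjoint, Set.image_eq_empty, Set.compl_empty_iff] at hdisj
      exact hdisj
  obtain ⟨m, hm⟩ := Ideal.exists_maximal R
  obtain ⟨x₀, -, -⟩ := hpt m hm
  exact { toNonempty := ⟨x₀⟩ }

end LineRing

end Connected

section Eigenlines

variable {R : Type u} [CommRing R] {M : Type u} [AddCommGroup M] [Module R M]

/-- A module which is nonzero in the fibre at `p` has a line in this fibre annihilated by a given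
nilpotent endomorphism `f₀`, hence by all endomorphisms proportional to `f₀` near `p`. -/
lemma LineRing.conormal_ne_top {p : Ideal R} [hp : p.IsMaximal] {𝒩 : Set (Module.End R M)}
    {f₀ : Module.End R M} (h₀ : IsNilpotent f₀)
    (h : ∀ f ∈ 𝒩, ∃ a r : R, r ∉ p ∧ r • f = a • f₀) {α : Module.Dual R M} {e : M}
    (hα : α e ∉ p) : LineRing.conormal p 𝒩 ≠ ⊤ := by
  intro htop
  -- The functionals which agree modulo `p` with one in the image of the transpose of `f₀`.
  let 𝒮 : Submodule R (Module.Dual R M) :=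
    { carrier := {α | ∃ β : Module.Dual R M, ∀ e, α e - β (f₀ e) ∈ p}
      add_mem' := by
        rintro α α' ⟨β, hβ⟩ ⟨β', hβ'⟩
        refine ⟨β + β', fun e ↦ ?_⟩
        rw [LinearMap.add_apply, LinearMap.add_apply, add_sub_add_comm]
        exact p.add_mem (hβ e) (hβ' e)
      zero_mem' := ⟨0, fun e ↦ by simp⟩
      smul_mem' := by
        rintro c α ⟨β, hβ⟩
        refine ⟨c • β, fun e ↦ ?_⟩
        rw [LinearMap.smul_apply, LinearMap.smul_apply, ← smul_sub]
        exact p.mul_mem_left c (hβ e) }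
  have hle : LineRing.conormal p 𝒩 ≤ 𝒮 := by
    refine sup_le (Submodule.smul_le.mpr fun r hr γ _ ↦ ⟨0, fun e ↦ ?_⟩) (Submodule.span_le.mpr ?_)
    · simpa using p.mul_mem_right (γ e) hr
    · rintro _ ⟨f, hf, β, rfl⟩
      obtain ⟨a, r, hr, hf'⟩ := h f hf
      obtain ⟨s, hs⟩ := hp.exists_inv hr
      obtain ⟨i, hi, hs⟩ := hs
      refine ⟨(s * a) • β, fun e ↦ ?_⟩
      have e₁ := congr(β ($hf' e))
      simp only [LinearMap.smul_apply, map_smul, smul_eq_mul] at e₁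
      have e₂ : (β ∘ₗ f) e - ((s * a) • β) (f₀ e) = β (f e) * i := by
        simp only [LinearMap.comp_apply, LinearMap.smul_apply, smul_eq_mul]
        linear_combination s * e₁ - β (f e) * hs
      rw [e₂]
      exact p.mul_mem_left _ hi
  have key (k : ℕ) : ∃ β : Module.Dual R M, ∀ e, α e - β ((f₀ ^ k) e) ∈ p := by
    induction k with
    | zero => exact ⟨α, fun e ↦ by simp⟩
    | succ k ih =>
      obtain ⟨β, hβ⟩ := ih
      obtain ⟨γ, hγ⟩ : β ∈ 𝒮 := hle (htop ▸ Submodule.mem_top)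
      refine ⟨γ, fun e ↦ ?_⟩
      have := p.add_mem (hβ e) (hγ ((f₀ ^ k) e))
      rwa [sub_add_sub_cancel, ← Module.End.mul_apply, ← pow_succ'] at this
  obtain ⟨n, hn⟩ := h₀
  obtain ⟨β, hβ⟩ := key n
  exact hα (by simpa [hn] using hβ e)

variable {Ω : Type*} [AddCommGroup Ω] [Module R Ω] {ι : Type*} [Fintype ι]
  {T : Module.Dual R Ω → Module.End R M} {lam : ι → Ω} {N : ℕ}

variable [IsDomain R] [Module.IsTorsionFree R M] [DecidableEq ι]
  [Module.Finite R M] [Module.Projective R M]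

/-- The scheme of invariant lines in a common generalized eigenspace is connected. -/
lemma IsSpectral.connectedSpace_proj [IsJacobsonRing R] (h : IsSpectral T lam N) (v : ι)
    (T' : Module.Dual R Ω → Module.End R (commonGenEigenspace T (lam v)))
    (hT' : ∀ D e, (T' D e : M) = T D e)
    (hp : ∀ p : Ideal R, p.IsMaximal → ∃ (D : Module.Dual R Ω) (ω : Ω)
      (α : Module.Dual R (commonGenEigenspace T (lam v))) (e : _), D ω ∉ p ∧ α e ∉ p) :
    ConnectedSpace (Proj (LineRing.deg R (commonGenEigenspace T (lam v)) (Set.range T'))) := by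
  obtain ⟨π, hπ⟩ := h.exists_isDecomposition
  let q : M →ₗ[R] commonGenEigenspace T (lam v) := (π v).codRestrict _ (hπ.mem v)
  have hq (x : commonGenEigenspace T (lam v)) : q x = x := Subtype.ext (hπ.apply_eq x.2)
  have : Module.Finite R (commonGenEigenspace T (lam v)) :=
    .of_surjective q fun x ↦ ⟨x, hq x⟩
  have : Module.Projective R (commonGenEigenspace T (lam v)) :=
    .of_split (commonGenEigenspace T (lam v)).subtype q (LinearMap.ext hq)
  let n (D : Module.Dual R Ω) : Module.End R (commonGenEigenspace T (lam v)) :=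
    T' D - D (lam v) • 1
  have hnil (D) : IsNilpotent (n D) := by
    refine ⟨N, LinearMap.ext fun e ↦ Subtype.ext ?_⟩
    have hk (k : ℕ) : ((n D ^ k) e : M) = ((T D - D (lam v) • 1) ^ k) (e : M) := by
      induction k with
      | zero => rfl
      | succ k ih =>
        rw [pow_succ', pow_succ', Module.End.mul_apply, Module.End.mul_apply, ← ih]
        simp [n, hT']
    rw [hk, h.sub_pow_apply_eq_zero D e.2]
    rfl
  refine LineRing.connectedSpace_proj (𝒩 := Set.range n) ?_ ?_ ?_ ?_
  · rintro _ ⟨D, rfl⟩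
    exact sub_mem (subset_quad ⟨D, rfl⟩) (Submodule.smul_mem _ _ one_mem_quad)
  · rintro _ ⟨D, rfl⟩
    exact hnil D
  · rintro _ ⟨D, rfl⟩
    exact ⟨_, D, rfl⟩
  · intro p hpm
    obtain ⟨D, ω, α, e, hD, hα⟩ := hp p hpm
    refine LineRing.conormal_ne_top (hnil D) ?_ hα
    rintro _ ⟨D', rfl⟩
    refine ⟨D' ω, D ω, hD, LinearMap.ext fun x ↦ Subtype.ext ?_⟩
    have e₁ := congr($(h.smul_comm D D' ω) (x : M))
    have e₂ := h.rank_one D D' ω (lam v)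
    simp only [LinearMap.smul_apply] at e₁
    simp [n, hT', smul_sub, e₁, smul_smul, e₂]

end Eigenlines

/-! ### Differential forms on a smooth curve -/

section RankOne

/-- A module is free of rank one on a generator `ω₀`, with dual generator `D₀`. (Over the zero ring,
this is no condition.) -/
def IsGenerator {R M : Type*} [CommRing R] [AddCommGroup M] [Module R M] (ω₀ : M)
    (D₀ : Module.Dual R M) : Prop :=
  D₀ ω₀ = 1 ∧ ∀ ω, D₀ ω • ω₀ = ω

variable {k R : Type u} [CommRing k] [CommRing R] [Algebra k R]

lemma exists_mem_notMem {s : Set R} (hs : Ideal.span s = ⊤) (p : Ideal R) (hp : p.IsMaximal) :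
    ∃ t ∈ s, t ∉ p := by
  by_contra! H
  exact hp.ne_top (eq_top_iff.mpr (hs ▸ Ideal.span_le.mpr H))

lemma isLocRing_away (t : R) :
    IsLocRing (IsScalarTower.toAlgHom k R (Localization.Away t)).toRingHom t := by
  have : (IsScalarTower.toAlgHom k R (Localization.Away t)).toRingHom.toAlgebra =
    (inferInstance : Algebra R (Localization.Away t)) := Algebra.algebra_ext _ _ fun _ ↦ rfl
  unfold IsLocRing
  rw [this]
  infer_instance

variable [Module.FinitePresentation R Ω[R⁄k]] {s : Set R} (hs : Ideal.span s = ⊤)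
  (hω : ∀ t ∈ s, ∃ (ω₀ : Ω[Localization.Away t⁄k]) (D₀ : Module.Dual (Localization.Away t) _),
    IsGenerator ω₀ D₀)

include hs hω

/-- Functionals on the differentials satisfy the relation of proportionality, if the differentials
are locally free of rank one. -/
lemma apply_mul_apply_comm (D D' : Module.Dual R Ω[R⁄k]) (ω ω' : Ω[R⁄k]) :
    D ω * D' ω' = D' ω * D ω' := by
  rw [← sub_eq_zero]
  set x := D ω * D' ω' - D' ω * D ω'
  let I : Ideal R := LinearMap.ker (LinearMap.toSpanSingleton R R x)
  suffices I = ⊤ by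
    have h₁ : (1 : R) ∈ I := this ▸ Submodule.mem_top
    simpa [I] using h₁
  by_contra hI
  obtain ⟨p, hp, hIp⟩ := Ideal.exists_le_maximal I hI
  obtain ⟨t, hts, htp⟩ := exists_mem_notMem hs p hp
  obtain ⟨ω₀, D₀, -, h₀⟩ := hω t hts
  let g := IsScalarTower.toAlgHom k R (Localization.Away t)
  have hg : IsLocRing g.toRingHom t := isLocRing_away t
  have hd (D : Module.Dual R Ω[R⁄k]) (ω) : algebraMap R (Localization.Away t) (D ω) =
      D₀ (omegaRes g ω) * dualExt hg (isLocMod_omegaRes hg) D ω₀ := by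
    rw [← smul_eq_mul, ← map_smul, h₀]
    exact (dualExt_apply _ _ _ _).symm
  have hx : algebraMap R (Localization.Away t) x = 0 := by
    simp only [x, map_sub, map_mul, hd]
    ring
  rw [IsLocalization.map_eq_zero_iff (.powers t)] at hx
  obtain ⟨⟨_, n, rfl⟩, hn⟩ := hx
  exact htp (hp.isPrime.mem_of_pow_mem n (hIp hn))

lemma exists_apply_notMem (p : Ideal R) (hp : p.IsMaximal) :
    ∃ (D : Module.Dual R Ω[R⁄k]) (ω : Ω[R⁄k]), D ω ∉ p := by
  obtain ⟨t, hts, htp⟩ := exists_mem_notMem hs p hp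
  obtain ⟨ω₀, D₀, h₁, -⟩ := hω t hts
  let g := IsScalarTower.toAlgHom k R (Localization.Away t)
  have hg : IsLocRing g.toRingHom t := isLocRing_away t
  obtain ⟨m, ω, hω⟩ := (isLocMod_omegaRes hg).surj ω₀
  obtain ⟨n, D, hD⟩ := (isLocMod_dualExt hg (isLocMod_omegaRes hg)).surj D₀
  refine ⟨D, ω, fun hmem ↦ htp ?_⟩
  have e : algebraMap R (Localization.Away t) (D ω - t ^ (n + m)) = 0 := by
    have := dualExt_apply hg (isLocMod_omegaRes hg) D ω
    rw [hD, hω, LinearMap.smul_apply, map_smul, h₁] at this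
    rw [map_sub, sub_eq_zero, map_pow, pow_add]
    refine Eq.trans this.symm ?_
    simp only [smul_eq_mul, mul_one]
    rfl
  rw [IsLocalization.map_eq_zero_iff (.powers t)] at e
  obtain ⟨⟨_, l, rfl⟩, hl⟩ := e
  have h₂ : t ^ l * t ^ (n + m) ∈ p := by
    have : t ^ l * t ^ (n + m) = t ^ l * D ω := by
      simp only at hl
      linear_combination -hl
    rw [this]
    exact p.mul_mem_left _ hmem
  rw [← pow_add] at h₂
  exact hp.isPrime.mem_of_pow_mem _ h₂

end RankOne

section Curve

variable {B : Scheme.{0}} [B.Over (Spec (.of ℂ))] [IsSmoothCurve B]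

lemma exists_isGenerator_of_isStandardSmooth {k R : Type u} [CommRing k] [CommRing R] [Algebra k R]
    [Algebra.IsStandardSmoothOfRelativeDimension 1 k R] :
    ∃ (ω₀ : Ω[R⁄k]) (D₀ : Module.Dual R Ω[R⁄k]), IsGenerator ω₀ D₀ := by
  cases subsingleton_or_nontrivial R
  · exact ⟨0, 0, Subsingleton.elim _ _, fun ω ↦
      (Module.subsingleton R Ω[R⁄k]).elim _ _⟩
  have : Algebra.IsStandardSmooth k R :=
    Algebra.IsStandardSmoothOfRelativeDimension.isStandardSmooth 1
  have h := Algebra.IsStandardSmoothOfRelativeDimension.rank_kaehlerDifferential (R := k) (S := R) 1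
  let b := Module.finBasisOfFinrankEq R Ω[R⁄k] (n := 1) (Module.finrank_eq_of_rank_eq h)
  refine ⟨b 0, b.coord 0, by simp, fun ω ↦ ?_⟩
  conv_rhs => rw [← b.sum_repr ω]
  simp

/-- A smooth affine curve is covered by basic open subsets which are standard smooth of relative
dimension one; on these, the differentials are free of rank one. -/
lemma exists_span_isStandardSmooth (W : B.AffineZariskiSite) :
    ∃ s : Set Γ(B, W.toOpens), Ideal.span s = ⊤ ∧
      ∀ t ∈ s, Algebra.IsStandardSmoothOfRelativeDimension 1 ℂ (Localization.Away t) := by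
  have hs : SmoothOfRelativeDimension 1 (B ↘ Spec (.of ℂ)) := IsSmoothCurve.smooth
  obtain ⟨s, hs, h⟩ := HasRingHomProperty.appLE (P := @SmoothOfRelativeDimension 1)
    (B ↘ Spec (.of ℂ)) hs ⟨⊤, isAffineOpen_top _⟩ ⟨W.toOpens, W.2⟩ le_top
  refine ⟨s, hs, fun t ht ↦ ?_⟩
  have h₁ := (RingHom.isStandardSmoothOfRelativeDimension_respectsIso (n := 1)).2 _
    (Scheme.ΓSpecIso (.of ℂ)).symm.commRingCatIsoToRingEquiv (h t ht)
  exact (RingHom.isStandardSmoothOfRelativeDimension_algebraMap _).mp h₁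

instance (W : B.AffineZariskiSite) : Module.FinitePresentation Γ(B, W.toOpens)
    Ω[Γ(B, W.toOpens)⁄ℂ] := finitePresentation_omega W

lemma omega_apply_mul_apply_comm (W : B.AffineZariskiSite)
    (D D' : Module.Dual Γ(B, W.toOpens) Ω[Γ(B, W.toOpens)⁄ℂ]) (ω ω' : Ω[Γ(B, W.toOpens)⁄ℂ]) :
    D ω * D' ω' = D' ω * D ω' := by
  obtain ⟨s, hs, h⟩ := exists_span_isStandardSmooth W
  exact apply_mul_apply_comm hs (fun t ht ↦
    have := h t ht
    exists_isGenerator_of_isStandardSmooth) _ _ _ _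

lemma exists_vectorField_notMem (W : B.AffineZariskiSite)
    (p : Ideal Γ(B, W.toOpens)) (hp : p.IsMaximal) :
    ∃ (D : Module.Dual Γ(B, W.toOpens) Ω[Γ(B, W.toOpens)⁄ℂ]) (ω : _), D ω ∉ p := by
  obtain ⟨s, hs, h⟩ := exists_span_isStandardSmooth W
  exact exists_apply_notMem hs (fun t ht ↦
    have := h t ht
    exists_isGenerator_of_isStandardSmooth) p hp

lemma smooth_sections (W : B.AffineZariskiSite) :
    Algebra.Smooth ℂ Γ(B, W.toOpens) := by
  have := IsSmoothCurve.smooth (B := B)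
  have := SmoothOfRelativeDimension.smooth 1 (B ↘ Spec (.of ℂ))
  have h := (B ↘ Spec (.of ℂ)).smooth_appLE (isAffineOpen_top _) W.2 le_top
  have h₁ := RingHom.Smooth.propertyIsLocal.respectsIso.2 _
    (Scheme.ΓSpecIso (.of ℂ)).symm.commRingCatIsoToRingEquiv h
  exact RingHom.smooth_algebraMap.mp h₁

instance (W : B.AffineZariskiSite) : Module.Projective Γ(B, W.toOpens) Ω[Γ(B, W.toOpens)⁄ℂ] := by
  have := smooth_sections W
  infer_instance

instance (W : B.AffineZariskiSite) : IsJacobsonRing Γ(B, W.toOpens) := by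
  have := smooth_sections W
  have : IsJacobsonRing ℂ := inferInstance
  exact isJacobsonRing_of_finiteType (A := ℂ)

end Curve

/-! ### Generalized eigensheaves of a Higgs field of constant Jordan type -/

section Algebra

lemma mem_radical_of_forall_isMaximal {R : Type*} [CommRing R] [IsJacobsonRing R] {I : Ideal R}
    {x : R} (h : ∀ q : Ideal R, q.IsMaximal → I ≤ q → x ∈ q) : x ∈ I.radical := by
  rw [Ideal.radical_eq_jacobson, Ideal.jacobson, Submodule.mem_sInf]
  exact fun q hq ↦ h q hq.2 hq.1

/-- An element of `M ⊗ Ω` is determined by its contractions with the functionals on `Ω`. -/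
lemma mem_range_rTensor_of_contract_mem {k R M : Type u} [CommRing k] [CommRing R] [Algebra k R]
    [AddCommGroup M] [Module R M] [Module.Finite R Ω[R⁄k]] [Module.Projective R Ω[R⁄k]]
    (φ : M →ₗ[R] M ⊗[R] Ω[R⁄k]) (F : Submodule R M) (e : M) (h : ∀ D, contract φ D e ∈ F) :
    φ e ∈ LinearMap.range (LinearMap.rTensor Ω[R⁄k] F.subtype) := by
  obtain ⟨n, m, γ, hm⟩ := exists_dualBasis R Ω[R⁄k]
  have key (t : M ⊗[R] Ω[R⁄k]) :
      ∑ i, (TensorProduct.rid R M (LinearMap.lTensor M (γ i) t)) ⊗ₜ[R] m i = t := by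
    induction t using TensorProduct.induction_on with
    | zero => simp
    | add x y hx hy => simp only [map_add, TensorProduct.add_tmul, Finset.sum_add_distrib, hx, hy]
    | tmul x ω =>
      conv_rhs => rw [← hm ω, TensorProduct.tmul_sum]
      refine Finset.sum_congr rfl fun i _ ↦ ?_
      simp [TensorProduct.smul_tmul]
  rw [← key (φ e)]
  exact sum_mem fun i _ ↦ ⟨⟨_, h (γ i)⟩ ⊗ₜ m i, rfl⟩

end Algebra

section Eigensheaf

variable {B : Scheme.{0}} [B.Over (Spec (.of ℂ))] [IsSmoothCurve B] {U : B.Opens}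

omit [B.Over (Spec (.of ℂ))] [IsSmoothCurve B] in
lemma nonempty_of_nontrivial_sections {W : B.Opens} [Nontrivial Γ(B, W)] : Nonempty W := by
  by_contra H
  have hW : W = ⊥ := TopologicalSpace.Opens.ext (Set.isEmpty_coe_sort.mp (not_nonempty_iff.mp H))
  subst hW
  exact not_subsingleton Γ(B, ⊥) inferInstance

instance (W : B.Opens) [Nontrivial Γ(B, W)] : IsDomain Γ(B, W) := by
  have : IsIntegral B := IsSmoothCurve.isIntegral
  have : Nonempty W := nonempty_of_nontrivial_sections
  infer_instance

variable (𝔈 : HiggsBundle B)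

instance (W : B.AffineZariskiSite) : Module.Finite Γ(B, W.toOpens) Γ(𝔈.E, W.toOpens) := 𝔈.finite W

instance (W : B.AffineZariskiSite) : Module.Projective Γ(B, W.toOpens) Γ(𝔈.E, W.toOpens) :=
  𝔈.projective W

variable {𝔈} {s : ℕ} {lam : Fin s → OneForm U} {J : Fin s → ℕ} {size mult : ∀ v, Fin (J v) → ℕ}

omit [IsSmoothCurve B] in
/-- The product of the powers of `φ_D - lam_D` vanishes in the fibre at a closed point. The sum of
all block sizes serves as an exponent which is at least the size of every block. -/
lemma HiggsBundle.HasConstantJordanType.apply_aeval_mem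
    (h : 𝔈.HasConstantJordanType lam J size mult)
    (W : AffineIn U) (q : Ideal Γ(B, W.opens)) [q.IsMaximal]
    (D : Module.Dual Γ(B, W.opens) Ω[Γ(B, W.opens)⁄ℂ]) (hD : ∃ ω, D ω ∉ q)
    (γ : Module.Dual Γ(B, W.opens) Γ(𝔈.E, W.opens)) (e : Γ(𝔈.E, W.opens)) :
    γ (Polynomial.aeval (𝔈.endo W.1 D) (∏ v, (Polynomial.X - Polynomial.C (D ((lam v).val W))) ^
      (∑ v, ∑ j, size v j)) e) ∈ q := by
  set P := ∏ v, (Polynomial.X - Polynomial.C (D ((lam v).val W))) ^ (∑ v, ∑ j, size v j) with hP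
  have h₁ := (h.hasJordanType W q D hD).aeval_prod_eq_zero (N := ∑ v, ∑ j, size v j)
    fun v j ↦ (Finset.single_le_sum (f := fun j ↦ size v j) (by simp) (Finset.mem_univ j)).trans
      (Finset.single_le_sum (f := fun v ↦ ∑ j, size v j) (by simp) (Finset.mem_univ v))
  have h₂ : (Polynomial.aeval (𝔈.endo W.1 D) P).baseChange q.ResidueField = 0 := by
    have e₁ : (Polynomial.aeval (𝔈.endo W.1 D) P).baseChange q.ResidueField = Polynomial.aeval
        ((𝔈.endo W.1 D).baseChange q.ResidueField) (P.map (algebraMap _ q.ResidueField)) := by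
      rw [Polynomial.aeval_map_algebraMap]
      exact (Polynomial.aeval_algHom_apply (Module.End.baseChangeHom _ q.ResidueField _) _ P).symm
    rw [e₁, ← h₁, hP, Polynomial.map_prod]
    simp
  have h₃ := congr(γ.baseChange q.ResidueField ($h₂ ((1 : q.ResidueField) ⊗ₜ e)))
  rw [← Ideal.algebraMap_residueField_eq_zero]
  simpa [Algebra.smul_def] using h₃

/-- A Higgs field with constant Jordan type is spectral over every affine open subset. The
assertions hold at the closed points, hence everywhere since the rings of sections are Jacobson. -/
lemma HiggsBundle.HasConstantJordanType.isSpectral (h : 𝔈.HasConstantJordanType lam J size mult)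
    (W : AffineIn U) [Nontrivial Γ(B, W.opens)] :
    IsSpectral (𝔈.endo W.1) (fun v ↦ (lam v).val W) (∑ v, ∑ j, size v j) where
  rank_one := omega_apply_mul_apply_comm W.1
  smul_comm D D' ω := by
    have : D ω • D' = D' ω • D := LinearMap.ext fun ω' ↦ omega_apply_mul_apply_comm W.1 D D' ω ω'
    unfold endo
    rw [← contract_smul, ← contract_smul, this]
  exists_notMem := exists_vectorField_notMem W.1
  mem_radical D ω v w hvw := by
    refine mem_radical_of_forall_isMaximal fun q hq hle ↦ ?_
    by_contra hD
    refine hvw (h.injective W q D ⟨ω, hD⟩ ?_)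
    rw [← sub_eq_zero, ← map_sub, Ideal.algebraMap_residueField_eq_zero]
    exact hle (Ideal.mem_span_singleton_self _)
  aeval_eq_zero D ω hD := by
    refine LinearMap.ext fun e ↦ ?_
    obtain ⟨n, m, γ, hm⟩ := exists_dualBasis Γ(B, W.opens) Γ(𝔈.E, W.opens)
    rw [LinearMap.zero_apply]
    refine (hm _).symm.trans (Finset.sum_eq_zero fun i _ ↦ ?_)
    have h₁ : D ω * γ i (Polynomial.aeval (𝔈.endo W.1 D) (∏ v, (Polynomial.X -
        Polynomial.C (D ((lam v).val W))) ^ (∑ v, ∑ j, size v j)) e) ∈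
        (⊥ : Ideal Γ(B, W.opens)).radical := by
      refine mem_radical_of_forall_isMaximal fun q hq _ ↦ ?_
      by_cases hDq : D ω ∈ q
      · exact q.mul_mem_right _ hDq
      · exact q.mul_mem_left _ (h.apply_aeval_mem W q D ⟨ω, hDq⟩ (γ i) e)
    rw [Ideal.radical_bot_of_isReduced, Ideal.mem_bot] at h₁
    rw [(mul_eq_zero_iff_left hD).mp h₁, zero_smul]

omit [IsSmoothCurve B] in
lemma HiggsBundle.resMod_endo (𝔈 : HiggsBundle B) {V W : AffineIn U} (hVW : V ≤ W)
    (D : Module.Dual Γ(B, W.opens) Ω[Γ(B, W.opens)⁄ℂ])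
    (D' : Module.Dual Γ(B, V.opens) Ω[Γ(B, V.opens)⁄ℂ])
    (h : ∀ ω, D' (omegaRes (Higgs.res hVW) ω) = Higgs.res hVW (D ω)) (e : Γ(𝔈.E, W.opens)) :
    resMod 𝔈.E (AffineIn.opens_mono hVW) (𝔈.endo W.1 D e) =
      𝔈.endo V.1 D' (resMod 𝔈.E (AffineIn.opens_mono hVW) e) :=
  contract_res (Higgs.res hVW) (resMod 𝔈.E (AffineIn.opens_mono hVW)) (𝔈.φ W.1) (𝔈.φ V.1)
    (𝔈.φ_res _) D D' h e

lemma HiggsBundle.resMod_mem_genEigenspace (𝔈 : HiggsBundle B) (lam : OneForm U) {V W : AffineIn U}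
    (hVW : V ≤ W) {e : Γ(𝔈.E, W.opens)} (he : e ∈ 𝔈.genEigenspace lam W) :
    resMod 𝔈.E (AffineIn.opens_mono hVW) e ∈ 𝔈.genEigenspace lam V := by
  obtain ⟨r, hr⟩ := id hVW
  have hg := isLocRing_resAlg (V := V.1) (W := W.1) hVW r hr
  refine (Submodule.mem_iInf _).mpr fun D ↦ ?_
  -- A multiple of `D` by a unit extends to a vector field on `W`.
  obtain ⟨k, D', hD'⟩ := (isLocMod_dualExt hg (isLocMod_omegaRes hg)).surj D
  set c : Γ(B, V.opens) := Higgs.res hVW r ^ k with hc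
  have hcu : IsUnit c := hg.isUnit.pow k
  have hext (ω) : (c • D) (omegaRes (Higgs.res hVW) ω) = Higgs.res hVW (D' ω) := by
    erw [← hD']
    exact dualExt_apply _ _ _ _
  obtain ⟨n, hn⟩ := (Module.End.mem_maxGenEigenspace _ _ _).mp ((Submodule.mem_iInf _).mp he D')
  have key (n : ℕ) : c ^ n • ((𝔈.endo V.1 D - D (lam.val V) • 1) ^ n)
      (resMod 𝔈.E (AffineIn.opens_mono hVW) e) = resMod 𝔈.E (AffineIn.opens_mono hVW)
        (((𝔈.endo W.1 D' - D' (lam.val W) • 1) ^ n) e) := by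
    induction n with
    | zero => simp
    | succ n ih =>
      have h₁ := 𝔈.resMod_endo hVW D' (c • D) hext
        (((𝔈.endo W.1 D' - D' (lam.val W) • 1) ^ n) e)
      have h₂ : 𝔈.endo V.1 (c • D) = c • 𝔈.endo V.1 D := contract_smul _ _ _
      have h₃ := hext (lam.val W)
      rw [lam.val_res] at h₃
      rw [pow_succ', pow_succ', pow_succ', Module.End.mul_apply, Module.End.mul_apply, mul_smul,
        ← map_smul, ih, LinearMap.sub_apply, LinearMap.sub_apply, map_sub, h₁, h₂,
        LinearMap.smul_apply, LinearMap.smul_apply, LinearMap.smul_apply, smul_sub,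
        LinearMap.map_smulₛₗ, smul_smul, Module.End.one_apply, Module.End.one_apply]
      congr 2
  rw [Module.End.mem_maxGenEigenspace]
  refine ⟨n, (hcu.pow n).smul_left_cancel.mp ?_⟩
  rw [key, hn, map_zero, smul_zero]

/-- The sections over `W` are the direct sum of those of the eigensheaves. If `W` is empty, all
modules are zero, and any endomorphisms will do. -/
lemma HiggsBundle.HasConstantJordanType.exists_projections
    (h : 𝔈.HasConstantJordanType lam J size mult) (W : AffineIn U) :
    ∃ π : Fin s → Module.End Γ(B, W.opens) Γ(𝔈.E, W.opens),
      IsDecomposition (fun v ↦ 𝔈.genEigenspace (lam v) W) π ∧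
      ∀ v, π v ∈ quad (Set.range (𝔈.endo W.1)) := by
  cases subsingleton_or_nontrivial Γ(B, W.opens)
  · have : Subsingleton Γ(𝔈.E, W.opens) := Module.subsingleton Γ(B, W.opens) _
    refine ⟨fun _ ↦ 1, ⟨fun v e ↦ ?_, fun e ↦ Subsingleton.elim _ _,
      fun _ _ _ ↦ Subsingleton.elim _ _⟩, fun _ ↦ one_mem_quad⟩
    rw [Subsingleton.elim ((1 : Module.End _ _) e) 0]
    exact zero_mem _
  · obtain ⟨π, hπ⟩ := (h.isSpectral W).exists_isDecomposition
    exact ⟨π, hπ, (h.isSpectral W).mem_quad hπ⟩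

lemma HiggsBundle.HasConstantJordanType.endo_mem_genEigenspace
    (h : 𝔈.HasConstantJordanType lam J size mult) (W : AffineIn U)
    (D : Module.Dual Γ(B, W.opens) Ω[Γ(B, W.opens)⁄ℂ]) (v : Fin s) {e : Γ(𝔈.E, W.opens)}
    (he : e ∈ 𝔈.genEigenspace (lam v) W) : 𝔈.endo W.1 D e ∈ 𝔈.genEigenspace (lam v) W := by
  cases subsingleton_or_nontrivial Γ(B, W.opens)
  · have : Subsingleton Γ(𝔈.E, W.opens) := Module.subsingleton Γ(B, W.opens) _
    rwa [Subsingleton.elim (𝔈.endo W.1 D e) e]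
  · exact (h.isSpectral W).map_mem D he

/-- The generalized eigensheaf of a Higgs field with constant Jordan type, as a Higgs subbundle. -/
def HiggsBundle.HasConstantJordanType.eigensheaf (h : 𝔈.HasConstantJordanType lam J size mult)
    (v : Fin s) : HiggsSubbundle 𝔈 U where
  sec := 𝔈.genEigenspace (lam v)
  span_res {V W} hVW := by
    refine le_antisymm (Submodule.span_le.mpr ?_) fun y hy ↦ ?_
    · rintro _ ⟨e, he, rfl⟩
      exact 𝔈.resMod_mem_genEigenspace _ hVW he
    · have := 𝔈.isQuasicoherent
      obtain ⟨r, hr⟩ := id hVW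
      have hg := isLocRing_resAlg (V := V.1) (W := W.1) hVW r hr
      obtain ⟨k, x, hx⟩ := (isLocMod_resMod 𝔈.E (V := V.1) (W := W.1) hVW r hr).surj y
      obtain ⟨π, hπ, -⟩ := h.exists_projections W
      obtain ⟨ρ, hρ, -⟩ := h.exists_projections V
      have hu := hg.isUnit.pow k
      have h₁ : resMod 𝔈.E (AffineIn.opens_mono hVW) (π v x) =
          (resAlg (AffineIn.opens_mono hVW)).toRingHom r ^ k • y := by
        have h₂ := congr(ρ v (resMod 𝔈.E (AffineIn.opens_mono hVW) $(hπ.sum x)))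
        rw [map_sum, map_sum, Finset.sum_eq_single v (fun w _ hw ↦ hρ.zero hw.symm
            (𝔈.resMod_mem_genEigenspace _ hVW (hπ.mem w x))) (by simp),
          hρ.apply_eq (𝔈.resMod_mem_genEigenspace _ hVW (hπ.mem v x))] at h₂
        refine h₂.trans ((congrArg (ρ v) hx).trans ?_)
        rw [map_smul, hρ.apply_eq hy]
      have : y = hu.unit⁻¹.1 • resMod 𝔈.E (AffineIn.opens_mono hVW) (π v x) := by
        rw [h₁, smul_smul, hu.val_inv_mul, one_smul]
      rw [this]
      exact Submodule.smul_mem _ _ (Submodule.subset_span ⟨_, hπ.mem v x, rfl⟩)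
  projective W := by
    obtain ⟨π, hπ, -⟩ := h.exists_projections W
    exact hπ.projective v
  invariant W e he := mem_range_rTensor_of_contract_mem (𝔈.φ W.1) _ e
    fun D ↦ h.endo_mem_genEigenspace W D v he

lemma HiggsBundle.HasConstantJordanType.connectedSpace_hgrassOver
    (h : 𝔈.HasConstantJordanType lam J size mult) (v : Fin s) (W : AffineIn U)
    [Nontrivial Γ(B, W.opens)] : ConnectedSpace ((h.eigensheaf v).hgrassOver W) := by
  refine (h.isSpectral W).connectedSpace_proj v ((h.eigensheaf v).endo W) (fun _ _ ↦ rfl) ?_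
  intro p hp
  obtain ⟨D, ω, hD⟩ := exists_vectorField_notMem W.1 p hp
  have hD₀ : D ω ≠ 0 := fun e ↦ hD (e ▸ p.zero_mem)
  obtain ⟨b, hb, hTb⟩ := (h.hasJordanType W p D ⟨ω, hD⟩).exists_eigenvector v (h.pos_J v)
    (h.pos_size v) (h.pos_mult v)
  obtain ⟨α, e, hα⟩ := (h.isSpectral W).exists_dual_notMem hD₀ p v
    (fun w hw ↦ ((h.injective W p D ⟨ω, hD⟩).ne hw).symm) hb hTb
  exact ⟨D, ω, α, e, hD, hα⟩

end Eigensheaf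

/-! ### The decomposition of the Higgs Grassmannian -/

section Transport

/-- Preserving the universal line is invariant under isomorphisms of modules. -/
lemma mem_quad_of_equiv {R : Type u} [CommRing R] {M M' : Type u} [AddCommGroup M] [Module R M]
    [AddCommGroup M'] [Module R M'] {Φ : Set (Module.End R M)} {Φ' : Set (Module.End R M')}
    (e : M' ≃ₗ[R] M) (hΦ : ∀ φ ∈ Φ, ∃ φ' ∈ Φ', ∀ x, e (φ' x) = φ (e x)) {f : Module.End R M}
    {f' : Module.End R M'} (hf : f ∈ quad Φ) (hf' : ∀ x, e (f' x) = f (e x)) : f' ∈ quad Φ' := by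
  have hc : LineRing.Compat Φ Φ' (LineRing.dualRestrict e.toLinearMap) := by
    intro φ hφ
    obtain ⟨φ', h', H⟩ := hΦ φ hφ
    exact ⟨φ', h', fun α ↦ LinearMap.ext fun x ↦ congrArg α (H x).symm⟩
  intro α β
  have := congr(LineRing.mapRingHom _ _ hc
    $(hf (α ∘ₗ e.symm.toLinearMap) (β ∘ₗ e.symm.toLinearMap)))
  simp only [map_mul, LineRing.mapRingHom_coord] at this
  have e₁ (γ : Module.Dual R M') :
      LineRing.dualRestrict e.toLinearMap (γ ∘ₗ e.symm.toLinearMap) = γ :=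
    LinearMap.ext fun x ↦ by simp
  have e₂ (γ : Module.Dual R M') :
      LineRing.dualRestrict e.toLinearMap ((γ ∘ₗ e.symm.toLinearMap) ∘ₗ f) = γ ∘ₗ f' :=
    LinearMap.ext fun x ↦ by simp [← hf']
  rwa [e₁, e₁, e₂, e₂] at this

end Transport

section Glue

variable {S : Scheme.{0}} {𝒰 : S.OpenCover} [Category 𝒰.I₀] [𝒰.LocallyDirected]
  [Small.{0} 𝒰.I₀] [Quiver.IsThin 𝒰.I₀] (d d' : 𝒰.RelativeGluingData)

lemma map_cover_f {i j : 𝒰.I₀} (f : i ⟶ j) : d.functor.map f ≫ d.cover.f j = d.cover.f i :=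
  colimit.w d.functor f

lemma cover_f_gluedMap (η : d.functor ⟶ d'.functor) (i : 𝒰.I₀) :
    d.cover.f i ≫ gluedMap d d' η = η.app i ≫ d'.cover.f i :=
  ι_colimMap η i

end Glue

section Grassmannian

variable {B : Scheme.{0}} [B.Over (Spec (.of ℂ))] [IsSmoothCurve B] {U : B.Opens}

namespace HiggsSubbundle

variable {𝔈 : HiggsBundle B} (F : HiggsSubbundle 𝔈 U)

/-- The inclusion of the part of the Higgs Grassmannian over an affine open subset. -/
def hgrassι (W : AffineIn U) : F.hgrassOver W ⟶ F.hgrass := F.gluingData.cover.f W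

instance (W : AffineIn U) : IsOpenImmersion (F.hgrassι W) :=
  F.gluingData.cover.map_prop W

lemma exists_hgrassι_eq (x : F.hgrass) : ∃ W y, F.hgrassι W y = x :=
  ⟨_, F.gluingData.cover.exists_eq x |>.choose_spec⟩

lemma hgrassOverRes_hgrassι {V W : AffineIn U} (h : V ≤ W) :
    F.hgrassOverRes h ≫ F.hgrassι W = F.hgrassι V :=
  map_cover_f F.gluingData (homOfLE h)

lemma hgrassι_toBase (W : AffineIn U) : F.hgrassι W ≫ F.hgrassToBase =
    (F.hgrassOverToSpec W ≫ W.1.2.isoSpec.inv) ≫ B.homOfLE W.2 :=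
  F.gluingData.ι_toBase W

lemma hgrassι_incl (W : AffineIn U) :
    F.hgrassι W ≫ F.hgrassIncl = F.hgrassOverIncl W ≫ (𝔈.restrict U).hgrassι W :=
  cover_f_gluedMap _ _ F.hgrassInclNatTrans W

omit [IsSmoothCurve B] in
lemma hgrassOverIncl_toSpec (W : AffineIn U) :
    F.hgrassOverIncl W ≫ (𝔈.restrict U).hgrassOverToSpec W = F.hgrassOverToSpec W := by
  refine (LineRing.projMap_base _ _ _ _).trans ?_
  have : Spec.map (CommRingCat.ofHom (RingHom.id Γ(B, W.opens))) = 𝟙 _ := Spec.map_id _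
  erw [this, Category.comp_id]
  rfl

lemma hgrassIncl_toBase : F.hgrassIncl ≫ (𝔈.restrict U).hgrassToBase = F.hgrassToBase := by
  refine F.gluingData.cover.hom_ext _ _ fun (W : AffineIn U) ↦ ?_
  change F.hgrassι W ≫ _ = F.hgrassι W ≫ _
  rw [← Category.assoc, hgrassι_incl, Category.assoc, hgrassι_toBase, hgrassι_toBase,
    ← Category.assoc, ← Category.assoc, hgrassOverIncl_toSpec]

/-- The canonical morphism of Grassmannians restricts to `hgrassOverIncl` over `W`. -/
lemma isPullback_hgrassOverIncl (W : AffineIn U) :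
    IsPullback (F.hgrassOverIncl W) (F.hgrassι W) ((𝔈.restrict U).hgrassι W) F.hgrassIncl := by
  refine IsPullback.of_right ?_ (F.hgrassι_incl W).symm
    ((𝔈.restrict U).gluingData.isPullback_natTrans_ι_toBase W)
  have h := F.gluingData.isPullback_natTrans_ι_toBase W
  have e : F.hgrassOverIncl W ≫ (𝔈.restrict U).gluingData.natTrans.app W =
      F.gluingData.natTrans.app W :=
    (Category.assoc _ _ _).symm.trans (congrArg (· ≫ _) (F.hgrassOverIncl_toSpec W))
  have e' : F.hgrassIncl ≫ (𝔈.restrict U).gluingData.toBase = F.gluingData.toBase :=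
    F.hgrassIncl_toBase
  rw [e, e']
  exact h

lemma isOpenImmersion_hgrassIncl (H : ∀ W, IsOpenImmersion (F.hgrassOverIncl W)) :
    IsOpenImmersion F.hgrassIncl := by
  refine IsZariskiLocalAtTarget.of_openCover (𝔈.restrict U).gluingData.cover ?_
  suffices ∀ W, IsOpenImmersion (pullback.snd F.hgrassIncl ((𝔈.restrict U).hgrassι W)) from this
  intro W
  have := H W
  rw [← (F.isPullback_hgrassOverIncl W).flip.isoPullback_inv_snd]
  infer_instance

end HiggsSubbundle

namespace HiggsBundle.HasConstantJordanType

variable {𝔈 : HiggsBundle B} {s : ℕ} {lam : Fin s → OneForm U} {J : Fin s → ℕ}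
  {size mult : ∀ v, Fin (J v) → ℕ} (h : 𝔈.HasConstantJordanType lam J size mult)

/-- The inclusion of the sections of an eigensheaf in those of the Higgs bundle. -/
abbrev incl (v : Fin s) (W : AffineIn U) :
    (h.eigensheaf v).sec W →ₗ[Γ(B, W.opens)] (𝔈.restrict U).sec W :=
  Submodule.inclusion le_top

/-- The projections onto the eigensheaves, as maps on the sections of the restriction of the Higgs
bundle to `U`. -/
lemma exists_retractions (W : AffineIn U) :
    ∃ π : ∀ v, (𝔈.restrict U).sec W →ₗ[Γ(B, W.opens)] (h.eigensheaf v).sec W,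
      (∀ v x, π v (h.incl v W x) = x) ∧ (∀ v w, v ≠ w → ∀ x, π v (h.incl w W x) = 0) ∧
      (∀ e, ∑ v, h.incl v W (π v e) = e) ∧
      (∀ v, ∀ ψ ∈ (h.eigensheaf v).endos W, ∃ φ ∈ (𝔈.restrict U).endos W,
        ∀ e, ψ (π v e) = π v (φ e)) ∧
      ∀ v, h.incl v W ∘ₗ π v ∈ quad ((𝔈.restrict U).endos W) := by
  obtain ⟨π, hπ, hq⟩ := h.exists_projections W
  refine ⟨fun v ↦ (π v).codRestrict _ (hπ.mem v) ∘ₗ Submodule.subtype _,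
    fun v x ↦ Subtype.ext (hπ.apply_eq x.2), fun v w hvw x ↦ Subtype.ext (hπ.zero hvw x.2),
    fun e ↦ Subtype.ext ?_, ?_, fun v ↦ ?_⟩
  · rw [← hπ.sum e.1, ← Submodule.subtype_apply, map_sum]
    rfl
  · rintro v _ ⟨D, rfl⟩
    refine ⟨_, ⟨D, rfl⟩, fun e ↦ Subtype.ext ?_⟩
    exact LinearMap.congr_fun (hπ.commute
      (fun v e he ↦ h.endo_mem_genEigenspace W D v he) v).eq e.1
  · refine mem_quad_of_equiv (LinearEquiv.ofTop _ rfl) ?_ (hq v) fun x ↦ rfl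
    rintro _ ⟨D, rfl⟩
    exact ⟨_, ⟨D, rfl⟩, fun x ↦ rfl⟩

instance isOpenImmersion_hgrassIncl (v : Fin s) :
    IsOpenImmersion (h.eigensheaf v).hgrassIncl := by
  refine (h.eigensheaf v).isOpenImmersion_hgrassIncl fun W ↦ ?_
  obtain ⟨π, h₁, -, -, h₂, h₃⟩ := h.exists_retractions W
  exact LineRing.isOpenImmersion_projMap (π v) (h₁ v) (h₂ v) (h₃ v) _ _

lemma hgrassIncl_ne {v w : Fin s} (hvw : v ≠ w) (y : (h.eigensheaf v).hgrass)
    (z : (h.eigensheaf w).hgrass) :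
    (h.eigensheaf v).hgrassIncl y ≠ (h.eigensheaf w).hgrassIncl z := by
  intro e
  obtain ⟨W, y, rfl⟩ := (h.eigensheaf v).exists_hgrassι_eq y
  rw [← Scheme.Hom.comp_apply, HiggsSubbundle.hgrassι_incl, Scheme.Hom.comp_apply] at e
  obtain ⟨z, hz, -⟩ := Scheme.exists_preimage_of_isPullback
    ((h.eigensheaf w).isPullback_hgrassOverIncl W) _ _ e
  obtain ⟨π, h₁, h₀, -⟩ := h.exists_retractions W
  exact LineRing.projMap_ne (π v) (h₁ v) _ _ (h₀ v w hvw) _ _ y z hz.symm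

lemma exists_hgrassIncl_eq (x : (𝔈.restrict U).hgrass) :
    ∃ v y, (h.eigensheaf v).hgrassIncl y = x := by
  obtain ⟨W, x, rfl⟩ := (𝔈.restrict U).exists_hgrassι_eq x
  obtain ⟨π, h₁, -, hsum, h₂, h₃⟩ := h.exists_retractions W
  suffices ∃ v, x ∈ Set.range ((h.eigensheaf v).hgrassOverIncl W) by
    obtain ⟨v, y, rfl⟩ := this
    refine ⟨v, (h.eigensheaf v).hgrassι W y, ?_⟩
    rw [← Scheme.Hom.comp_apply, HiggsSubbundle.hgrassι_incl, Scheme.Hom.comp_apply]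
  obtain ⟨v, α, hα⟩ := LineRing.exists_mem_basicOpen_comp hsum x
  exact ⟨v, LineRing.basicOpen_le_range_projMap (π v) (h₁ v) (h₂ v) (h₃ v) _ _ _ hα⟩

lemma isIso_sigmaDesc_hgrassIncl : IsIso (Sigma.desc fun v ↦ (h.eigensheaf v).hgrassIncl) := by
  have : IsOpenImmersion (Sigma.desc fun v ↦ (h.eigensheaf v).hgrassIncl) := by
    refine isOpenImmersion_sigmaDesc _ _ fun v w hvw ↦ Set.disjoint_iff_forall_ne.mpr ?_
    rintro _ ⟨y, rfl⟩ _ ⟨z, rfl⟩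
    exact h.hgrassIncl_ne hvw y z
  refine isIso_of_isOpenImmersion_of_opensRange_eq_top _ (eq_top_iff.mpr fun x _ ↦ ?_)
  obtain ⟨v, y, rfl⟩ := h.exists_hgrassIncl_eq x
  refine ⟨Sigma.ι (fun v ↦ (h.eigensheaf v).hgrass) v y, ?_⟩
  rw [← Scheme.Hom.comp_apply, Sigma.ι_desc]

/-- The parts of the Higgs Grassmannian over the nonempty affine open subsets of `U` are connected
and meet pairwise, since `U` is irreducible. -/
lemma connectedSpace_hgrass (hU : (U : Set B).Nonempty) (v : Fin s) :
    ConnectedSpace (h.eigensheaf v).hgrass := by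
  have : IsIntegral B := IsSmoothCurve.isIntegral
  let I := {W : AffineIn U // Nontrivial Γ(B, W.opens)}
  let t (W : I) : Set (h.eigensheaf v).hgrass := Set.range ((h.eigensheaf v).hgrassι W.1)
  have hconn (W : I) : ConnectedSpace ((h.eigensheaf v).hgrassOver W.1) :=
    have := W.2
    h.connectedSpace_hgrassOver v W.1
  have hpre (W : I) : _root_.IsPreconnected (t W) :=
    isPreconnected_range ((h.eigensheaf v).hgrassι W.1).continuous
  have hmeet (V W : I) : (t V ∩ t W).Nonempty := by
    have := V.2
    have := W.2
    obtain ⟨a⟩ := nonempty_of_nontrivial_sections (W := V.1.opens)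
    obtain ⟨b⟩ := nonempty_of_nontrivial_sections (W := W.1.opens)
    obtain ⟨c, hcV, hcW⟩ :=
      nonempty_preirreducible_inter V.1.opens.2 W.1.opens.2 ⟨a.1, a.2⟩ ⟨b.1, b.2⟩
    obtain ⟨f, g, e, hxf⟩ := exists_basicOpen_le_affine_inter V.1.1.2 W.1.1.2 c ⟨hcV, hcW⟩
    let X : AffineIn U := ⟨V.1.1.basicOpen f, (B.basicOpen_le f).trans V.1.2⟩
    have hV : X ≤ V.1 := ⟨f, rfl⟩
    have hW : X ≤ W.1 := ⟨g, e.symm⟩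
    have : Nonempty X.opens := ⟨⟨c, hxf⟩⟩
    have : Nontrivial Γ(B, X.opens) := inferInstance
    obtain ⟨y⟩ := (hconn ⟨X, this⟩).toNonempty
    refine ⟨(h.eigensheaf v).hgrassι X y, ?_, ?_⟩
    · rw [← (h.eigensheaf v).hgrassOverRes_hgrassι hV]
      exact ⟨_, rfl⟩
    · rw [← (h.eigensheaf v).hgrassOverRes_hgrassι hW]
      exact ⟨_, rfl⟩
  have hcov : ⋃ W, t W = Set.univ := by
    refine Set.eq_univ_of_forall fun x ↦ ?_
    obtain ⟨W, y, rfl⟩ := (h.eigensheaf v).exists_hgrassι_eq x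
    refine Set.mem_iUnion.mpr ⟨⟨W, ?_⟩, y, rfl⟩
    by_contra H
    have : Subsingleton Γ(B, W.opens) := not_nontrivial_iff_subsingleton.mp H
    have : IsEmpty (Spec Γ(B, W.opens)) :=
      (inferInstance : IsEmpty (PrimeSpectrum Γ(B, W.opens)))
    exact this.false
      ((h.eigensheaf v).hgrassOverToSpec W y)
  have hne : Nonempty (h.eigensheaf v).hgrass := by
    obtain ⟨x, hx⟩ := hU
    obtain ⟨W, y, -⟩ := (affineCover U).exists_eq ⟨x, hx⟩
    have : Nonempty (AffineIn.opens W) := ⟨y⟩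
    have : Nontrivial Γ(B, AffineIn.opens W) := inferInstance
    exact ⟨(h.eigensheaf v).hgrassι W (hconn ⟨W, this⟩).toNonempty.some⟩
  have hpre' := _root_.IsPreconnected.iUnion_of_reflTransGen hpre fun V W ↦ .single (hmeet V W)
  rw [hcov] at hpre'
  exact { toPreconnectedSpace := ⟨hpre'⟩, toNonempty := hne }

end HiggsBundle.HasConstantJordanType

end Grassmannian

end Higgs
end

theorem mainTheorem1 (B : Scheme.{0}) [B.Over (Spec (.of ℂ))] [Higgs.IsSmoothCurve B]
    (𝔈 : Higgs.HiggsBundle B) (U : B.Opens) (hU : (U : Set B).Nonempty)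
    (s : ℕ) (lam : Fin s → Higgs.OneForm U) (J : Fin s → ℕ) (size mult : ∀ v, Fin (J v) → ℕ)
    (h : 𝔈.HasConstantJordanType lam J size mult) :
    ∃ F : Fin s → Higgs.HiggsSubbundle 𝔈 U,
      (∀ v W, (F v).sec W = 𝔈.genEigenspace (lam v) W) ∧
      (∀ v, ConnectedSpace (F v).hgrass) ∧
      IsIso (Sigma.desc fun v ↦ (F v).hgrassIncl) ∧
      Sigma.desc (fun v ↦ (F v).hgrassIncl) ≫ (𝔈.restrict U).hgrassToBase =
        Sigma.desc fun v ↦ (F v).hgrassToBase := by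
  refine ⟨h.eigensheaf, fun _ _ ↦ rfl, h.connectedSpace_hgrass hU,
    h.isIso_sigmaDesc_hgrassIncl, Sigma.hom_ext _ _ fun v ↦ ?_⟩
  rw [Sigma.ι_desc_assoc, Sigma.ι_desc, Higgs.HiggsSubbundle.hgrassIncl_toBase]
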